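/- Let $0\le r<n$ be integers and let $M$ be an oriented $n$-dimensional Riemannian manifold with oriented orthonormal frame bundle $P_{SO(M)}$. Then the following are equivalent: (a) $M$ admits a $Spin^{c,r}(n)$ structure whose twisted spinor bundle $S$ carries a smooth partially pure spinor field; (b) $M$ admits an almost CR hermitian structure of codimension $r$, i.e. a smooth sub-bundle $D\subset TM$ of rank $n-r$ together with a smooth bundle automorphism $J$ of $D$ with $J^2=-\mathrm{Id}_D$ that is orthogonal with respect to the metric. Here $Spin^{c,r}(n)=(Spin(n)\times Spin^c(r))/\{\pm(1,1)\}$, where $Spin^c(r)=(Spin(r)\times U(1))/\{\pm(1,1)\}$ and $Spin(0)=\{\pm1\}$. A $Spin^{c,r}(n)$ structure consists of a principal $SO(r)$ bundle $P_{SO(r)}$, a principal $U(1)$ bundle $P_{U(1)}$ and a principal $Spin^{c,r}(n)$ bundle $P$ over $M$ with a two-fold covering map $\Lambda:P\to P_{SO(M)}\times_M P_{SO(r)}\times_M P_{U(1)}$ over $M$ that is equivariant with respect to $[g,[h,z]]\mapsto(\lambda_n(g),\lambda_r(h),z^2)$, where $\lambda_k:Spin(k)\to SO(k)$ is the standard double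 covering. Let $\Delta_k=(\mathbb C^2)^{\otimes\lfloor k/2\rfloor}$ be the complex spin representation of the Clifford algebra of $\mathbb R^k$ (with $x\cdot x=-|x|^2$), and let $Spin^{c,r}(n)$ act on $\Delta_r\otimes\Delta_n$ by $[g,[h,z]]\mapsto z\,h\otimes g$. Put $\Sigma_r=\Delta_r$ if $r$ is odd or $r\in\{2,4\}$, and $\Sigma_r=\Delta_r^+$ (the half-spin space on which $f_1\cdots f_r$ acts as $i^{r/2}$) for all other even $r$. The twisted spinor bundle is $S=P\times_{Spin^{c,r}(n)}(\Sigma_r\otimes\Delta_n)$. Let $(e_i)$ and $(f_k)$ be the standard bases of $\mathbb R^n$ and $\mathbb R^r$, with Clifford multiplication acting on $\Delta_n$ and $\Delta_r$ respectively, and put $\eta^\phi_{kl}=\sum_{i<j}\mathrm{Re}\langle e_ie_j\cdot f_kf_l\cdot\phi,\phi\rangle\,e_i\wedge e_j$, where $e_i\wedge e_j$ ($i<j$) acts on spinors as $e_ie_j$. A unit vector $\phi\in\Sigma_r\otimes\Delta_n$ is partially pure if 1. there is a subspace $V^\phi\subset\mathbb R^n$ of dimension $n-r$ such that for every $X\in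 V^\phi$ there is a $Y\in V^\phi$ with $X\cdot\phi=i\,Y\cdot\phi$; 2. $(\eta^\phi_{kl}+f_kf_l)\cdot\phi=0$ and $\langle f_kf_l\cdot\phi,\phi\rangle=0$ for all $1\le k<l\le r$; 3. if $r=4$, moreover $\langle f_1f_2f_3f_4\cdot\phi,\phi\rangle=0$. A spinor field is partially pure if its value at every point is represented by partially pure vectors. -/

import Mathlib

open scoped Manifold ContDiff Bundle Matrix Kronecker

noncomputable section

namespace TwistedSpin

/-! ### Clifford algebras and their complex matrix representations -/

/-- The quadratic form `x ↦ -|x|²` on `ℝⁿ`. -/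
def negSq (n : ℕ) : QuadraticForm ℝ (Fin n → ℝ) :=
  QuadraticMap.weightedSumSquares ℝ (fun _ : Fin n => (-1 : ℝ))

theorem negSq_apply (n : ℕ) (x : Fin n → ℝ) : negSq n x = -(x ⬝ᵥ x) := by
  simp [negSq, QuadraticMap.weightedSumSquares_apply, dotProduct, Finset.sum_neg_distrib]

/-- The real Clifford algebra `Clₙ`, with `eⱼ eₖ + eₖ eⱼ = -2 ⟨eⱼ, eₖ⟩`. -/
abbrev Cl (n : ℕ) : Type := CliffordAlgebra (negSq n)

/-- The inclusion `ℝⁿ ⊂ Clₙ`. -/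
abbrev vec {n : ℕ} : (Fin n → ℝ) →ₗ[ℝ] Cl n := CliffordAlgebra.ι (negSq n)

/-- Indices of the standard basis of `(ℂ²)^{⊗ ⌊n/2⌋}`. The tensor factors are numbered from right
to left, so that the factor `0` is the rightmost one. -/
abbrev SpinIdx (n : ℕ) : Type := Fin (n / 2) → Fin 2

def g₁ : Matrix (Fin 2) (Fin 2) ℂ := !![Complex.I, 0; 0, -Complex.I]

def g₂ : Matrix (Fin 2) (Fin 2) ℂ := !![0, Complex.I; Complex.I, 0]

def matT : Matrix (Fin 2) (Fin 2) ℂ := !![0, -Complex.I; Complex.I, 0]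

/-- The tensor (Kronecker) product of the `2 × 2` matrices `A a`, acting on `(ℂ²)^{⊗ k}`. -/
def tensorMat {k : ℕ} (A : Fin k → Matrix (Fin 2) (Fin 2) ℂ) :
    Matrix (Fin k → Fin 2) (Fin k → Fin 2) ℂ :=
  Matrix.of fun s t => ∏ a, A a (s a) (t a)

/-- The tensor factor in position `a` of the image of the `j`-th standard basis vector (counted
from `0`): `T` to the right of position `⌊j/2⌋`, `g₁` or `g₂` there, the identity to the left of
it. -/
def genFactor {k : ℕ} (j : ℕ) (a : Fin k) : Matrix (Fin 2) (Fin 2) ℂ :=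
  if a.val < j / 2 then matT
  else if a.val = j / 2 then (if j % 2 = 0 then g₁ else g₂)
  else 1

/-- The matrix by which the `j`-th standard basis vector of `ℝⁿ` (counted from `0`) acts on `Δₙ`.
The extra factor `i` concerns the last basis vector of an odd-dimensional space, which acts as
`i T ⊗ ⋯ ⊗ T`. -/
def gen (n : ℕ) (j : Fin n) : Matrix (SpinIdx n) (SpinIdx n) ℂ :=
  (if j.val / 2 = n / 2 then Complex.I else 1) • tensorMat (genFactor j.val)

theorem tensorMat_mul {k : ℕ} (A B : Fin k → Matrix (Fin 2) (Fin 2) ℂ) :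
    tensorMat A * tensorMat B = tensorMat (fun a => A a * B a) := by
  ext s t
  simp only [tensorMat, Matrix.mul_apply, Matrix.of_apply]
  rw [Finset.prod_univ_sum]
  simp [Finset.prod_mul_distrib]

theorem tensorMat_one {k : ℕ} :
    tensorMat (fun _ : Fin k => (1 : Matrix (Fin 2) (Fin 2) ℂ)) = 1 := by
  ext s t
  simp only [tensorMat, Matrix.of_apply, Matrix.one_apply]
  by_cases h : s = t
  · simp [h]
  · obtain ⟨a, ha⟩ := Function.ne_iff.mp h
    rw [if_neg h]
    exact Finset.prod_eq_zero (Finset.mem_univ a) (by simp [ha])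

theorem tensorMat_neg_of {k : ℕ} {A B : Fin k → Matrix (Fin 2) (Fin 2) ℂ} (a : Fin k)
    (ha : A a = -B a) (h : ∀ b, b ≠ a → A b = B b) : tensorMat A = -tensorMat B := by
  ext s t
  simp only [tensorMat, Matrix.of_apply, Matrix.neg_apply]
  rw [← Finset.mul_prod_erase _ _ (Finset.mem_univ a),
    ← Finset.mul_prod_erase _ _ (Finset.mem_univ a), ha,
    Finset.prod_congr rfl (fun b hb => by rw [h b (Finset.ne_of_mem_erase hb)])]
  simp

theorem g₁_mul_self : g₁ * g₁ = -1 := by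
  ext i j; fin_cases i <;> fin_cases j <;> simp [g₁]

theorem g₂_mul_self : g₂ * g₂ = -1 := by
  ext i j; fin_cases i <;> fin_cases j <;> simp [g₂]

theorem matT_mul_self : matT * matT = 1 := by
  ext i j; fin_cases i <;> fin_cases j <;> simp [matT]

theorem g₁_mul_g₂ : g₁ * g₂ = -(g₂ * g₁) := by
  ext i j; fin_cases i <;> fin_cases j <;> simp [g₁, g₂]

theorem g₁_mul_matT : g₁ * matT = -(matT * g₁) := by
  ext i j; fin_cases i <;> fin_cases j <;> simp [g₁, matT]

theorem g₂_mul_matT : g₂ * matT = -(matT * g₂) := by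
  ext i j; fin_cases i <;> fin_cases j <;> simp [g₂, matT]

theorem gen_mul_self (n : ℕ) (j : Fin n) : gen n j * gen n j = -1 := by
  have hj := j.isLt
  rw [gen, smul_mul_smul_comm, tensorMat_mul]
  by_cases h : j.val / 2 = n / 2
  · have : (fun a : Fin (n / 2) => genFactor j.val a * genFactor j.val a) = fun _ => 1 := by
      funext a
      have : a.val < j.val / 2 := by omega
      simp [genFactor, this, matT_mul_self]
    rw [this, tensorMat_one, if_pos h]
    simp
  · have hlt : j.val / 2 < n / 2 := by omega
    rw [if_neg h, tensorMat_neg_of (B := fun _ => 1) ⟨j.val / 2, hlt⟩, tensorMat_one]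
    · simp
    · by_cases h2 : j.val % 2 = 0
      · simp [genFactor, h2, g₁_mul_self]
      · simp [genFactor, h2, g₂_mul_self]
    · intro b hb
      have : b.val ≠ j.val / 2 := fun h' => hb (Fin.ext h')
      by_cases hb2 : b.val < j.val / 2 <;> simp [genFactor, this, hb2, matT_mul_self]

theorem gen_anticomm_of_lt (n : ℕ) (i j : Fin n) (hij : i < j) :
    gen n i * gen n j = -(gen n j * gen n i) := by
  have hj := j.isLt
  have hij' : i.val < j.val := hij
  have hlt : i.val / 2 < n / 2 := by omega
  simp only [gen, smul_mul_smul_comm, tensorMat_mul]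
  rw [tensorMat_neg_of (B := fun a => genFactor j.val a * genFactor i.val a) ⟨i.val / 2, hlt⟩,
    smul_neg, mul_comm]
  · by_cases h : i.val / 2 = j.val / 2
    · have h1 : i.val % 2 = 0 := by omega
      have h2 : j.val % 2 = 1 := by omega
      simp [genFactor, ← h, h1, h2, g₁_mul_g₂]
    · have h1 : i.val / 2 < j.val / 2 := by omega
      by_cases h2 : i.val % 2 = 0
      · simp [genFactor, h1, h2, g₁_mul_matT]
      · simp [genFactor, h1, h2, g₂_mul_matT]
  · intro b hb
    have hb1 : b.val ≠ i.val / 2 := fun h' => hb (Fin.ext h')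
    by_cases hb2 : b.val < i.val / 2
    · have : b.val < j.val / 2 := by omega
      simp [genFactor, hb2, this]
    · simp [genFactor, hb1, hb2]

theorem gen_anticomm (n : ℕ) (i j : Fin n) :
    gen n i * gen n j + gen n j * gen n i = if i = j then -2 else 0 := by
  rcases lt_trichotomy i j with h | h | h
  · rw [gen_anticomm_of_lt n i j h, if_neg h.ne]; simp
  · subst h; rw [gen_mul_self, if_pos rfl]; norm_num
  · rw [gen_anticomm_of_lt n j i h, if_neg h.ne']; simp

/-- Clifford multiplication by vectors as a linear map `ℝⁿ → End(Δₙ)`. -/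
def vecMat (n : ℕ) : (Fin n → ℝ) →ₗ[ℝ] Matrix (SpinIdx n) (SpinIdx n) ℂ where
  toFun x := ∑ j, x j • gen n j
  map_add' x y := by simp [add_smul, Finset.sum_add_distrib]
  map_smul' c x := by simp [mul_smul, Finset.smul_sum]

theorem vecMat_mul_self (n : ℕ) (x : Fin n → ℝ) :
    vecMat n x * vecMat n x = algebraMap ℝ _ (negSq n x) := by
  have h1 : vecMat n x * vecMat n x = ∑ i, ∑ j, (x i * x j) • (gen n i * gen n j) := by
    simp only [vecMat, LinearMap.coe_mk, AddHom.coe_mk, Finset.sum_mul, Finset.mul_sum,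
      smul_mul_smul_comm]
    exact Finset.sum_comm
  have h2 : vecMat n x * vecMat n x = ∑ i, ∑ j, (x i * x j) • (gen n j * gen n i) := by
    rw [h1, Finset.sum_comm]
    exact Finset.sum_congr rfl fun i _ => Finset.sum_congr rfl fun j _ => by
      rw [mul_comm (x i) (x j)]
  have h3 : (2 : ℝ) • (vecMat n x * vecMat n x) = (2 : ℝ) • algebraMap ℝ _ (negSq n x) := by
    rw [two_smul]
    nth_rewrite 1 [h1]
    rw [h2]
    simp only [← Finset.sum_add_distrib, ← smul_add, gen_anticomm, smul_ite, smul_zero,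
      Finset.sum_ite_eq, Finset.mem_univ, if_true]
    rw [← Finset.sum_smul, negSq_apply, Algebra.algebraMap_eq_smul_one, smul_smul, mul_neg,
      neg_smul, smul_neg, mul_comm, mul_smul, two_smul, one_add_one_eq_two]
    rfl
  exact smul_right_injective _ (two_ne_zero) h3

/-- The representation `κ` of the Clifford algebra on `Δₙ = (ℂ²)^{⊗ ⌊n/2⌋}`. -/
def kappa (n : ℕ) : Cl n →ₐ[ℝ] Matrix (SpinIdx n) (SpinIdx n) ℂ :=
  CliffordAlgebra.lift (negSq n) ⟨vecMat n, vecMat_mul_self n⟩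

/-! ### The spin group and its double covering of the special orthogonal group -/

theorem vec_mul_self {n : ℕ} {x : Fin n → ℝ} (hx : x ⬝ᵥ x = 1) : vec x * vec x = -1 := by
  rw [CliffordAlgebra.ι_sq_scalar, negSq_apply, hx]; simp

/-- A unit vector as an invertible element of the Clifford algebra. -/
def unitVec {n : ℕ} (x : Fin n → ℝ) (hx : x ⬝ᵥ x = 1) : (Cl n)ˣ where
  val := vec x
  inv := -vec x
  val_inv := by rw [mul_neg, vec_mul_self hx, neg_neg]
  inv_val := by rw [neg_mul, vec_mul_self hx, neg_neg]

/-- `Spin(n) ⊂ Clₙ`, the group of all products of an even number of unit vectors. The element `-1`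
is such a product if `n ≥ 1`; listing it among the generators makes `Spin(0) = {±1}`. -/
def Spin (n : ℕ) : Subgroup (Cl n)ˣ :=
  Subgroup.closure
    ({u | ∃ (x y : Fin n → ℝ) (hx : x ⬝ᵥ x = 1) (hy : y ⬝ᵥ y = 1),
      u = unitVec x hx * unitVec y hy} ∪ {-1})

/-- The element `-1` of `Spin(n)`. -/
def Spin.negOne (n : ℕ) : Spin n := ⟨-1, Subgroup.subset_closure (Or.inr rfl)⟩

abbrev SO (n : ℕ) := Matrix.specialOrthogonalGroup (Fin n) ℝ

theorem vec_injective (n : ℕ) : Function.Injective (vec : (Fin n → ℝ) → Cl n) := by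
  rw [injective_iff_map_eq_zero]
  intro x hx
  have h := CliffordAlgebra.ι_sq_scalar (negSq n) x
  have h' := congrArg (kappa n) h
  rw [show CliffordAlgebra.ι (negSq n) x = 0 from hx, mul_zero, map_zero, AlgHom.commutes,
    negSq_apply] at h'
  have h2 : -(x ⬝ᵥ x) = 0 := by
    by_contra hne
    exact hne ((algebraMap ℝ (Matrix (SpinIdx n) (SpinIdx n) ℂ)).injective
      (by rw [← h', map_zero]))
  exact dotProduct_self_eq_zero.mp (neg_eq_zero.mp h2)

/-- The reflection in the hyperplane orthogonal to the unit vector `x`. -/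
def reflMat {n : ℕ} (x : Fin n → ℝ) : Matrix (Fin n) (Fin n) ℝ :=
  1 - (2 : ℝ) • Matrix.vecMulVec x x

theorem reflMat_mem {n : ℕ} {x : Fin n → ℝ} (hx : x ⬝ᵥ x = 1) :
    reflMat x ∈ Matrix.orthogonalGroup (Fin n) ℝ := by
  rw [Matrix.mem_orthogonalGroup_iff]
  have hT : (reflMat x)ᵀ = reflMat x := by
    ext i j
    simp [reflMat, Matrix.vecMulVec_apply, Matrix.one_apply, eq_comm, mul_comm]
  have h : Matrix.vecMulVec x x * Matrix.vecMulVec x x = Matrix.vecMulVec x x := by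
    rw [Matrix.vecMulVec_mul_vecMulVec, hx]; simp
  rw [hT, reflMat, sub_mul, mul_sub, mul_sub, smul_mul_smul_comm, h]
  simp only [one_mul, mul_one]
  module

theorem reflMat_det {n : ℕ} {x : Fin n → ℝ} (hx : x ⬝ᵥ x = 1) : (reflMat x).det = -1 := by
  have : reflMat x = 1 + Matrix.replicateCol Unit (-(2 : ℝ) • x) * Matrix.replicateRow Unit x := by
    ext i j
    simp [reflMat, Matrix.vecMulVec_apply, Matrix.mul_apply]
    ring
  rw [this, Matrix.det_one_add_replicateCol_mul_replicateRow, dotProduct_smul, hx]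
  norm_num

theorem unitVec_conj {n : ℕ} {x : Fin n → ℝ} (hx : x ⬝ᵥ x = 1) (v : Fin n → ℝ) :
    (unitVec x hx : Cl n) * vec v * ((unitVec x hx)⁻¹ : (Cl n)ˣ) = -vec (reflMat x *ᵥ v) := by
  have h1 : vec x * vec v = -(vec v * vec x) - algebraMap ℝ (Cl n) (2 * (x ⬝ᵥ v)) := by
    have := CliffordAlgebra.ι_mul_ι_add_swap (Q := negSq n) x v
    rw [eq_sub_of_add_eq this, QuadraticMap.polar, negSq_apply, negSq_apply, negSq_apply,
      add_dotProduct, dotProduct_add, dotProduct_add, dotProduct_comm v x,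
      sub_eq_iff_eq_add, sub_add_eq_add_sub, eq_sub_iff_add_eq]
    rw [add_right_comm, ← map_add]
    have : -(x ⬝ᵥ x + (x ⬝ᵥ v + v ⬝ᵥ v) + x ⬝ᵥ v) - -(x ⬝ᵥ x) - -(v ⬝ᵥ v) + 2 * (x ⬝ᵥ v) = 0 := by
      ring
    rw [this, map_zero, neg_add_cancel]
  have h2 : ((unitVec x hx : (Cl n)ˣ) : Cl n) = vec x := rfl
  have h3 : (((unitVec x hx)⁻¹ : (Cl n)ˣ) : Cl n) = -vec x := rfl
  have h4 : reflMat x *ᵥ v = v - (2 * (x ⬝ᵥ v)) • x := by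
    ext i
    simp [reflMat, Matrix.sub_mulVec, Matrix.smul_mulVec, Matrix.vecMulVec_mulVec]
    ring
  rw [h2, h3, h1, h4, mul_neg, sub_mul, neg_mul, mul_assoc, vec_mul_self hx, map_sub, map_smul,
    Algebra.smul_def]
  noncomm_ring

/-- `A` is the orthogonal transformation `v ↦ a v a⁻¹` of `ℝⁿ ⊂ Clₙ`. -/
def Covers {n : ℕ} (a : (Cl n)ˣ) (A : Matrix (Fin n) (Fin n) ℝ) : Prop :=
  ∀ v : Fin n → ℝ, (a : Cl n) * vec v * ((a⁻¹ : (Cl n)ˣ) : Cl n) = vec (A *ᵥ v)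

theorem Covers.mul {n : ℕ} {a b : (Cl n)ˣ} {A B : Matrix (Fin n) (Fin n) ℝ}
    (ha : Covers a A) (hb : Covers b B) : Covers (a * b) (A * B) := by
  intro v
  rw [← Matrix.mulVec_mulVec, ← ha, ← hb]
  simp only [mul_inv_rev, Units.val_mul, mul_assoc]

theorem Covers.unique {n : ℕ} {a : (Cl n)ˣ} {A B : Matrix (Fin n) (Fin n) ℝ}
    (hA : Covers a A) (hB : Covers a B) : A = B := by
  apply Matrix.ext_of_mulVec_single
  intro i
  exact vec_injective n ((hA _).symm.trans (hB _))

theorem Spin.exists_covers {n : ℕ} (a : (Cl n)ˣ) (ha : a ∈ Spin n) :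
    ∃ A : SO n, Covers a A.1 := by
  induction ha using Subgroup.closure_induction with
  | mem u hu =>
    rcases hu with ⟨x, y, hx, hy, rfl⟩ | rfl
    · refine ⟨⟨reflMat x * reflMat y, ?_⟩, ?_⟩
      · rw [Matrix.mem_specialOrthogonalGroup_iff]
        refine ⟨mul_mem (reflMat_mem hx) (reflMat_mem hy), ?_⟩
        rw [Matrix.det_mul, reflMat_det hx, reflMat_det hy]; norm_num
      · intro v
        have h1 := unitVec_conj hy v
        have h2 := unitVec_conj hx (reflMat y *ᵥ v)
        rw [← Matrix.mulVec_mulVec, mul_inv_rev, Units.val_mul, Units.val_mul]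
        rw [← neg_eq_iff_eq_neg] at h2
        rw [← h2, ← neg_eq_iff_eq_neg.mpr h1]
        noncomm_ring
    · exact ⟨1, fun v => by simp⟩
  | one => exact ⟨1, fun v => by simp⟩
  | mul a b _ _ iha ihb =>
    obtain ⟨A, hA⟩ := iha
    obtain ⟨B, hB⟩ := ihb
    exact ⟨A * B, hA.mul hB⟩
  | inv a _ ih =>
    obtain ⟨A, hA⟩ := ih
    refine ⟨A⁻¹, fun v => ?_⟩
    have h := hA ((A⁻¹ : SO n).1 *ᵥ v)
    have h1 : A.1 * (A⁻¹ : SO n).1 = 1 := congrArg Subtype.val (mul_inv_cancel A)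
    rw [Matrix.mulVec_mulVec, h1, Matrix.one_mulVec] at h
    rw [← h, inv_inv]
    simp only [← mul_assoc, Units.inv_mul, one_mul]
    simp only [mul_assoc, Units.inv_mul, mul_one]

/-- The double covering `λₙ : Spin(n) → SO(n)`, `λₙ(a) v = a v a⁻¹`. -/
def spinCover (n : ℕ) : Spin n →* SO n where
  toFun a := Classical.choose (Spin.exists_covers a.1 a.2)
  map_one' := Subtype.ext <|
    (Classical.choose_spec (Spin.exists_covers (1 : Spin n).1 (1 : Spin n).2)).unique
      (fun v => by simp)
  map_mul' a b := Subtype.ext <|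
    (Classical.choose_spec (Spin.exists_covers (a * b).1 (a * b).2)).unique
      ((Classical.choose_spec (Spin.exists_covers a.1 a.2)).mul
        (Classical.choose_spec (Spin.exists_covers b.1 b.2)))

theorem spinCover_spec {n : ℕ} (a : Spin n) : Covers a.1 (spinCover n a).1 :=
  Classical.choose_spec (Spin.exists_covers a.1 a.2)

theorem spinCover_negOne (n : ℕ) : spinCover n (Spin.negOne n) = 1 :=
  Subtype.ext ((spinCover_spec (Spin.negOne n)).unique (fun v => by simp [Spin.negOne]))

/-! ### The twisted spin group `Spin^{c,r}(n)` -/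

/-- The group `{(ε₁, ε₂, ε₃) ∈ {±1}³ : ε₁ ε₂ ε₃ = 1}`, as the subgroup of `Spin(n) × Spin(r) × U(1)`
generated by `(1, -1, -1)` and `(-1, -1, 1)`. -/
def signs (n r : ℕ) : Subgroup (Spin n × Spin r × Circle) :=
  Subgroup.closure {(1, Spin.negOne r, -1), (Spin.negOne n, Spin.negOne r, 1)}

theorem Spin.negOne_comm {n : ℕ} (a : Spin n) : a * Spin.negOne n = Spin.negOne n * a := by
  apply Subtype.ext
  simp [Spin.negOne]

instance signs_normal (n r : ℕ) : (signs n r).Normal := by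
  have h : signs n r ≤ Subgroup.center _ := by
    rw [signs, Subgroup.closure_le]
    rintro u (rfl | rfl) <;> rw [SetLike.mem_coe, Subgroup.mem_center_iff] <;> rintro ⟨a, b, z⟩ <;>
      simp [Spin.negOne_comm]
  refine ⟨fun u hu g => ?_⟩
  rw [(Subgroup.mem_center_iff.mp (h hu)) g]
  simpa using hu

/-- `Spin^{c,r}(n) = (Spin(n) × Spin^c(r)) / {±(1,1)}` with `Spin^c(r) = (Spin(r) × U(1)) / {±(1,1)}`.
The class of `(g, h, z)` is the element `[g, [h, z]]`. -/
abbrev SpinCR (n r : ℕ) : Type := (Spin n × Spin r × Circle) ⧸ signs n r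

/-- The two-fold covering `λ_{n,r,2} : Spin^{c,r}(n) → SO(n) × SO(r) × U(1)`,
`[g, [h, z]] ↦ (λₙ(g), λᵣ(h), z²)`. -/
def coverCR (n r : ℕ) : SpinCR n r →* SO n × SO r × Circle :=
  QuotientGroup.lift (signs n r)
    ((spinCover n).prodMap ((spinCover r).prodMap (powMonoidHom 2)))
    (by
      rw [signs, Subgroup.closure_le]
      rintro u (rfl | rfl) <;> simp [MonoidHom.mem_ker, spinCover_negOne])

/-! ### Twisted spinors -/

/-- The twisted spin representation space `Δᵣ ⊗ Δₙ`, in coordinates with respect to the standard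
basis of `(ℂ²)^{⊗ ⌊r/2⌋} ⊗ (ℂ²)^{⊗ ⌊n/2⌋}`. -/
abbrev TwistedSpinor (r n : ℕ) : Type := SpinIdx r × SpinIdx n → ℂ

/-- The representation `[g, [h, z]] ↦ z κᵣ(h) ⊗ κₙ(g)` of `Spin^{c,r}(n)` on `Δᵣ ⊗ Δₙ`. -/
def repCR (n r : ℕ) :
    SpinCR n r →* Matrix (SpinIdx r × SpinIdx n) (SpinIdx r × SpinIdx n) ℂ :=
  QuotientGroup.lift (signs n r)
    { toFun := fun u => (u.2.2 : ℂ) • (kappa r (u.2.1 : (Cl r)ˣ) ⊗ₖ kappa n (u.1 : (Cl n)ˣ))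
      map_one' := by simp
      map_mul' := fun u v => by
        simp [Matrix.mul_kronecker_mul, smul_smul, mul_comm] }
    (by
      rw [signs, Subgroup.closure_le]
      rintro u (rfl | rfl) <;> rw [SetLike.mem_coe, MonoidHom.mem_ker] <;>
        ext ⟨i, j⟩ ⟨k, l⟩ <;> simp [Spin.negOne, Matrix.one_apply] <;>
        split_ifs <;> simp_all)

/-- The action of `w ∈ Clₙ` on the second factor of `Δᵣ ⊗ Δₙ`. -/
def clMul {r n : ℕ} (w : Cl n) (φ : TwistedSpinor r n) : TwistedSpinor r n :=
  ((1 : Matrix (SpinIdx r) (SpinIdx r) ℂ) ⊗ₖ kappa n w) *ᵥ φ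

/-- The action of `w ∈ Clᵣ` on the first (twisting) factor of `Δᵣ ⊗ Δₙ`. -/
def twMul {r n : ℕ} (w : Cl r) (φ : TwistedSpinor r n) : TwistedSpinor r n :=
  (kappa r w ⊗ₖ (1 : Matrix (SpinIdx n) (SpinIdx n) ℂ)) *ᵥ φ

/-- The standard Hermitian product `⟨φ, ψ⟩` of `Δᵣ ⊗ Δₙ`, linear in `φ`. -/
def herm {r n : ℕ} (φ ψ : TwistedSpinor r n) : ℂ := φ ⬝ᵥ star ψ

/-- The `j`-th standard basis vector of `ℝⁿ` in the Clifford algebra. -/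
def basisVec {n : ℕ} (j : Fin n) : Cl n := vec (Pi.single j 1)

/-- The volume element `f₁ f₂ ⋯ fᵣ` of `Clᵣ`. -/
def volumeElt (r : ℕ) : Cl r := (List.ofFn (fun j : Fin r => basisVec j)).prod

/-- The subspace `Σᵣ ⊗ Δₙ` of `Δᵣ ⊗ Δₙ`, where `Σᵣ = Δᵣ` if `r` is odd or `r ∈ {2, 4}`, and
`Σᵣ = Δᵣ⁺`, the `i^{r/2}`-eigenspace of the volume element, for the other even `r`. -/
def InSigma {r n : ℕ} (φ : TwistedSpinor r n) : Prop :=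
  Odd r ∨ r = 2 ∨ r = 4 ∨ twMul (volumeElt r) φ = Complex.I ^ (r / 2) • φ

/-- The coefficient `η_{kl}^φ(eᵢ, eⱼ) = Re ⟨eᵢ ∧ eⱼ · κ_{r*}(f_k f_l) · φ, φ⟩`, for `i ≠ j`. -/
def etaCoeff {r n : ℕ} (φ : TwistedSpinor r n) (k l : Fin r) (i j : Fin n) : ℝ :=
  (herm (clMul (basisVec i * basisVec j) (twMul (basisVec k * basisVec l) φ)) φ).re

/-- The two-form `η_{kl}^φ = ∑_{i<j} η_{kl}^φ(eᵢ, eⱼ) eᵢ ∧ eⱼ` as an element of the Clifford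
algebra. -/
def eta {r n : ℕ} (φ : TwistedSpinor r n) (k l : Fin r) : Cl n :=
  ∑ i, ∑ j, if i < j then etaCoeff φ k l i j • (basisVec i * basisVec j) else 0

/-- Twisted partially pure spinors (for `r < n`). -/
structure IsPartiallyPure {r n : ℕ} (φ : TwistedSpinor r n) : Prop where
  inSigma : InSigma φ
  unit : herm φ φ = 1
  exists_subspace : ∃ V : Submodule ℝ (Fin n → ℝ), Module.finrank ℝ V + r = n ∧
    ∀ X ∈ V, ∃ Y ∈ V, clMul (vec X) φ = Complex.I • clMul (vec Y) φ
  eta_add : ∀ k l : Fin r, k < l →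
    clMul (eta φ k l) φ + twMul (basisVec k * basisVec l) φ = 0
  herm_eq_zero : ∀ k l : Fin r, k < l → herm (twMul (basisVec k * basisVec l) φ) φ = 0
  four : r = 4 → herm (twMul (volumeElt r) φ) φ = 0

/-! ### Principal bundles -/

/-- A notion of smoothness, on subsets of `M`, for maps from `M` to a set `G`. -/
abbrev SmoothMaps (M G : Type*) := Set M → (M → G) → Prop

/-- A smooth principal bundle over `M` with structure group `G`, where `Sm U g` says that the
map `g : M → G` is smooth on the open set `U`: a family of right `G`-torsors `Fiber x`, with an
atlas of smooth local sections `s` (over open sets `U` that cover `M`; the values of `s` outside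
`U` are irrelevant) whose transition functions are smooth. -/
structure PrincipalBundle (M : Type*) [TopologicalSpace M] (G : Type) [Group G]
    (Sm : SmoothMaps M G) where
  Fiber : M → Type
  act : ∀ {x : M}, Fiber x → G → Fiber x
  act_one : ∀ {x : M} (p : Fiber x), act p 1 = p
  act_mul : ∀ {x : M} (p : Fiber x) (g h : G), act p (g * h) = act (act p g) h
  simply_transitive : ∀ {x : M} (p q : Fiber x), ∃! g : G, act p g = q
  atlas : Set (Set M × ((x : M) → Fiber x))
  isOpen : ∀ c ∈ atlas, IsOpen c.1
  cover : ∀ x : M, ∃ c ∈ atlas, x ∈ c.1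
  transition : ∀ c ∈ atlas, ∀ d ∈ atlas, ∃ g : M → G, Sm (c.1 ∩ d.1) g ∧
    ∀ x ∈ c.1 ∩ d.1, d.2 x = act (c.2 x) (g x)

/-- Smoothness on `U` of a local section of a principal bundle: it differs from the smooth local
sections of the atlas by smooth functions with values in the structure group. -/
def PrincipalBundle.IsSmoothSection {M : Type*} [TopologicalSpace M] {G : Type} [Group G]
    {Sm : SmoothMaps M G} (P : PrincipalBundle M G Sm) (U : Set M)
    (t : (x : M) → P.Fiber x) : Prop :=
  ∀ c ∈ P.atlas, ∃ g : M → G, Sm (c.1 ∩ U) g ∧ ∀ x ∈ c.1 ∩ U, t x = P.act (c.2 x) (g x)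

section Manifold

variable (n : ℕ) (M : Type*) [TopologicalSpace M] [ChartedSpace (EuclideanSpace ℝ (Fin n)) M]

/-- Smooth maps to `U(1) ⊂ ℂ`. -/
def smoothCircle : SmoothMaps M Circle := fun U g =>
  ContMDiffOn (𝓡 n) 𝓘(ℝ, ℂ) ∞ (fun x => (g x : ℂ)) U

/-- Smooth maps to `SO(r)`: the matrix entries are smooth. -/
def smoothSO (r : ℕ) : SmoothMaps M (SO r) := fun U g =>
  ∀ i j : Fin r, ContMDiffOn (𝓡 n) 𝓘(ℝ, ℝ) ∞ (fun x => (g x).1 i j) U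

/-- Smooth maps to `Spin(k)`, a submanifold of the finite-dimensional real vector space `Cl_k`:
the composite with every linear form is smooth. -/
def smoothSpin (k : ℕ) : SmoothMaps M (Spin k) := fun U g =>
  ∀ ℓ : Cl k →ₗ[ℝ] ℝ, ContMDiffOn (𝓡 n) 𝓘(ℝ, ℝ) ∞ (fun x => ℓ ((g x : (Cl k)ˣ) : Cl k)) U

/-- Smooth maps to `Spin^{c,r}(n)`: those that lift locally to smooth maps to the finite covering
`Spin(n) × Spin(r) × U(1)`. -/
def smoothSpinCR (r : ℕ) : SmoothMaps M (SpinCR n r) := fun U g =>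
  ∀ x₀ ∈ U, ∃ W : Set M, IsOpen W ∧ x₀ ∈ W ∧
    ∃ (a : M → Spin n) (b : M → Spin r) (z : M → Circle),
      smoothSpin n M n (U ∩ W) a ∧ smoothSpin n M r (U ∩ W) b ∧ smoothCircle n M (U ∩ W) z ∧
      ∀ x ∈ U ∩ W, g x = QuotientGroup.mk (a x, b x, z x)

variable {n M} in
/-- Smoothness on `U` of a vector field. -/
def SmoothField [IsManifold (𝓡 n) ∞ M] (U : Set M) (X : (x : M) → TangentSpace (𝓡 n) x) : Prop :=
  ContMDiffOn (𝓡 n) (𝓡 n).tangent ∞ (fun x => (⟨x, X x⟩ : TangentBundle (𝓡 n) M)) U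

/-- An orientation of the `n`-manifold `M`: a choice of an orientation of every tangent space,
such that near every point there is a positively oriented smooth frame. -/
structure ManifoldOrientation [IsManifold (𝓡 n) ∞ M] where
  orient : (x : M) → Orientation ℝ (TangentSpace (𝓡 n) x) (Fin n)
  locally_constant : ∀ x₀ : M, ∃ U : Set M, IsOpen U ∧ x₀ ∈ U ∧
    ∃ e : Fin n → (x : M) → TangentSpace (𝓡 n) x, (∀ i, SmoothField U (e i)) ∧
      ∀ x ∈ U, ∃ b : Module.Basis (Fin n) ℝ (TangentSpace (𝓡 n) x),
        (∀ i, b i = e i x) ∧ b.orientation = orient x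

variable {n M}
variable [IsManifold (𝓡 n) ∞ M] [Bundle.RiemannianBundle (fun x : M => TangentSpace (𝓡 n) x)]

/-- Oriented orthonormal frames of `TₓM`, the fibre at `x` of `P_{SO(M)}`. -/
def Frame (o : ManifoldOrientation n M) (x : M) : Type :=
  {f : OrthonormalBasis (Fin n) ℝ (TangentSpace (𝓡 n) x) // f.toBasis.orientation = o.orient x}

/-- A `Spin^{c,r}(n)` structure on `M`: principal bundles `P_{SO(r)}` and `P_{U(1)}`, and a principal
`Spin^{c,r}(n)` bundle with a smooth map `Λ` over `M` to `P_{SO(M)} ×_M P_{SO(r)} ×_M P_{U(1)}`,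
equivariant with respect to the two-fold covering `λ_{n,r,2}` (and therefore a two-fold covering). -/
structure SpinCRStructure (o : ManifoldOrientation n M) (r : ℕ) where
  PSO : PrincipalBundle M (SO r) (smoothSO n M r)
  PU : PrincipalBundle M Circle (smoothCircle n M)
  P : PrincipalBundle M (SpinCR n r) (smoothSpinCR n M r)
  toFrame : ∀ {x : M}, P.Fiber x → Frame o x
  toPSO : ∀ {x : M}, P.Fiber x → PSO.Fiber x
  toPU : ∀ {x : M}, P.Fiber x → PU.Fiber x
  toFrame_act : ∀ {x : M} (p : P.Fiber x) (g : SpinCR n r) (j : Fin n),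
    (toFrame (P.act p g)).1 j = ∑ i, (coverCR n r g).1.1 i j • (toFrame p).1 i
  toPSO_act : ∀ {x : M} (p : P.Fiber x) (g : SpinCR n r),
    toPSO (P.act p g) = PSO.act (toPSO p) (coverCR n r g).2.1
  toPU_act : ∀ {x : M} (p : P.Fiber x) (g : SpinCR n r),
    toPU (P.act p g) = PU.act (toPU p) (coverCR n r g).2.2
  toFrame_smooth : ∀ c ∈ P.atlas, ∀ i, SmoothField c.1 (fun x => (toFrame (c.2 x)).1 i)
  toPSO_smooth : ∀ c ∈ P.atlas, PSO.IsSmoothSection c.1 (fun x => toPSO (c.2 x))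
  toPU_smooth : ∀ c ∈ P.atlas, PU.IsSmoothSection c.1 (fun x => toPU (c.2 x))

namespace SpinCRStructure

variable {o : ManifoldOrientation n M} {r : ℕ} (S : SpinCRStructure o r)

/-- The fibre at `x` of the twisted spinor bundle `S = P ×_κ (Σᵣ ⊗ Δₙ)`: pairs `(p, v)`, where
`(p g, v)` is identified with `(p, κ(g) v)`. -/
def SpinorFiber (x : M) : Type :=
  Quot fun (a b : S.P.Fiber x × {v : TwistedSpinor r n // InSigma v}) =>
    ∃ g : SpinCR n r, a.1 = S.P.act b.1 g ∧ b.2.1 = repCR n r g *ᵥ a.2.1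

/-- The class `[p, v]` in the fibre of the twisted spinor bundle. -/
def mkSpinor {x : M} (p : S.P.Fiber x) (v : {v : TwistedSpinor r n // InSigma v}) :
    S.SpinorFiber x :=
  Quot.mk _ (p, v)

/-- Smooth sections of the twisted spinor bundle: on the domain of every smooth local section `s` of
`P` they have the form `[s, v]` with a smooth function `v`. -/
def IsSmoothSpinor (φ : (x : M) → S.SpinorFiber x) : Prop :=
  ∀ c ∈ S.P.atlas, ∃ v : M → {v : TwistedSpinor r n // InSigma v},
    ContMDiffOn (𝓡 n) 𝓘(ℝ, TwistedSpinor r n) ∞ (fun x => (v x).1) c.1 ∧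
    ∀ x ∈ c.1, φ x = S.mkSpinor (c.2 x) (v x)

/-- An element of the fibre `Sₓ` is partially pure if the vectors of `Σᵣ ⊗ Δₙ` that represent it
are. -/
def IsPartiallyPureAt {x : M} (ψ : S.SpinorFiber x) : Prop :=
  ∀ (p : S.P.Fiber x) (v : {v : TwistedSpinor r n // InSigma v}),
    ψ = S.mkSpinor p v → IsPartiallyPure v.1

/-- The twisted spinor bundle carries a partially pure (smooth) spinor field. -/
def CarriesPartiallyPure : Prop :=
  ∃ φ : (x : M) → S.SpinorFiber x, S.IsSmoothSpinor φ ∧ ∀ x, S.IsPartiallyPureAt (φ x)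

end SpinCRStructure

/-! ### Almost CR hermitian structures -/

variable (n M) in
/-- An almost CR hermitian structure of codimension `r` on the Riemannian manifold `M`: a smooth
sub-bundle `D` of `TM` of rank `n - r` and a smooth bundle automorphism `J` of `D` with
`J² = -Id` that is orthogonal with respect to the metric. -/
structure AlmostCRHermitian (r : ℕ) where
  D : (x : M) → Submodule ℝ (TangentSpace (𝓡 n) x)
  finrank_D : ∀ x, Module.finrank ℝ (D x) + r = n
  smooth_D : ∀ x₀ : M, ∃ U : Set M, IsOpen U ∧ x₀ ∈ U ∧
    ∃ e : Fin (n - r) → (x : M) → TangentSpace (𝓡 n) x, (∀ i, SmoothField U (e i)) ∧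
      ∀ x ∈ U, Submodule.span ℝ (Set.range fun i => e i x) = D x
  J : (x : M) → D x →ₗ[ℝ] D x
  J_J : ∀ x (u : D x), J x (J x u) = -u
  smooth_J : ∀ (U : Set M) (X : (x : M) → D x), IsOpen U →
    SmoothField U (fun x => (X x : TangentSpace (𝓡 n) x)) →
    SmoothField U (fun x => (J x (X x) : TangentSpace (𝓡 n) x))
  orthogonal : ∀ x (u v : D x),
    inner ℝ (J x u : TangentSpace (𝓡 n) x) (J x v : TangentSpace (𝓡 n) x) =
      inner ℝ (u : TangentSpace (𝓡 n) x) (v : TangentSpace (𝓡 n) x)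

end Manifold

end TwistedSpin

end

/-! Both sides describe the same reduction of the oriented frame bundle: to the matrices of `SO n`,
n = 2m + r, that commute with a complex structure on a 2m-dimensional summand of ℝⁿ extended by
zero, that is, to SO(n) ∩ (U(m) × O(r)).

From spinors to structures. For a partially pure φ, consider the real skew matrix `cxMat φ` with the
entries -Im⟨eᵢ eⱼ φ, φ⟩. On V it is the map X ↦ Y with X φ = i Y φ (`cxMat_mulVec`), and it vanishes
on U = V^⊥ (`IsPartiallyPure.cxMat_mulVec_eq_zero`). The second fact is a dimension count. The forms
η_kl kill V, so they are two-forms on U. The spinors f_k f_l φ = -η_kl φ are orthonormal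
(`IsPartiallyPure.herm_F_F_F_F`), so the η_kl are linearly independent and span Λ²U. Hence every
two-form on U acts on φ as a combination of the f_k f_l φ, all of which are orthogonal to φ. Since
`cxMat` is quadratic in φ and equivariant (`cxMat_spinAct`), a smooth spinor field defines a smooth
skew endomorphism L of TM of constant rank with L³ = -L. Its range is D and its restriction to D is
J.

From structures to spinors. There are constant spinors φ (`exists_modelSpinor`) on which e_{2a} acts
as ± i e_{2a+1} and f_k f_l as e_{2m+l} e_{2m+k}. A matrix of `SO n` that commutes with `cxMat φ`
has exactly one lift to Spin^{c,r}(n) that fixes φ and acts on ℝʳ as the matrix acts on U. For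
existence (`ModelSpinor.exists_lift`) the matrix is factored into reflections: pairs of them in a
complex line of the first summand move φ by a phase, which U(1) compensates, and pairs in U are
compensated by Spin(r). Uniqueness (`stabilizer_ext`) follows from ker λ_k = {±1}. So the changes of
adapted frames lift canonically to the stabilizer of φ, and the constant φ becomes a global spinor
field. The lifts are smooth because smooth local lifts to the two spin groups exist
(`exists_smooth_lift`) and the phase can be read off from their action on φ.

Orientation. Adapted frames have to be positively oriented. If r > 0, a vector orthogonal to D can
be reversed. If r = 0, the complex structure determines an orientation, which may be the wrong one.
Therefore there are two model spinors, distinguished by a Boolean that is locally constant on M. -/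

noncomputable section
namespace TwistedSpin

/-! ### Algebra of twisted spinors -/

section SpinorAlgebra

variable {r n : ℕ}

/-- The action of `Clₙ` on the second factor of `Δᵣ ⊗ Δₙ` as an algebra homomorphism. -/
def clHom (r n : ℕ) : Cl n →ₐ[ℝ] Module.End ℂ (TwistedSpinor r n) where
  toFun w := Matrix.toLin' ((1 : Matrix (SpinIdx r) (SpinIdx r) ℂ) ⊗ₖ kappa n w)
  map_one' := by simp [Module.End.one_eq_id]
  map_mul' w w' := by
    rw [map_mul, Module.End.mul_eq_comp, ← Matrix.toLin'_mul, ← Matrix.mul_kronecker_mul, one_mul]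
  map_zero' := by simp
  map_add' w w' := by rw [map_add, Matrix.kronecker_add, map_add]
  commutes' c := by
    refine LinearMap.ext fun φ => ?_
    simp [Algebra.algebraMap_eq_smul_one, Matrix.kronecker_smul, Matrix.smul_mulVec]

/-- The action of `Clᵣ` on the first factor of `Δᵣ ⊗ Δₙ` as an algebra homomorphism. -/
def twHom (r n : ℕ) : Cl r →ₐ[ℝ] Module.End ℂ (TwistedSpinor r n) where
  toFun w := Matrix.toLin' (kappa r w ⊗ₖ (1 : Matrix (SpinIdx n) (SpinIdx n) ℂ))
  map_one' := by simp [Module.End.one_eq_id]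
  map_mul' w w' := by
    rw [map_mul, Module.End.mul_eq_comp, ← Matrix.toLin'_mul, ← Matrix.mul_kronecker_mul, one_mul]
  map_zero' := by simp
  map_add' w w' := by rw [map_add, Matrix.add_kronecker, map_add]
  commutes' c := by
    refine LinearMap.ext fun φ => ?_
    simp [Algebra.algebraMap_eq_smul_one, Matrix.smul_kronecker, Matrix.smul_mulVec]

theorem clMul_eq (w : Cl n) (φ : TwistedSpinor r n) : clMul w φ = clHom r n w φ := rfl

theorem twMul_eq (w : Cl r) (φ : TwistedSpinor r n) : twMul w φ = twHom r n w φ := rfl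

theorem clHom_mul_apply (w w' : Cl n) (φ : TwistedSpinor r n) :
    clHom r n (w * w') φ = clHom r n w (clHom r n w' φ) := by rw [map_mul]; rfl

theorem twHom_mul_apply (w w' : Cl r) (φ : TwistedSpinor r n) :
    twHom r n (w * w') φ = twHom r n w (twHom r n w' φ) := by rw [map_mul]; rfl

theorem clHom_twHom (w : Cl n) (w' : Cl r) (φ : TwistedSpinor r n) :
    clHom r n w (twHom r n w' φ) = twHom r n w' (clHom r n w φ) := by
  change _ *ᵥ (_ *ᵥ φ) = _ *ᵥ (_ *ᵥ φ)
  rw [Matrix.mulVec_mulVec, Matrix.mulVec_mulVec, ← Matrix.mul_kronecker_mul,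
    ← Matrix.mul_kronecker_mul]
  simp

/-- Clifford multiplication by the vector `x` of `ℝⁿ`. -/
def E (x : Fin n → ℝ) : Module.End ℂ (TwistedSpinor r n) := clHom r n (vec x)

/-- Multiplication by the vector `y` of `ℝʳ` on the twisting factor. -/
def F (y : Fin r → ℝ) : Module.End ℂ (TwistedSpinor r n) := twHom r n (vec y)

theorem E_smul (c : ℝ) (x : Fin n → ℝ) (φ : TwistedSpinor r n) : E (c • x) φ = c • E x φ := by
  simp [E]

theorem E_neg (x : Fin n → ℝ) (φ : TwistedSpinor r n) : E (-x) φ = -E x φ := by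
  simp [E]

theorem E_sub (x y : Fin n → ℝ) (φ : TwistedSpinor r n) : E (x - y) φ = E x φ - E y φ := by
  simp [E]

theorem vec_mul_vec_add_swap (x y : Fin n → ℝ) :
    vec x * vec y + vec y * vec x = algebraMap ℝ (Cl n) (-2 * (x ⬝ᵥ y)) := by
  rw [CliffordAlgebra.ι_mul_ι_add_swap, QuadraticMap.polar, negSq_apply, negSq_apply, negSq_apply]
  congr 1
  rw [add_dotProduct, dotProduct_add, dotProduct_add, dotProduct_comm y x]
  ring

theorem vec_mul_vec_of_orth {x y : Fin n → ℝ} (h : x ⬝ᵥ y = 0) :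
    vec x * vec y = -(vec y * vec x) := by
  rw [← add_eq_zero_iff_eq_neg, vec_mul_vec_add_swap, h]; simp

theorem E_E_swap (x y : Fin n → ℝ) (φ : TwistedSpinor r n) :
    E x (E y φ) = -E y (E x φ) - (2 * (x ⬝ᵥ y)) • φ := by
  have h := congrArg (fun w => clHom r n w φ) (vec_mul_vec_add_swap x y)
  simp only [map_add, AlgHom.commutes, LinearMap.add_apply, Module.algebraMap_end_apply,
    clHom_mul_apply] at h
  change E x (E y φ) + E y (E x φ) = _ at h
  rw [eq_sub_iff_add_eq, ← eq_sub_iff_add_eq', ← sub_eq_zero]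
  have h2 : (-2 * (x ⬝ᵥ y)) • φ = -((2 * (x ⬝ᵥ y)) • φ) := by rw [← neg_smul]; ring_nf
  rw [h2] at h
  rw [← sub_eq_zero] at h
  rw [← h]; abel

theorem F_F_swap (x y : Fin r → ℝ) (φ : TwistedSpinor r n) :
    F x (F y φ) = -F y (F x φ) - (2 * (x ⬝ᵥ y)) • φ := by
  have h := congrArg (fun w => twHom r n w φ) (vec_mul_vec_add_swap x y)
  simp only [map_add, AlgHom.commutes, LinearMap.add_apply, Module.algebraMap_end_apply,
    twHom_mul_apply] at h
  change F x (F y φ) + F y (F x φ) = _ at h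
  rw [eq_sub_iff_add_eq, ← eq_sub_iff_add_eq', ← sub_eq_zero]
  have h2 : (-2 * (x ⬝ᵥ y)) • φ = -((2 * (x ⬝ᵥ y)) • φ) := by rw [← neg_smul]; ring_nf
  rw [h2] at h
  rw [← sub_eq_zero] at h
  rw [← h]; abel

theorem E_E_self (x : Fin n → ℝ) (φ : TwistedSpinor r n) : E x (E x φ) = -((x ⬝ᵥ x) • φ) := by
  have h := CliffordAlgebra.ι_sq_scalar (negSq n) x
  have h' := congrArg (fun w => clHom r n w φ) h
  simp only [map_mul, AlgHom.commutes, Module.algebraMap_end_apply, negSq_apply, neg_smul] at h'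
  exact h'

theorem F_F_self (x : Fin r → ℝ) (φ : TwistedSpinor r n) : F x (F x φ) = -((x ⬝ᵥ x) • φ) := by
  have h := CliffordAlgebra.ι_sq_scalar (negSq r) x
  have h' := congrArg (fun w => twHom r n w φ) h
  simp only [map_mul, AlgHom.commutes, Module.algebraMap_end_apply, negSq_apply, neg_smul] at h'
  exact h'

theorem E_F (x : Fin n → ℝ) (y : Fin r → ℝ) (φ : TwistedSpinor r n) :
    E x (F y φ) = F y (E x φ) := clHom_twHom _ _ _

/-! ### The Hermitian product and the skew-adjointness of Clifford multiplication. -/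

theorem tensorMat_conjTranspose {k : ℕ} (A : Fin k → Matrix (Fin 2) (Fin 2) ℂ) :
    (tensorMat A)ᴴ = tensorMat (fun a => (A a)ᴴ) := by
  ext s t
  simp [tensorMat, Matrix.conjTranspose_apply]

theorem g₁_conjTranspose : g₁ᴴ = -g₁ := by
  ext i j; fin_cases i <;> fin_cases j <;> simp [g₁]

theorem g₂_conjTranspose : g₂ᴴ = -g₂ := by
  ext i j; fin_cases i <;> fin_cases j <;> simp [g₂]

theorem matT_conjTranspose : matTᴴ = matT := by
  ext i j; fin_cases i <;> fin_cases j <;> simp [matT]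

/-- Exactly one tensor factor, `g₁` or `g₂` in position ⌊j/2⌋, is skew-hermitian. For the last
vector in odd dimension all factors are the hermitian `matT`, and the scalar i supplies the sign. -/
theorem gen_conjTranspose (n : ℕ) (j : Fin n) : (gen n j)ᴴ = -gen n j := by
  have hj := j.isLt
  rw [gen, Matrix.conjTranspose_smul, tensorMat_conjTranspose]
  by_cases h : j.val / 2 = n / 2
  · have : (fun a : Fin (n / 2) => (genFactor j.val a)ᴴ) = genFactor j.val := by
      funext a
      have : a.val < j.val / 2 := by omega
      simp [genFactor, this, matT_conjTranspose]
    rw [this, if_pos h]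
    simp
  · have hlt : j.val / 2 < n / 2 := by omega
    rw [if_neg h, tensorMat_neg_of (B := genFactor j.val) ⟨j.val / 2, hlt⟩]
    · simp
    · by_cases h2 : j.val % 2 = 0
      · simp [genFactor, h2, g₁_conjTranspose]
      · simp [genFactor, h2, g₂_conjTranspose]
    · intro b hb
      have : b.val ≠ j.val / 2 := fun h' => hb (Fin.ext h')
      by_cases hb2 : b.val < j.val / 2 <;> simp [genFactor, this, hb2, matT_conjTranspose]

theorem kappa_vec (x : Fin n → ℝ) : kappa n (vec x) = vecMat n x :=
  CliffordAlgebra.lift_ι_apply _ _ _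

theorem vecMat_conjTranspose (x : Fin n → ℝ) : (vecMat n x)ᴴ = -vecMat n x := by
  simp [vecMat, Matrix.conjTranspose_sum, gen_conjTranspose]

theorem herm_mulVec (A : Matrix (SpinIdx r × SpinIdx n) (SpinIdx r × SpinIdx n) ℂ)
    (φ ψ : TwistedSpinor r n) : herm (A *ᵥ φ) ψ = herm φ (Aᴴ *ᵥ ψ) := by
  rw [herm, herm, Matrix.star_mulVec, Matrix.conjTranspose_conjTranspose, dotProduct_comm,
    Matrix.dotProduct_mulVec, dotProduct_comm]

theorem herm_add_left (φ ψ χ : TwistedSpinor r n) : herm (φ + ψ) χ = herm φ χ + herm ψ χ := by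
  simp [herm, add_dotProduct]

theorem herm_add_right (φ ψ χ : TwistedSpinor r n) : herm φ (ψ + χ) = herm φ ψ + herm φ χ := by
  simp [herm, dotProduct_add]

theorem herm_neg_left (φ χ : TwistedSpinor r n) : herm (-φ) χ = -herm φ χ := by
  simp [herm]

theorem herm_neg_right (φ χ : TwistedSpinor r n) : herm φ (-χ) = -herm φ χ := by
  simp [herm]

theorem herm_sub_left (φ ψ χ : TwistedSpinor r n) : herm (φ - ψ) χ = herm φ χ - herm ψ χ := by
  simp [herm, sub_dotProduct]

theorem herm_zero_left (χ : TwistedSpinor r n) : herm 0 χ = 0 := by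
  simp [herm]

theorem herm_smul_left (c : ℂ) (φ χ : TwistedSpinor r n) : herm (c • φ) χ = c * herm φ χ := by
  simp [herm]

theorem herm_smul_right (c : ℂ) (φ χ : TwistedSpinor r n) :
    herm φ (c • χ) = (starRingEnd ℂ) c * herm φ χ := by
  simp [herm]

theorem herm_rsmul_left (c : ℝ) (φ χ : TwistedSpinor r n) : herm (c • φ) χ = c * herm φ χ := by
  simp [herm]

theorem herm_rsmul_right (c : ℝ) (φ χ : TwistedSpinor r n) : herm φ (c • χ) = c * herm φ χ := by
  simp [herm]

theorem herm_sum_left {ι : Type*} (s : Finset ι) (f : ι → TwistedSpinor r n)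
    (χ : TwistedSpinor r n) : herm (∑ i ∈ s, f i) χ = ∑ i ∈ s, herm (f i) χ := by
  simp [herm, sum_dotProduct]

theorem herm_conj (φ χ : TwistedSpinor r n) : (starRingEnd ℂ) (herm φ χ) = herm χ φ := by
  simp only [herm, dotProduct, map_sum, map_mul, Pi.star_apply]
  exact Finset.sum_congr rfl fun i _ => by
    rw [← starRingEnd_apply, ← starRingEnd_apply, Complex.conj_conj, mul_comm]

theorem herm_self_eq (φ : TwistedSpinor r n) :
    herm φ φ = ((∑ i, Complex.normSq (φ i) : ℝ) : ℂ) := by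
  simp only [herm, dotProduct, Pi.star_apply, Complex.ofReal_sum]
  exact Finset.sum_congr rfl fun i _ => by rw [← starRingEnd_apply, Complex.mul_conj]

theorem herm_self_eq_zero {φ : TwistedSpinor r n} (h : herm φ φ = 0) : φ = 0 := by
  rw [herm_self_eq, Complex.ofReal_eq_zero,
    Finset.sum_eq_zero_iff_of_nonneg fun i _ => Complex.normSq_nonneg _] at h
  funext i
  exact Complex.normSq_eq_zero.mp (h i (Finset.mem_univ i))

theorem herm_E (x : Fin n → ℝ) (φ ψ : TwistedSpinor r n) :
    herm (E x φ) ψ = -herm φ (E x ψ) := by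
  change herm (_ *ᵥ φ) ψ = -herm φ (_ *ᵥ ψ)
  rw [herm_mulVec, Matrix.conjTranspose_kronecker, kappa_vec, vecMat_conjTranspose,
    ← herm_neg_right, ← Matrix.neg_mulVec]
  congr 2
  ext ⟨i, j⟩ ⟨k, l⟩
  simp

theorem herm_F (x : Fin r → ℝ) (φ ψ : TwistedSpinor r n) :
    herm (F x φ) ψ = -herm φ (F x ψ) := by
  change herm (_ *ᵥ φ) ψ = -herm φ (_ *ᵥ ψ)
  rw [herm_mulVec, Matrix.conjTranspose_kronecker, kappa_vec, vecMat_conjTranspose,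
    ← herm_neg_right, ← Matrix.neg_mulVec]
  congr 2
  ext ⟨i, j⟩ ⟨k, l⟩
  simp

/-- The `i`-th standard basis vector. -/
abbrev e (i : Fin n) : Fin n → ℝ := Pi.single i 1

theorem clMul_basis (i j : Fin n) (φ : TwistedSpinor r n) :
    clMul (basisVec i * basisVec j) φ = E (e i) (E (e j) φ) := clHom_mul_apply _ _ _

theorem twMul_basis (i j : Fin r) (φ : TwistedSpinor r n) :
    twMul (basisVec i * basisVec j) φ = F (e i) (F (e j) φ) := twHom_mul_apply _ _ _

theorem e_dot (i j : Fin n) : e i ⬝ᵥ e j = if i = j then (1 : ℝ) else 0 := by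
  simp [Pi.single_apply, eq_comm]

theorem e_dot_self (i : Fin n) : e i ⬝ᵥ e i = (1 : ℝ) := by simp

theorem e_dot_ne {i j : Fin n} (h : i ≠ j) : e i ⬝ᵥ e j = (0 : ℝ) := by simp [h]

theorem E_E_orth {x y : Fin n → ℝ} (h : x ⬝ᵥ y = 0) (φ : TwistedSpinor r n) :
    E x (E y φ) = -E y (E x φ) := by rw [E_E_swap, h]; simp

theorem F_F_orth {x y : Fin r → ℝ} (h : x ⬝ᵥ y = 0) (φ : TwistedSpinor r n) :
    F x (F y φ) = -F y (F x φ) := by rw [F_F_swap, h]; simp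

theorem E_E_unit {x : Fin n → ℝ} (h : x ⬝ᵥ x = 1) (φ : TwistedSpinor r n) :
    E x (E x φ) = -φ := by rw [E_E_self, h, one_smul]

theorem F_F_unit {x : Fin r → ℝ} (h : x ⬝ᵥ x = 1) (φ : TwistedSpinor r n) :
    F x (F x φ) = -φ := by rw [F_F_self, h, one_smul]

theorem E_eq_sum (x : Fin n → ℝ) (φ : TwistedSpinor r n) : E x φ = ∑ i, x i • E (e i) φ := by
  have : x = ∑ i, x i • e i := by
    ext j; simp [Finset.sum_apply, Pi.single_apply]
  conv_lhs => rw [this]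
  simp [E, map_sum, LinearMap.sum_apply]

theorem F_eq_sum (x : Fin r → ℝ) (φ : TwistedSpinor r n) : F x φ = ∑ i, x i • F (e i) φ := by
  have : x = ∑ i, x i • e i := by
    ext j; simp [Finset.sum_apply, Pi.single_apply]
  conv_lhs => rw [this]
  simp [F, map_sum, LinearMap.sum_apply]

/-- The real part of `⟨x y φ, φ⟩` is `-⟨x, y⟩ |φ|²`. -/
theorem herm_E_E_re (x y : Fin n → ℝ) {φ : TwistedSpinor r n} (h : herm φ φ = 1) :
    (herm (E x (E y φ)) φ).re = -(x ⬝ᵥ y) := by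
  -- ⟨x y φ, φ⟩ and ⟨y x φ, φ⟩ are conjugate, and by the Clifford relation their sum is -2⟨x, y⟩.
  have h1 : herm (E x (E y φ)) φ = (starRingEnd ℂ) (herm (E y (E x φ)) φ) := by
    rw [herm_conj, herm_E, herm_E, neg_neg]
  have h2 : herm (E x (E y φ)) φ = -herm (E y (E x φ)) φ - 2 * (x ⬝ᵥ y) := by
    rw [E_E_swap, herm_sub_left, herm_neg_left, herm_rsmul_left, h]
    push_cast; ring
  have h3 := congrArg Complex.re h1
  have h4 := congrArg Complex.re h2
  simp at h3 h4
  linarith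

end SpinorAlgebra

/-! ### Two-forms and partially pure spinors -/

section Quantization

variable {r n : ℕ}

/-- The action on spinors of the two-form with the skew-symmetric matrix `B`. -/
def quant (r : ℕ) {n : ℕ} (B : Matrix (Fin n) (Fin n) ℝ) (φ : TwistedSpinor r n) :
    TwistedSpinor r n :=
  (1 / 2 : ℝ) • ∑ i, ∑ j, B i j • E (e i) (E (e j) φ)

theorem quant_add (B C : Matrix (Fin n) (Fin n) ℝ) (φ : TwistedSpinor r n) :
    quant r (B + C) φ = quant r B φ + quant r C φ := by
  simp [quant, add_smul, Finset.sum_add_distrib]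

theorem quant_smul (c : ℝ) (B : Matrix (Fin n) (Fin n) ℝ) (φ : TwistedSpinor r n) :
    quant r (c • B) φ = c • quant r B φ := by
  simp only [quant, Matrix.smul_apply, smul_eq_mul, mul_smul, ← Finset.smul_sum]
  rw [smul_comm]

theorem quant_sum {ι : Type*} (s : Finset ι) (B : ι → Matrix (Fin n) (Fin n) ℝ)
    (φ : TwistedSpinor r n) : quant r (∑ i ∈ s, B i) φ = ∑ i ∈ s, quant r (B i) φ := by
  classical
  induction s using Finset.induction_on with
  | empty => simp [quant]
  | insert a s ha ih => rw [Finset.sum_insert ha, Finset.sum_insert ha, quant_add, ih]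

theorem quant_neg (B : Matrix (Fin n) (Fin n) ℝ) (φ : TwistedSpinor r n) :
    quant r B (-φ) = -quant r B φ := by
  simp [quant]

theorem quant_F (B : Matrix (Fin n) (Fin n) ℝ) (x : Fin r → ℝ) (φ : TwistedSpinor r n) :
    quant r B (F x φ) = F x (quant r B φ) := by
  have h (c : ℝ) (ψ : TwistedSpinor r n) : F x (c • ψ) = c • F x ψ :=
    LinearMap.map_smul_of_tower _ _ _
  simp only [quant, h, map_sum, E_F]

theorem herm_quant {B : Matrix (Fin n) (Fin n) ℝ} (hB : Bᵀ = -B) (φ ψ : TwistedSpinor r n) :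
    herm (quant r B φ) ψ = -herm φ (quant r B ψ) := by
  have hB' : ∀ i j, B j i = -B i j := fun i j => congrFun (congrFun hB i) j
  have hsum (s : Finset (Fin n)) (f : Fin n → TwistedSpinor r n) (χ : TwistedSpinor r n) :
      herm χ (∑ i ∈ s, f i) = ∑ i ∈ s, herm χ (f i) := by
    rw [← herm_conj, herm_sum_left, map_sum]
    simp only [herm_conj]
  simp only [quant, herm_rsmul_left, herm_rsmul_right, herm_sum_left, hsum, herm_E, neg_neg]
  rw [Finset.sum_comm, ← mul_neg, ← Finset.sum_neg_distrib]
  congr 1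
  refine Finset.sum_congr rfl fun i _ => ?_
  rw [← Finset.sum_neg_distrib]
  refine Finset.sum_congr rfl fun j _ => ?_
  rw [hB' i j]; push_cast; ring

/-- Both factors change sign under i ↔ j, so the pairs above and below the diagonal contribute
equally. This links the sum over i < j in `eta` to the full sum in `quant`. -/
theorem sum_lt_eq_half_sum {V : Type*} [AddCommGroup V] [Module ℝ V] (B : Fin n → Fin n → ℝ)
    (hB : ∀ i j, B j i = -B i j) (c : Fin n → Fin n → V) (hc : ∀ i j, i ≠ j → c j i = -c i j) :
    ∑ i, ∑ j, (if i < j then B i j • c i j else 0) = (1 / 2 : ℝ) • ∑ i, ∑ j, B i j • c i j := by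
  have h : ∑ i, ∑ j, B i j • c i j =
      ∑ i, ∑ j, (if i < j then B i j • c i j else 0) +
        ∑ i, ∑ j, (if j < i then B i j • c i j else 0) := by
    simp only [← Finset.sum_add_distrib]
    refine Finset.sum_congr rfl fun i _ => Finset.sum_congr rfl fun j _ => ?_
    rcases lt_trichotomy i j with h | h | h
    · simp [h, h.not_gt]
    · subst h
      have : B i i = 0 := by have := hB i i; linarith
      simp [this]
    · simp [h, h.not_gt]
  have h2 : ∑ i, ∑ j, (if j < i then B i j • c i j else 0) =
      ∑ i, ∑ j, (if i < j then B i j • c i j else 0) := by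
    rw [Finset.sum_comm]
    refine Finset.sum_congr rfl fun i _ => Finset.sum_congr rfl fun j _ => ?_
    split_ifs with h
    · rw [hB, hc i j h.ne, smul_neg, neg_smul, neg_neg]
    · rfl
  rw [h, h2, ← two_smul ℝ, smul_smul]
  norm_num

/-- The matrix with the entries `Re ⟨eᵢ eⱼ ψ, φ⟩`. -/
def reMat (ψ φ : TwistedSpinor r n) : Matrix (Fin n) (Fin n) ℝ :=
  Matrix.of fun i j => (herm (E (e i) (E (e j) ψ)) φ).re

theorem reMat_transpose {ψ φ : TwistedSpinor r n} (h : (herm ψ φ).re = 0) :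
    (reMat ψ φ)ᵀ = -reMat ψ φ := by
  ext i j
  simp only [reMat, Matrix.transpose_apply, Matrix.of_apply, Matrix.neg_apply]
  rw [E_E_swap, herm_sub_left, herm_neg_left, herm_rsmul_left]
  simp [h]

/-- The real-linear map `ψ ↦ η(ψ) φ + ψ`, where `η(ψ)` is the two-form with the coefficients
`Re ⟨eᵢ eⱼ ψ, φ⟩`. -/
def etaMap (φ : TwistedSpinor r n) : TwistedSpinor r n →ₗ[ℝ] TwistedSpinor r n where
  toFun ψ := quant r (reMat ψ φ) φ + ψ
  map_add' ψ χ := by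
    have : reMat (ψ + χ) φ = reMat ψ φ + reMat χ φ := by
      ext i j; simp [reMat, herm_add_left]
    rw [this, quant_add]; abel
  map_smul' c ψ := by
    have : reMat (c • ψ) φ = c • reMat ψ φ := by
      ext i j
      simp [reMat, LinearMap.map_smul_of_tower, herm_rsmul_left]
    rw [this, quant_smul, smul_add]; rfl

/-- The pairing with `φ` as a real-linear map. -/
def hermMap (φ : TwistedSpinor r n) : TwistedSpinor r n →ₗ[ℝ] ℂ where
  toFun ψ := herm ψ φ
  map_add' ψ χ := herm_add_left ψ χ φ
  map_smul' c ψ := by simp [herm_rsmul_left]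

/-- The hypothesis makes the coefficient matrix skew, which is what permits the passage to `quant`.
-/
theorem clMul_eta (φ : TwistedSpinor r n) (k l : Fin r)
    (h : (herm (F (e k) (F (e l) φ)) φ).re = 0) :
    clMul (eta φ k l) φ = quant r (reMat (F (e k) (F (e l) φ)) φ) φ := by
  have h1 : clMul (eta φ k l) φ = ∑ i, ∑ j, if i < j then
      reMat (F (e k) (F (e l) φ)) φ i j • E (e i) (E (e j) φ) else 0 := by
    simp only [clMul_eq, eta, map_sum, LinearMap.sum_apply]
    refine Finset.sum_congr rfl fun i _ => Finset.sum_congr rfl fun j _ => ?_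
    split_ifs
    · rw [map_smul, LinearMap.smul_apply, etaCoeff, clMul_basis, twMul_basis, ← clMul_eq,
        clMul_basis]
      rfl
    · simp
  rw [h1]
  refine sum_lt_eq_half_sum (fun i j => reMat (F (e k) (F (e l) φ)) φ i j) ?_
    (fun i j => E (e i) (E (e j) φ)) ?_
  · intro i j; exact congrFun (congrFun (reMat_transpose h) i) j
  · intro i j hij; exact E_E_orth (e_dot_ne hij.symm) φ

/-- Expanding x y in the basis, the diagonal terms add up to a multiple of ⟨x, y⟩. So conditions
imposed on the pairs k < l hold for all orthogonal pairs, and in particular do not depend on the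
orthonormal basis. -/
theorem map_F_F_of_basis {W : Type*} [AddCommGroup W] [Module ℝ W]
    (Φ : TwistedSpinor r n →ₗ[ℝ] W) (φ : TwistedSpinor r n)
    (h : ∀ k l : Fin r, k < l → Φ (F (e k) (F (e l) φ)) = 0) {x y : Fin r → ℝ}
    (hxy : x ⬝ᵥ y = 0) : Φ (F x (F y φ)) = 0 := by
  have hne : ∀ k l : Fin r, Φ (F (e k) (F (e l) φ)) = if k = l then -Φ φ else 0 := by
    intro k l
    rcases lt_trichotomy k l with hkl | hkl | hkl
    · rw [h k l hkl, if_neg hkl.ne]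
    · rw [hkl, F_F_unit (e_dot_self l), if_pos rfl, map_neg]
    · rw [F_F_orth (e_dot_ne hkl.ne'), map_neg, h l k hkl, if_neg hkl.ne', neg_zero]
  have hexp : F x (F y φ) = ∑ k, ∑ l, (x k * y l) • F (e k) (F (e l) φ) := by
    rw [F_eq_sum x]
    refine Finset.sum_congr rfl fun k _ => ?_
    rw [F_eq_sum y, map_sum, Finset.smul_sum]
    refine Finset.sum_congr rfl fun l _ => ?_
    rw [LinearMap.map_smul_of_tower, smul_smul]
  rw [hexp]
  simp only [map_sum, map_smul, hne, smul_ite, smul_zero, Finset.sum_ite_eq, Finset.mem_univ,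
    if_true, ← Finset.sum_smul]
  change (x ⬝ᵥ y) • _ = 0
  rw [hxy, zero_smul]

theorem IsPartiallyPure.herm_F_F {φ : TwistedSpinor r n} (hφ : IsPartiallyPure φ)
    {x y : Fin r → ℝ} (hxy : x ⬝ᵥ y = 0) : herm (F x (F y φ)) φ = 0 :=
  map_F_F_of_basis (hermMap φ) φ (fun k l hkl => by
    have := hφ.herm_eq_zero k l hkl
    rwa [twMul_basis] at this) hxy

theorem IsPartiallyPure.etaMap_F_F {φ : TwistedSpinor r n} (hφ : IsPartiallyPure φ)
    {x y : Fin r → ℝ} (hxy : x ⬝ᵥ y = 0) :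
    quant r (reMat (F x (F y φ)) φ) φ + F x (F y φ) = 0 :=
  map_F_F_of_basis (etaMap φ) φ (fun k l hkl => by
    have := hφ.eta_add k l hkl
    rw [clMul_eta, twMul_basis] at this
    · exact this
    · rw [hφ.herm_F_F (e_dot_ne hkl.ne)]; rfl) hxy

/-- If `X φ = i X' φ` and `w` acts on the twisting factor with `⟨w φ, φ⟩ = 0`, then
`⟨X Z w φ, φ⟩ = 0` for all `Z`. -/
theorem herm_E_E_tw_eq_zero {φ : TwistedSpinor r n} {w : Cl r} (hw : herm (twHom r n w φ) φ = 0)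
    {X X' : Fin n → ℝ} (hX : E X φ = Complex.I • E X' φ) (Z : Fin n → ℝ) :
    herm (E X (E Z (twHom r n w φ))) φ = 0 := by
  -- With X moved to the second argument the substitution produces -i. With X carried past Z and w
  -- onto φ it produces +i, and the Clifford corrections are multiples of ⟨w φ, φ⟩ = 0.
  have h1 : herm (E X (E Z (twHom r n w φ))) φ =
      -Complex.I * herm (E X' (E Z (twHom r n w φ))) φ := by
    rw [herm_E X, hX, herm_smul_right, herm_E X']
    simp
  have hw' : ∀ Y, E Y (twHom r n w φ) = twHom r n w (E Y φ) := fun Y => clHom_twHom _ _ _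
  have h2 : herm (E X (E Z (twHom r n w φ))) φ =
      Complex.I * herm (E X' (E Z (twHom r n w φ))) φ := by
    rw [E_E_swap X, E_E_swap X', herm_sub_left, herm_sub_left, herm_neg_left, herm_neg_left,
      herm_rsmul_left, herm_rsmul_left, hw, hw' X, hw' X', hX, map_smul, map_smul, herm_smul_left]
    ring
  have h3 : (2 : ℂ) * herm (E X (E Z (twHom r n w φ))) φ = 0 := by
    linear_combination h1 + h2
  exact (mul_eq_zero.mp h3).resolve_left two_ne_zero

theorem volumeElt_four (φ : TwistedSpinor 4 n) :
    twMul (volumeElt 4) φ = F (e 0) (F (e 1) (F (e 2) (F (e 3) φ))) := by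
  rw [volumeElt, twMul_eq]
  simp only [List.ofFn_succ, List.ofFn_zero, List.prod_cons, List.prod_nil, mul_one,
    twHom_mul_apply]
  rfl

/-- f_d f_p shares just one factor with ω = f_a f_b f_c f_d, hence anticommutes with it. On φ,
however, f_d f_p acts as minus a two-form of ℝⁿ, which commutes with ω and is skew-adjoint.
Evaluating ⟨ω φ, φ⟩ = ⟨f_d f_p ω φ, f_d f_p φ⟩ by means of both facts gives -⟨ω φ, φ⟩. -/
theorem IsPartiallyPure.herm_four_of_outside {φ : TwistedSpinor r n} (hφ : IsPartiallyPure φ)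
    {a b c d p : Fin r} (hda : d ≠ a) (hdb : d ≠ b) (hdc : d ≠ c) (hpa : p ≠ a) (hpb : p ≠ b)
    (hpc : p ≠ c) (hpd : p ≠ d) : herm (F (e a) (F (e b) (F (e c) (F (e d) φ)))) φ = 0 := by
  set om : TwistedSpinor r n → TwistedSpinor r n :=
    fun ψ => F (e a) (F (e b) (F (e c) (F (e d) ψ))) with hom
  set B := reMat (F (e d) (F (e p) φ)) φ with hBdef
  have hB : Bᵀ = -B := reMat_transpose (by rw [hφ.herm_F_F (e_dot_ne hpd.symm)]; rfl)
  have hη : F (e d) (F (e p) φ) = -quant r B φ := by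
    rw [eq_neg_iff_add_eq_zero, add_comm]; exact hφ.etaMap_F_F (e_dot_ne hpd.symm)
  -- The two-form commutes with the f's, so its square acts on φ as (f_d f_p)² = -1.
  have hηη : quant r B (quant r B φ) = -φ := by
    rw [← neg_neg (quant r B φ), ← hη, quant_neg, quant_F, quant_F, ← neg_neg (quant r B φ), ← hη]
    simp only [map_neg, neg_neg]
    rw [F_F_orth (e_dot_ne hpd), map_neg, F_F_unit (e_dot_self d), F_F_unit (e_dot_self p)]
    simp
  have hanti : F (e d) (F (e p) (om φ)) = -om (F (e d) (F (e p) φ)) := by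
    simp only [hom]
    rw [F_F_orth (e_dot_ne hpa), F_F_orth (e_dot_ne hpb), F_F_orth (e_dot_ne hpc),
      F_F_orth (e_dot_ne hpd)]
    simp only [map_neg, neg_neg]
    rw [F_F_orth (e_dot_ne hda), F_F_orth (e_dot_ne hdb), F_F_orth (e_dot_ne hdc)]
    simp only [map_neg, neg_neg]
  have h1 : herm (om φ) φ = herm (F (e d) (F (e p) (om φ))) (F (e d) (F (e p) φ)) := by
    rw [herm_F (e d) (F (e p) (om φ)), herm_F (e p) (om φ), F_F_unit (e_dot_self d), map_neg,
      F_F_unit (e_dot_self p)]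
    simp
  have homq : ∀ ψ, om (quant r B ψ) = quant r B (om ψ) := by
    intro ψ; simp only [hom, quant_F]
  have homn : ∀ ψ, om (-ψ) = -om ψ := by
    intro ψ; simp only [hom, map_neg]
  have h2 : herm (om φ) φ = -herm (om φ) φ := by
    conv_lhs => rw [h1, hanti, hη, homn, homq, neg_neg, herm_neg_right, herm_quant hB, neg_neg, hηη,
      herm_neg_right]
  exact self_eq_neg.mp h2

/-- A fifth index reduces this to `herm_four_of_outside`. Without one, r = 4 and the product is the
volume element up to sign, which is where condition 3 enters. -/
theorem IsPartiallyPure.herm_four {φ : TwistedSpinor r n} (hφ : IsPartiallyPure φ)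
    {a b c d : Fin r} (hab : a ≠ b) (hac : a ≠ c) (had : a ≠ d) (hbc : b ≠ c) (hbd : b ≠ d)
    (hcd : c ≠ d) : herm (F (e a) (F (e b) (F (e c) (F (e d) φ)))) φ = 0 := by
  by_cases h : ∃ p, p ≠ a ∧ p ≠ b ∧ p ≠ c ∧ p ≠ d
  · obtain ⟨p, h1, h2, h3, h4⟩ := h
    exact hφ.herm_four_of_outside had.symm hbd.symm hcd.symm h1 h2 h3 h4
  · have hcard : ({a, b, c, d} : Finset (Fin r)) = Finset.univ := by
      ext p; simp only [Finset.mem_insert, Finset.mem_singleton, Finset.mem_univ, iff_true]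
      by_contra hp; push Not at hp; exact h ⟨p, hp⟩
    have hr : r = 4 := by
      have h4 := congrArg Finset.card hcard
      rw [Finset.card_univ, Fintype.card_fin, Finset.card_insert_of_notMem (by simp [*]),
        Finset.card_insert_of_notMem (by simp [*]), Finset.card_insert_of_notMem (by simp [*]),
        Finset.card_singleton] at h4
      omega
    subst hr
    have hvol := hφ.four rfl
    rw [volumeElt_four] at hvol
    set q : Fin 4 → Fin 4 → Fin 4 → Fin 4 → ℂ :=
      fun a b c d => herm (F (e a) (F (e b) (F (e c) (F (e d) φ)))) φ with hq
    have s1 : ∀ a b c d, a ≠ b → q a b c d = -q b a c d := fun a b c d h => by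
      simp only [hq]; rw [F_F_orth (e_dot_ne h), herm_neg_left]
    have s2 : ∀ a b c d, b ≠ c → q a b c d = -q a c b d := fun a b c d h => by
      simp only [hq]; rw [F_F_orth (e_dot_ne h), map_neg, herm_neg_left]
    have s3 : ∀ a b c d, c ≠ d → q a b c d = -q a b d c := fun a b c d h => by
      simp only [hq]; rw [F_F_orth (e_dot_ne h), map_neg, map_neg, herm_neg_left]
    change q a b c d = 0
    replace hvol : q 0 1 2 3 = 0 := hvol
    have t0 : ∀ a b c d, a ≠ b → q b a c d = 0 → q a b c d = 0 := fun a b c d h h' => by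
      rw [s1 a b c d h, h', neg_zero]
    have t1 : ∀ a b c d, b ≠ c → q a c b d = 0 → q a b c d = 0 := fun a b c d h h' => by
      rw [s2 a b c d h, h', neg_zero]
    have t2 : ∀ a b c d, c ≠ d → q a b d c = 0 → q a b c d = 0 := fun a b c d h h' => by
      rw [s3 a b c d h, h', neg_zero]
    -- Only the vanishing of `q 0 1 2 3` and the transposition rules `t0`, `t1`, `t2` are kept; they
    -- settle the 24 orderings.
    clear_value q
    clear hq s1 s2 s3 h hcard hφ
    fin_cases a <;> fin_cases b <;> first | exact absurd rfl hab | skip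
    all_goals fin_cases c <;> first | exact absurd rfl hac | exact absurd rfl hbc | skip
    all_goals fin_cases d <;>
      first | exact absurd rfl had | exact absurd rfl hbd | exact absurd rfl hcd | skip
    all_goals
      first
      | grind

/-- The spinors `f_k f_l φ`, `k < l`, are orthonormal. -/
theorem IsPartiallyPure.herm_F_F_F_F {φ : TwistedSpinor r n} (hφ : IsPartiallyPure φ)
    {k l k' l' : Fin r} (hkl : k < l) (hkl' : k' < l') :
    herm (F (e k) (F (e l) φ)) (F (e k') (F (e l') φ)) = if (k, l) = (k', l') then 1 else 0 := by
  have h0 : herm (F (e k) (F (e l) φ)) (F (e k') (F (e l') φ)) =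
      herm (F (e l') (F (e k') (F (e k) (F (e l) φ)))) φ := by
    rw [herm_F (e l'), herm_F (e k'), neg_neg]
  rw [h0]
  -- One common index collapses the product to two factors, treated by condition 2. No common index
  -- leaves four distinct factors, treated by `herm_four`.
  by_cases h1 : k = k'
  · subst h1
    rw [F_F_unit (e_dot_self k)]
    by_cases h2 : l = l'
    · subst h2
      rw [map_neg, F_F_unit (e_dot_self l)]
      simp [hφ.unit]
    · rw [map_neg, herm_neg_left, hφ.herm_F_F (e_dot_ne (Ne.symm h2))]
      simp [h2]
  · rw [if_neg (by simp [h1])]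
    by_cases h2 : l = l'
    · subst h2
      rw [F_F_orth (e_dot_ne hkl.ne), map_neg, map_neg, F_F_orth (e_dot_ne hkl'.ne), map_neg,
        F_F_unit (e_dot_self l)]
      simp [hφ.herm_F_F (e_dot_ne (Ne.symm h1)), herm_neg_left]
    · by_cases h3 : k = l'
      · subst h3
        rw [F_F_orth (e_dot_ne hkl'.ne), map_neg, F_F_unit (e_dot_self k)]
        simp [hφ.herm_F_F (e_dot_ne (hkl'.trans hkl).ne)]
      · by_cases h4 : l = k'
        · subst h4
          rw [F_F_orth (e_dot_ne hkl.ne), map_neg, F_F_unit (e_dot_self l), neg_neg,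
            hφ.herm_F_F (e_dot_ne (hkl.trans hkl').ne')]
        · exact hφ.herm_four hkl'.ne' (Ne.symm h3) (Ne.symm h2) (Ne.symm h1) (Ne.symm h4) hkl.ne

end Quantization

/-! ### The partial complex structure of a partially pure spinor -/

section PartialComplexStructure

variable {r n : ℕ}

/-- `Fin n → ℝ` carries the supremum norm, so the complement is taken in `EuclideanSpace` and
transported back. -/
theorem exists_orth_isCompl (V : Submodule ℝ (Fin n → ℝ)) :
    ∃ U : Submodule ℝ (Fin n → ℝ), IsCompl V U ∧ ∀ v ∈ V, ∀ u ∈ U, v ⬝ᵥ u = 0 := by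
  let L : EuclideanSpace ℝ (Fin n) ≃ₗ[ℝ] (Fin n → ℝ) := WithLp.linearEquiv 2 ℝ _
  let V' : Submodule ℝ (EuclideanSpace ℝ (Fin n)) := V.comap L.toLinearMap
  refine ⟨V'ᗮ.map L.toLinearMap, ?_, ?_⟩
  · have h : IsCompl V' V'ᗮ := Submodule.isCompl_orthogonal _
    have h2 := h.map (Submodule.orderIsoMapComap L)
    have h3 : V'.map L.toLinearMap = V := Submodule.map_comap_eq_of_surjective L.surjective V
    change IsCompl (V'.map L.toLinearMap) (V'ᗮ.map L.toLinearMap) at h2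
    rwa [h3] at h2
  · rintro v hv _ ⟨u, hu, rfl⟩
    have h := (Submodule.mem_orthogonal' V' u).mp hu (L.symm v) (by simpa [V'] using hv)
    simpa [EuclideanSpace.inner_eq_star_dotProduct, L] using h

theorem dot_mulVec_of_skew {M : Matrix (Fin n) (Fin n) ℝ} (hM : Mᵀ = -M) (x y : Fin n → ℝ) :
    x ⬝ᵥ M *ᵥ y = -(y ⬝ᵥ M *ᵥ x) := by
  rw [Matrix.dotProduct_mulVec, ← Matrix.mulVec_transpose, hM, Matrix.neg_mulVec, neg_dotProduct,
    dotProduct_comm]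

/-- A skew form that vanishes on `V × U` and on pairs of distinct vectors of a basis of `U` kills
`U`. -/
theorem mulVec_eq_zero_of_skew {V U : Submodule ℝ (Fin n → ℝ)} (hVU : IsCompl V U)
    {k : ℕ} (u : Module.Basis (Fin k) ℝ U) {M : Matrix (Fin n) (Fin n) ℝ} (hM : Mᵀ = -M)
    (h1 : ∀ v ∈ V, ∀ x ∈ U, v ⬝ᵥ M *ᵥ x = 0)
    (h2 : ∀ i j, i < j → (u i : Fin n → ℝ) ⬝ᵥ M *ᵥ (u j : Fin n → ℝ) = 0) {x : Fin n → ℝ}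
    (hx : x ∈ U) : M *ᵥ x = 0 := by
  have h3 : ∀ i j, (u i : Fin n → ℝ) ⬝ᵥ M *ᵥ (u j : Fin n → ℝ) = 0 := by
    intro i j
    rcases lt_trichotomy i j with h | h | h
    · exact h2 i j h
    · subst h
      have := dot_mulVec_of_skew hM (u i : Fin n → ℝ) (u i)
      linarith
    · rw [dot_mulVec_of_skew hM, h2 j i h, neg_zero]
  have hexp : ∀ y ∈ U, ∃ c : Fin k → ℝ, y = ∑ i, c i • (u i : Fin n → ℝ) := fun y hy =>
    ⟨u.repr ⟨y, hy⟩, by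
      have := congrArg Subtype.val (u.sum_repr ⟨y, hy⟩)
      rw [Submodule.coe_sum] at this
      exact this.symm⟩
  refine dotProduct_eq_zero _ fun w => ?_
  rw [dotProduct_comm]
  obtain ⟨v, hv, y, hy, rfl⟩ := Submodule.mem_sup.mp (hVU.sup_eq_top ▸ Submodule.mem_top : w ∈ V ⊔ U)
  rw [add_dotProduct, h1 v hv x hx, zero_add]
  obtain ⟨c, rfl⟩ := hexp x hx
  obtain ⟨d, rfl⟩ := hexp y hy
  simp [sum_dotProduct, Matrix.mulVec_sum, dotProduct_sum, Matrix.mulVec_smul, h3]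

theorem herm_E_E_eq_sum (x y : Fin n → ℝ) (ψ φ : TwistedSpinor r n) :
    herm (E x (E y ψ)) φ = ∑ i, ∑ j, ((x i * y j : ℝ) : ℂ) * herm (E (e i) (E (e j) ψ)) φ := by
  rw [E_eq_sum x, herm_sum_left]
  refine Finset.sum_congr rfl fun i _ => ?_
  rw [E_eq_sum y, map_sum, herm_rsmul_left, herm_sum_left, Finset.mul_sum]
  refine Finset.sum_congr rfl fun j _ => ?_
  rw [LinearMap.map_smul_of_tower, herm_rsmul_left]
  push_cast; ring

theorem dot_mulVec_eq_sum (M : Matrix (Fin n) (Fin n) ℝ) (x y : Fin n → ℝ) :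
    x ⬝ᵥ M *ᵥ y = ∑ i, ∑ j, (x i * y j) * M i j := by
  simp only [dotProduct, Matrix.mulVec, Finset.mul_sum]
  exact Finset.sum_congr rfl fun i _ => Finset.sum_congr rfl fun j _ => by ring

theorem dot_reMat (x y : Fin n → ℝ) (ψ φ : TwistedSpinor r n) :
    x ⬝ᵥ reMat ψ φ *ᵥ y = (herm (E x (E y ψ)) φ).re := by
  rw [herm_E_E_eq_sum, dot_mulVec_eq_sum]
  simp [reMat, Complex.re_sum]

/-- The skew-symmetric matrix with the entries `-Im ⟨eᵢ eⱼ φ, φ⟩`. -/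
def cxMat (φ : TwistedSpinor r n) : Matrix (Fin n) (Fin n) ℝ :=
  Matrix.of fun i j => -(herm (E (e i) (E (e j) φ)) φ).im

theorem dot_cxMat (x y : Fin n → ℝ) (φ : TwistedSpinor r n) :
    x ⬝ᵥ cxMat φ *ᵥ y = -(herm (E x (E y φ)) φ).im := by
  rw [herm_E_E_eq_sum, dot_mulVec_eq_sum]
  simp [cxMat, Complex.im_sum]

theorem cxMat_transpose {φ : TwistedSpinor r n} (hφ : herm φ φ = 1) : (cxMat φ)ᵀ = -cxMat φ := by
  ext i j
  simp only [cxMat, Matrix.transpose_apply, Matrix.of_apply, Matrix.neg_apply]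
  rw [E_E_swap, herm_sub_left, herm_neg_left, herm_rsmul_left, hφ]
  simp

/-- Paired with Z: -Im⟨Z X φ, φ⟩ = -Im(i⟨Z Y φ, φ⟩) = -Re⟨Z Y φ, φ⟩ = ⟨Z, Y⟩. -/
theorem cxMat_mulVec {φ : TwistedSpinor r n} (hφ : herm φ φ = 1) {X Y : Fin n → ℝ}
    (h : E X φ = Complex.I • E Y φ) : cxMat φ *ᵥ X = Y := by
  rw [← sub_eq_zero]
  refine dotProduct_eq_zero _ fun Z => ?_
  rw [dotProduct_comm, dotProduct_sub, dot_cxMat, h, map_smul, herm_smul_left, Complex.I_mul_im,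
    herm_E_E_re _ _ hφ]
  ring

theorem quant_wedge (x y : Fin n → ℝ) (φ : TwistedSpinor r n) :
    quant r (Matrix.vecMulVec x y - Matrix.vecMulVec y x) φ =
      (1 / 2 : ℝ) • (E x (E y φ) - E y (E x φ)) := by
  have h : ∀ x y : Fin n → ℝ, E x (E y φ) = ∑ i, ∑ j, (x i * y j) • E (e i) (E (e j) φ) := by
    intro x y
    rw [E_eq_sum x]
    refine Finset.sum_congr rfl fun k _ => ?_
    rw [E_eq_sum y, map_sum, Finset.smul_sum]
    refine Finset.sum_congr rfl fun l _ => ?_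
    rw [LinearMap.map_smul_of_tower, smul_smul]
  rw [quant, h x y, h y x]
  simp only [← Finset.sum_sub_distrib, ← sub_smul, Matrix.sub_apply, Matrix.vecMulVec_apply]

/-- The dimension count that carries the first implication. The matrices `B p` of the forms η_kl
live on U, are linearly independent, and are as many as dim Λ²U; so they span the two-forms on U. -/
theorem IsPartiallyPure.cxMat_mulVec_eq_zero {φ : TwistedSpinor r n} (hφ : IsPartiallyPure φ)
    {V U : Submodule ℝ (Fin n → ℝ)} (hV : Module.finrank ℝ V + r = n)
    (hJ : ∀ X ∈ V, ∃ Y ∈ V, E X φ = Complex.I • E Y φ) (hVU : IsCompl V U)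
    (horth : ∀ v ∈ V, ∀ u ∈ U, v ⬝ᵥ u = 0) {x : Fin n → ℝ} (hx : x ∈ U) :
    cxMat φ *ᵥ x = 0 := by
  have hU : Module.finrank ℝ U = r := by
    have h := Submodule.finrank_add_eq_of_isCompl hVU
    rw [Module.finrank_fin_fun] at h
    omega
  let u : Module.Basis (Fin r) ℝ U := Module.finBasisOfFinrankEq ℝ U hU
  let I := {p : Fin r × Fin r // p.1 < p.2}
  let ff : I → TwistedSpinor r n := fun p => F (e p.1.1) (F (e p.1.2) φ)
  let B : I → Matrix (Fin n) (Fin n) ℝ := fun p => reMat (ff p) φ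
  have hff : ∀ p : I, herm (ff p) φ = 0 := fun p => hφ.herm_F_F (e_dot_ne p.2.ne)
  have hBskew : ∀ c : I → ℝ, (∑ p, c p • B p)ᵀ = -∑ p, c p • B p := by
    intro c
    rw [Matrix.transpose_sum, ← Finset.sum_neg_distrib]
    refine Finset.sum_congr rfl fun p _ => ?_
    rw [Matrix.transpose_smul, reMat_transpose (by rw [hff]; rfl), smul_neg]
  have hBV : ∀ c : I → ℝ, ∀ v ∈ V, ∀ z, v ⬝ᵥ (∑ p, c p • B p) *ᵥ z = 0 := by
    intro c v hv z
    rw [Matrix.sum_mulVec, dotProduct_sum]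
    refine Finset.sum_eq_zero fun p _ => ?_
    obtain ⟨Y, -, hY⟩ := hJ v hv
    have h0 := herm_E_E_tw_eq_zero (φ := φ) (w := vec (e p.1.1) * vec (e p.1.2))
      (by rw [twHom_mul_apply]; exact hff p) hY z
    rw [twHom_mul_apply] at h0
    rw [Matrix.smul_mulVec, dotProduct_smul, dot_reMat]
    change c p • (herm ((E v) ((E z) (F (e p.1.1) (F (e p.1.2) φ)))) φ).re = 0
    have h0' : herm ((E v) ((E z) (F (e p.1.1) (F (e p.1.2) φ)))) φ = 0 := h0
    rw [h0']; simp
  -- A skew matrix that kills V is determined by its values on the pairs i < j of basis vectors of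
  -- U. These values are the coordinates used below.
  have key : ∀ M : Matrix (Fin n) (Fin n) ℝ, Mᵀ = -M → (∀ v ∈ V, ∀ z, v ⬝ᵥ M *ᵥ z = 0) →
      (∀ q : I, (u q.1.1 : Fin n → ℝ) ⬝ᵥ M *ᵥ (u q.1.2 : Fin n → ℝ) = 0) → M = 0 := by
    intro M hM h1 h2
    have h3 : ∀ z ∈ U, M *ᵥ z = 0 := fun z hz =>
      mulVec_eq_zero_of_skew hVU u hM (fun v hv x _ => h1 v hv x)
        (fun i j hij => h2 ⟨(i, j), hij⟩) hz
    have h4 : ∀ z ∈ V, M *ᵥ z = 0 := fun z hz => dotProduct_eq_zero _ fun w => by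
      rw [dotProduct_comm, dot_mulVec_of_skew hM, h1 z hz, neg_zero]
    refine Matrix.ext_of_mulVec_single fun i => ?_
    obtain ⟨v, hv, y, hy, hvy⟩ := Submodule.mem_sup.mp
      (hVU.sup_eq_top ▸ Submodule.mem_top : (Pi.single i 1 : Fin n → ℝ) ∈ V ⊔ U)
    rw [← hvy, Matrix.mulVec_add, h3 y hy, h4 v hv, Matrix.zero_mulVec, add_zero]
  let b : I → I → ℝ := fun p q => (u q.1.1 : Fin n → ℝ) ⬝ᵥ B p *ᵥ (u q.1.2 : Fin n → ℝ)
  have hbsum : ∀ (c : I → ℝ) (q : I), (∑ p, c p • b p) q =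
      (u q.1.1 : Fin n → ℝ) ⬝ᵥ (∑ p, c p • B p) *ᵥ (u q.1.2 : Fin n → ℝ) := by
    intro c q
    rw [Matrix.sum_mulVec, dotProduct_sum, Finset.sum_apply]
    refine Finset.sum_congr rfl fun p _ => ?_
    rw [Matrix.smul_mulVec, dotProduct_smul]; rfl
  have hquant : ∀ c : I → ℝ, quant r (∑ p, c p • B p) φ = -∑ p, c p • ff p := by
    intro c
    rw [quant_sum, ← Finset.sum_neg_distrib]
    refine Finset.sum_congr rfl fun p _ => ?_
    rw [quant_smul, ← smul_neg]
    congr 1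
    exact eq_neg_of_add_eq_zero_left (hφ.etaMap_F_F (e_dot_ne p.2.ne))
  -- A relation among the forms, applied to φ, becomes a relation among the orthonormal spinors f_k
  -- f_l φ.
  have hb : LinearIndependent ℝ b := by
    rw [Fintype.linearIndependent_iff]
    intro c hc q
    have hM : ∑ p, c p • B p = 0 :=
      key _ (hBskew c) (hBV c) fun q => by rw [← hbsum, hc]; rfl
    have h0 := hquant c
    rw [hM] at h0
    have h1 : herm (∑ p, c p • ff p) (ff q) = c q := by
      rw [herm_sum_left, Finset.sum_eq_single q]
      · rw [herm_rsmul_left, hφ.herm_F_F_F_F q.2 q.2]; simp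
      · intro p _ hp
        rw [herm_rsmul_left, hφ.herm_F_F_F_F p.2 q.2,
          if_neg (fun h => hp (Subtype.ext h)), mul_zero]
      · simp
    rw [eq_comm, neg_eq_iff_eq_neg] at h0
    rw [h0] at h1
    simpa [quant, herm_neg_left, herm_zero_left] using h1.symm
  have hspan : Submodule.span ℝ (Set.range b) = ⊤ :=
    hb.span_eq_top_of_card_eq_finrank' (by simp)
  -- The matrix of uᵢ ∧ uⱼ is a combination of the `B p`, so it sends φ to a vector orthogonal to φ.
  have huu : ∀ i j, i < j → (u i : Fin n → ℝ) ⬝ᵥ cxMat φ *ᵥ (u j : Fin n → ℝ) = 0 := by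
    intro i j _
    set Z := Matrix.vecMulVec (u i : Fin n → ℝ) (u j : Fin n → ℝ) -
      Matrix.vecMulVec (u j : Fin n → ℝ) (u i : Fin n → ℝ)
      with hZ
    have hZskew : Zᵀ = -Z := by
      rw [hZ, Matrix.transpose_sub, Matrix.transpose_vecMulVec, Matrix.transpose_vecMulVec, neg_sub]
    have hmem : (fun q : I => (u q.1.1 : Fin n → ℝ) ⬝ᵥ Z *ᵥ (u q.1.2 : Fin n → ℝ)) ∈
        Submodule.span ℝ (Set.range b) := by rw [hspan]; trivial
    obtain ⟨c, hc⟩ := (Submodule.mem_span_range_iff_exists_fun ℝ).mp hmem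
    have hZc : Z - ∑ p, c p • B p = 0 := by
      refine key _ ?_ ?_ ?_
      · rw [Matrix.transpose_sub, hZskew, hBskew]; abel
      · intro v hv z
        rw [Matrix.sub_mulVec, dotProduct_sub, hBV c v hv, hZ, Matrix.sub_mulVec, dotProduct_sub,
          Matrix.vecMulVec_mulVec, Matrix.vecMulVec_mulVec]
        simp [horth v hv _ (u i).2, horth v hv _ (u j).2]
      · intro q
        rw [Matrix.sub_mulVec, dotProduct_sub, ← hbsum, hc, sub_self]
    have h1 : herm (quant r Z φ) φ = 0 := by
      rw [sub_eq_zero.mp hZc, hquant, herm_neg_left, herm_sum_left]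
      simp [herm_rsmul_left, hff]
    rw [quant_wedge, herm_rsmul_left, herm_sub_left] at h1
    have h2 := (mul_eq_zero.mp h1).resolve_left (by norm_num)
    have h3 := congrArg Complex.im h2
    have h4 := dot_mulVec_of_skew (cxMat_transpose hφ.unit) (u i : Fin n → ℝ) (u j)
    rw [dot_cxMat, dot_cxMat] at h4
    rw [dot_cxMat]
    simp only [Complex.sub_im, Complex.zero_im] at h3
    linarith
  refine mulVec_eq_zero_of_skew hVU u (cxMat_transpose hφ.unit) ?_ huu hx
  -- On V × U skewness puts the matrix on v, where it yields a vector of V, orthogonal to U.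
  intro v hv x hx
  obtain ⟨Y, hY, h⟩ := hJ v hv
  rw [dot_mulVec_of_skew (cxMat_transpose hφ.unit), cxMat_mulVec hφ.unit h, dotProduct_comm,
    horth Y hY x hx, neg_zero]

/-- The matrix `cxMat φ` of a partially pure spinor is an orthogonal complex structure on a
subspace of dimension `n - r`, extended by zero. -/
theorem IsPartiallyPure.cxMat_spec {φ : TwistedSpinor r n} (hφ : IsPartiallyPure φ) :
    (∀ x, cxMat φ *ᵥ (cxMat φ *ᵥ (cxMat φ *ᵥ x)) = -(cxMat φ *ᵥ x)) ∧
      Module.finrank ℝ (LinearMap.range (cxMat φ).mulVecLin) + r = n := by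
  obtain ⟨V, hV, hJ⟩ := hφ.exists_subspace
  obtain ⟨U, hVU, horth⟩ := exists_orth_isCompl V
  have hJ' : ∀ X ∈ V, cxMat φ *ᵥ X ∈ V ∧ cxMat φ *ᵥ (cxMat φ *ᵥ X) = -X := by
    intro X hX
    obtain ⟨Y, hY, h⟩ := hJ X hX
    have h' : E X φ = Complex.I • E Y φ := h
    have h1 : E Y φ = Complex.I • E (-X) φ := by
      rw [E_neg, h', smul_neg, smul_smul, Complex.I_mul_I, neg_smul, one_smul, neg_neg]
    rw [cxMat_mulVec hφ.unit h', cxMat_mulVec hφ.unit h1]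
    exact ⟨hY, rfl⟩
  have h0 : ∀ x ∈ U, cxMat φ *ᵥ x = 0 := fun x hx =>
    hφ.cxMat_mulVec_eq_zero hV hJ hVU horth hx
  have hdec : ∀ x, ∃ v ∈ V, cxMat φ *ᵥ x = cxMat φ *ᵥ v := by
    intro x
    obtain ⟨v, hv, y, hy, rfl⟩ := Submodule.mem_sup.mp
      (hVU.sup_eq_top ▸ Submodule.mem_top : x ∈ V ⊔ U)
    exact ⟨v, hv, by rw [Matrix.mulVec_add, h0 y hy, add_zero]⟩
  refine ⟨fun x => ?_, ?_⟩
  · obtain ⟨v, hv, hxv⟩ := hdec x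
    rw [hxv, (hJ' v hv).2, Matrix.mulVec_neg]
  · have : LinearMap.range (cxMat φ).mulVecLin = V := by
      apply le_antisymm
      · rintro _ ⟨x, rfl⟩
        obtain ⟨v, hv, hxv⟩ := hdec x
        rw [Matrix.mulVecLin_apply, hxv]
        exact (hJ' v hv).1
      · intro v hv
        refine ⟨-(cxMat φ *ᵥ v), ?_⟩
        rw [Matrix.mulVecLin_apply, Matrix.mulVec_neg, (hJ' v hv).2, neg_neg]
    rw [this]; exact hV

end PartialComplexStructure

/-! ### Equivariance -/

section Equivariance

variable {r n : ℕ}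

/-- Every exchange with a different basis vector costs a sign, exchanges with itself cost none. The
exponent has the parity of `l.length - l.count i`. -/
theorem basisVec_mul_prod (i : Fin r) (l : List (Fin r)) :
    basisVec i * (l.map basisVec).prod =
      (-1 : ℝ) ^ (l.length + l.count i) • ((l.map basisVec).prod * basisVec i) := by
  induction l with
  | nil => simp
  | cons j l ih =>
    rw [List.map_cons, List.prod_cons, List.length_cons]
    by_cases h : j = i
    · subst h
      rw [List.count_cons_self, mul_assoc, ih, mul_smul_comm]
      congr 1
      ring
    · rw [List.count_cons_of_ne h, ← mul_assoc,
        show basisVec i * basisVec j = -(basisVec j * basisVec i) from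
          vec_mul_vec_of_orth (e_dot_ne (Ne.symm h)), neg_mul, mul_assoc, ih, mul_smul_comm,
        ← neg_smul, mul_assoc]
      congr 1
      ring

theorem volumeElt_eq (r : ℕ) : volumeElt r = ((List.finRange r).map basisVec).prod := by
  rw [volumeElt, List.ofFn_eq_map]

theorem vec_mul_volumeElt (hr : Even r) (x : Fin r → ℝ) :
    vec x * volumeElt r = -(volumeElt r * vec x) := by
  have hb : ∀ i : Fin r, basisVec i * volumeElt r = -(volumeElt r * basisVec i) := by
    intro i
    rw [volumeElt_eq, basisVec_mul_prod, List.length_finRange,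
      List.count_eq_one_of_mem (List.nodup_finRange r) (List.mem_finRange i), pow_succ,
      hr.neg_one_pow]
    simp
  have hx : vec x = ∑ i, x i • (basisVec i : Cl r) := by
    have : x = ∑ i, x i • e i := by
      ext j; simp [Finset.sum_apply, Pi.single_apply]
    conv_lhs => rw [this]
    simp [basisVec]
  rw [hx, Finset.sum_mul, Finset.mul_sum, ← Finset.sum_neg_distrib]
  refine Finset.sum_congr rfl fun i _ => ?_
  rw [smul_mul_assoc, hb, mul_smul_comm, smul_neg]

/-- For even r a vector anticommutes with the volume element, so a product of two commutes with it.
Hence the group preserves Δᵣ⁺. -/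
theorem Spin.mul_volumeElt (hr : Even r) (b : Spin r) :
    ((b : (Cl r)ˣ) : Cl r) * volumeElt r = volumeElt r * ((b : (Cl r)ˣ) : Cl r) := by
  obtain ⟨b, hb⟩ := b
  change (b : Cl r) * volumeElt r = volumeElt r * (b : Cl r)
  induction hb using Subgroup.closure_induction with
  | mem u hu =>
    rcases hu with ⟨x, y, hx, hy, rfl⟩ | rfl
    · change vec x * vec y * volumeElt r = volumeElt r * (vec x * vec y)
      rw [mul_assoc, vec_mul_volumeElt hr, mul_neg, ← mul_assoc, vec_mul_volumeElt hr, neg_mul,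
        neg_neg, mul_assoc]
    · simp
  | one => simp
  | mul a b _ _ iha ihb => rw [Units.val_mul, mul_assoc, ihb, ← mul_assoc, iha, mul_assoc]
  | inv a _ ih =>
    rw [← Units.mul_right_inj a, Units.mul_inv_cancel_left, ← mul_assoc, ih, mul_assoc,
      Units.mul_inv, mul_one]

theorem Spin.herm_clHom (a : Spin n) (φ ψ : TwistedSpinor r n) :
    herm (clHom r n ((a : (Cl n)ˣ) : Cl n) φ) (clHom r n ((a : (Cl n)ˣ) : Cl n) ψ) =
      herm φ ψ := by
  obtain ⟨a, ha⟩ := a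
  change herm (clHom r n (a : Cl n) φ) (clHom r n (a : Cl n) ψ) = herm φ ψ
  induction ha using Subgroup.closure_induction generalizing φ ψ with
  | mem u hu =>
    rcases hu with ⟨x, y, hx, hy, rfl⟩ | rfl
    · change herm (clHom r n (vec x * vec y) φ) (clHom r n (vec x * vec y) ψ) = _
      rw [clHom_mul_apply, clHom_mul_apply]
      change herm (E x (E y φ)) (E x (E y ψ)) = _
      rw [herm_E, E_E_unit hx, herm_E, map_neg, E_E_unit hy]
      simp
    · simp [herm_neg_left, herm_neg_right]
  | one => simp
  | mul a b _ _ iha ihb =>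
    rw [Units.val_mul, clHom_mul_apply, clHom_mul_apply, iha, ihb]
  | inv a _ ih =>
    rw [← ih, ← clHom_mul_apply, ← clHom_mul_apply, Units.mul_inv, map_one]; rfl

theorem Spin.herm_twHom (b : Spin r) (φ ψ : TwistedSpinor r n) :
    herm (twHom r n ((b : (Cl r)ˣ) : Cl r) φ) (twHom r n ((b : (Cl r)ˣ) : Cl r) ψ) =
      herm φ ψ := by
  obtain ⟨b, hb⟩ := b
  change herm (twHom r n (b : Cl r) φ) (twHom r n (b : Cl r) ψ) = herm φ ψ
  induction hb using Subgroup.closure_induction generalizing φ ψ with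
  | mem u hu =>
    rcases hu with ⟨x, y, hx, hy, rfl⟩ | rfl
    · change herm (twHom r n (vec x * vec y) φ) (twHom r n (vec x * vec y) ψ) = _
      rw [twHom_mul_apply, twHom_mul_apply]
      change herm (F x (F y φ)) (F x (F y ψ)) = _
      rw [herm_F, F_F_unit hx, herm_F, map_neg, F_F_unit hy]
      simp
    · simp [herm_neg_left, herm_neg_right]
  | one => simp
  | mul a b _ _ iha ihb =>
    rw [Units.val_mul, twHom_mul_apply, twHom_mul_apply, iha, ihb]
  | inv a _ ih =>
    rw [← ih, ← twHom_mul_apply, ← twHom_mul_apply, Units.mul_inv, map_one]; rfl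

theorem Covers.mul_vec {a : (Cl n)ˣ} {A : Matrix (Fin n) (Fin n) ℝ} (h : Covers a A)
    (v : Fin n → ℝ) : (a : Cl n) * vec v = vec (A *ᵥ v) * (a : Cl n) := by
  rw [← h v, mul_assoc, Units.inv_mul, mul_one]

/-- The action of a representative of an element of `Spin^{c,r}(n)` on `Δᵣ ⊗ Δₙ`. -/
def spinAct (u : Spin n × Spin r × Circle) : Module.End ℂ (TwistedSpinor r n) :=
  (u.2.2 : ℂ) • (twHom r n ((u.2.1 : (Cl r)ˣ) : Cl r) * clHom r n ((u.1 : (Cl n)ˣ) : Cl n))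

theorem spinAct_apply (u : Spin n × Spin r × Circle) (φ : TwistedSpinor r n) :
    spinAct u φ = (u.2.2 : ℂ) • twHom r n ((u.2.1 : (Cl r)ˣ) : Cl r)
      (clHom r n ((u.1 : (Cl n)ˣ) : Cl n) φ) := rfl

theorem repCR_mk (u : Spin n × Spin r × Circle) (φ : TwistedSpinor r n) :
    repCR n r (QuotientGroup.mk u) *ᵥ φ = spinAct u φ := by
  change ((u.2.2 : ℂ) • (kappa r ((u.2.1 : (Cl r)ˣ) : Cl r) ⊗ₖ kappa n ((u.1 : (Cl n)ˣ) : Cl n)))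
    *ᵥ φ = (u.2.2 : ℂ) • (_ *ᵥ (_ *ᵥ φ))
  rw [Matrix.mulVec_mulVec, ← Matrix.mul_kronecker_mul, mul_one, one_mul, Matrix.smul_mulVec]

theorem coverCR_mk (u : Spin n × Spin r × Circle) :
    coverCR n r (QuotientGroup.mk u) = (spinCover n u.1, spinCover r u.2.1, u.2.2 ^ 2) := rfl

/-- This is a x = (λₙ(a) x) a in the Clifford algebra; the twisting factor and the phase commute
with x. -/
theorem spinAct_E (u : Spin n × Spin r × Circle) (x : Fin n → ℝ) (φ : TwistedSpinor r n) :
    spinAct u (E x φ) = E ((spinCover n u.1).1 *ᵥ x) (spinAct u φ) := by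
  rw [spinAct_apply, spinAct_apply, map_smul]
  congr 1
  rw [E, ← clHom_mul_apply, (spinCover_spec u.1).mul_vec, clHom_mul_apply, ← clHom_twHom]
  rfl

theorem spinAct_F (u : Spin n × Spin r × Circle) (x : Fin r → ℝ) (φ : TwistedSpinor r n) :
    spinAct u (F x φ) = F ((spinCover r u.2.1).1 *ᵥ x) (spinAct u φ) := by
  rw [spinAct_apply, spinAct_apply, map_smul]
  congr 1
  rw [F, clHom_twHom, ← twHom_mul_apply, (spinCover_spec u.2.1).mul_vec, twHom_mul_apply]
  rfl

theorem herm_spinAct (u : Spin n × Spin r × Circle) (φ ψ : TwistedSpinor r n) :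
    herm (spinAct u φ) (spinAct u ψ) = herm φ ψ := by
  rw [spinAct_apply, spinAct_apply, herm_smul_left, herm_smul_right, Spin.herm_twHom,
    Spin.herm_clHom, ← mul_assoc, Complex.mul_conj, Complex.normSq_eq_norm_sq, Circle.norm_coe]
  simp

theorem spinAct_volume (hr : Even r) (u : Spin n × Spin r × Circle) (φ : TwistedSpinor r n) :
    twMul (volumeElt r) (spinAct u φ) = spinAct u (twMul (volumeElt r) φ) := by
  rw [spinAct_apply, spinAct_apply, twMul_eq, twMul_eq, map_smul]
  congr 1
  rw [← twHom_mul_apply, ← Spin.mul_volumeElt hr, twHom_mul_apply, clHom_twHom]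

theorem spinAct_mul (u v : Spin n × Spin r × Circle) (φ : TwistedSpinor r n) :
    spinAct (u * v) φ = spinAct u (spinAct v φ) := by
  rw [← repCR_mk, ← repCR_mk, ← repCR_mk, QuotientGroup.mk_mul, map_mul, Matrix.mulVec_mulVec]

theorem spinAct_one (φ : TwistedSpinor r n) :
    spinAct (1 : Spin n × Spin r × Circle) φ = φ := by
  rw [← repCR_mk, QuotientGroup.mk_one, map_one, Matrix.one_mulVec]

theorem SO_transpose_mul (A : SO n) : (A.1)ᵀ * A.1 = 1 :=
  (Matrix.mem_orthogonalGroup_iff' (Fin n) ℝ).mp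
    ((Matrix.mem_specialOrthogonalGroup_iff).mp A.2).1

theorem SO_mul_transpose (A : SO n) : A.1 * (A.1)ᵀ = 1 :=
  (Matrix.mem_orthogonalGroup_iff (Fin n) ℝ).mp
    ((Matrix.mem_specialOrthogonalGroup_iff).mp A.2).1

theorem eq_conj_of_form {A M R : Matrix (Fin n) (Fin n) ℝ} (hA : A * Aᵀ = 1)
    (h : ∀ i j, (A *ᵥ e i) ⬝ᵥ M *ᵥ (A *ᵥ e j) = R i j) : M = A * R * Aᵀ := by
  have h1 : Aᵀ * M * A = R := by
    ext i j
    rw [← h i j, dotProduct_comm]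
    rw [Matrix.mulVec_mulVec, dotProduct_comm, ← Matrix.vecMul_transpose,
      ← Matrix.dotProduct_mulVec, Matrix.mulVec_mulVec, ← mul_assoc]
    simp
  rw [← h1]
  calc M = (A * Aᵀ) * M * (A * Aᵀ) := by rw [hA]; simp
    _ = _ := by simp only [mul_assoc]

theorem reMat_spinAct (u : Spin n × Spin r × Circle) (ψ φ : TwistedSpinor r n) :
    reMat (spinAct u ψ) (spinAct u φ) =
      (spinCover n u.1).1 * reMat ψ φ * (spinCover n u.1).1ᵀ := by
  refine eq_conj_of_form (SO_mul_transpose _) fun i j => ?_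
  rw [dot_reMat, ← spinAct_E, ← spinAct_E, herm_spinAct]
  rfl

/-- The action is unitary and rotates Clifford vectors. Because of this rule the endomorphism
defined by a spinor does not depend on the representative. -/
theorem cxMat_spinAct (u : Spin n × Spin r × Circle) (φ : TwistedSpinor r n) :
    cxMat (spinAct u φ) = (spinCover n u.1).1 * cxMat φ * (spinCover n u.1).1ᵀ := by
  refine eq_conj_of_form (SO_mul_transpose _) fun i j => ?_
  rw [dot_cxMat, ← spinAct_E, ← spinAct_E, herm_spinAct]
  rfl

theorem spinAct_quant (u : Spin n × Spin r × Circle) (R : Matrix (Fin n) (Fin n) ℝ)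
    (φ : TwistedSpinor r n) :
    spinAct u (quant r R φ) =
      quant r ((spinCover n u.1).1 * R * (spinCover n u.1).1ᵀ) (spinAct u φ) := by
  set A := (spinCover n u.1).1
  have h1 : ∀ a b, spinAct u (E (e a) (E (e b) φ)) =
      ∑ i, ∑ j, (A i a * A j b) • E (e i) (E (e j) (spinAct u φ)) := by
    intro a b
    rw [spinAct_E, spinAct_E, E_eq_sum]
    refine Finset.sum_congr rfl fun i _ => ?_
    rw [E_eq_sum ((spinCover n u.1).1 *ᵥ e b), map_sum, Finset.smul_sum]
    refine Finset.sum_congr rfl fun j _ => ?_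
    rw [LinearMap.map_smul_of_tower, smul_smul]
    simp [A]
  have h2 : spinAct u (quant r R φ) =
      (1 / 2 : ℝ) • ∑ a, ∑ b, R a b • spinAct u (E (e a) (E (e b) φ)) := by
    simp only [quant, map_sum, LinearMap.map_smul_of_tower]
  rw [h2, quant]
  congr 1
  simp only [h1, Finset.smul_sum, smul_smul]
  have h3 : ∀ i j, (A * R * Aᵀ) i j = ∑ a, ∑ b, R a b * (A i a * A j b) := by
    intro i j
    simp only [Matrix.mul_apply, Finset.sum_mul, Matrix.transpose_apply]
    rw [Finset.sum_comm]
    exact Finset.sum_congr rfl fun a _ => Finset.sum_congr rfl fun b _ => by ring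
  simp only [h3, Finset.sum_smul]
  calc _ = ∑ a, ∑ i, ∑ b, ∑ j, (R a b * (A i a * A j b)) • E (e i) (E (e j) (spinAct u φ)) :=
        Finset.sum_congr rfl fun a _ => Finset.sum_comm
    _ = ∑ i, ∑ a, ∑ b, ∑ j, (R a b * (A i a * A j b)) • E (e i) (E (e j) (spinAct u φ)) :=
        Finset.sum_comm
    _ = ∑ i, ∑ a, ∑ j, ∑ b, (R a b * (A i a * A j b)) • E (e i) (E (e j) (spinAct u φ)) :=
        Finset.sum_congr rfl fun i _ => Finset.sum_congr rfl fun a _ => Finset.sum_comm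
    _ = _ := Finset.sum_congr rfl fun i _ => Finset.sum_comm

theorem InSigma.spinAct {φ : TwistedSpinor r n} (h : InSigma φ) (u : Spin n × Spin r × Circle) :
    InSigma (spinAct u φ) := by
  rcases Nat.even_or_odd r with hr | hr
  · rcases h with h | h | h | h
    · exact absurd h (Nat.not_odd_iff_even.mpr hr)
    · exact Or.inr (Or.inl h)
    · exact Or.inr (Or.inr (Or.inl h))
    · exact Or.inr (Or.inr (Or.inr (by rw [spinAct_volume hr, h, map_smul])))
  · exact Or.inl hr

/-- The conditions for the basis f_k at the transformed spinor are those for the orthonormal basis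
λᵣ(b)ᵀ f_k at φ, which hold by `herm_F_F` and `etaMap_F_F`. The subspace V is rotated by λₙ(a). -/
theorem IsPartiallyPure.spinAct {φ : TwistedSpinor r n} (hφ : IsPartiallyPure φ)
    (u : Spin n × Spin r × Circle) : IsPartiallyPure (spinAct u φ) := by
  set A := spinCover n u.1 with hA
  set B := spinCover r u.2.1 with hB
  have hFF : ∀ k l, F (e k) (F (e l) (TwistedSpin.spinAct u φ)) =
      TwistedSpin.spinAct u (F (B.1ᵀ *ᵥ e k) (F (B.1ᵀ *ᵥ e l) φ)) := by
    intro k l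
    rw [spinAct_F, spinAct_F, ← hB, Matrix.mulVec_mulVec, Matrix.mulVec_mulVec, SO_mul_transpose,
      Matrix.one_mulVec, Matrix.one_mulVec]
  have horth : ∀ k l : Fin r, k ≠ l → (B.1ᵀ *ᵥ e k) ⬝ᵥ (B.1ᵀ *ᵥ e l) = 0 := by
    intro k l hkl
    rw [Matrix.dotProduct_mulVec, ← Matrix.mulVec_transpose, Matrix.mulVec_mulVec,
      Matrix.transpose_transpose, SO_mul_transpose, Matrix.one_mulVec, e_dot_ne hkl]
  have hz : ∀ k l : Fin r, k ≠ l →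
      herm (F (e k) (F (e l) (TwistedSpin.spinAct u φ))) (TwistedSpin.spinAct u φ) = 0 := by
    intro k l hkl
    rw [hFF, herm_spinAct, hφ.herm_F_F (horth k l hkl)]
  refine ⟨hφ.inSigma.spinAct u, by rw [herm_spinAct, hφ.unit], ?_, ?_, ?_, ?_⟩
  · obtain ⟨V, hV, hJ⟩ := hφ.exists_subspace
    refine ⟨V.map A.1.mulVecLin, ?_, ?_⟩
    · have hinj : Function.Injective A.1.mulVecLin := by
        intro x y hxy
        have := congrArg (fun v => A.1ᵀ *ᵥ v) hxy
        simpa [Matrix.mulVec_mulVec, SO_transpose_mul] using this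
      rw [← (Submodule.equivMapOfInjective _ hinj V).finrank_eq, hV]
    · rintro _ ⟨X, hX, rfl⟩
      obtain ⟨Y, hY, h⟩ := hJ X hX
      refine ⟨_, ⟨Y, hY, rfl⟩, ?_⟩
      change E X φ = Complex.I • E Y φ at h
      change E (A.1 *ᵥ X) _ = Complex.I • E (A.1 *ᵥ Y) _
      rw [← spinAct_E, ← spinAct_E, h, map_smul]
  · intro k l hkl
    rw [clMul_eta _ _ _ (by rw [hz k l hkl.ne]; rfl), twMul_basis, hFF, reMat_spinAct,
      ← spinAct_quant, ← map_add, hφ.etaMap_F_F (horth k l hkl.ne), map_zero]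
  · intro k l hkl
    rw [twMul_basis, hz k l hkl.ne]
  · intro h4
    rw [spinAct_volume (by rw [h4]; decide), herm_spinAct, hφ.four h4]

end Equivariance

/-! ### Smooth vector fields -/

section Fields

variable {n : ℕ} {M : Type*} [TopologicalSpace M] [ChartedSpace (EuclideanSpace ℝ (Fin n)) M]
  [IsManifold (𝓡 n) ∞ M]

theorem SmoothField.mono {U W : Set M} {X : (x : M) → TangentSpace (𝓡 n) x}
    (h : SmoothField U X) (hW : W ⊆ U) : SmoothField W X := ContMDiffOn.mono h hW

theorem SmoothField.congr {U : Set M} {X Y : (x : M) → TangentSpace (𝓡 n) x}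
    (h : SmoothField U X) (hXY : ∀ x ∈ U, Y x = X x) : SmoothField U Y :=
  ContMDiffOn.congr h fun x hx => by rw [hXY x hx]

theorem SmoothField.of_locally {U : Set M} {X : (x : M) → TangentSpace (𝓡 n) x}
    (h : ∀ x ∈ U, ∃ W, IsOpen W ∧ x ∈ W ∧ SmoothField (U ∩ W) X) : SmoothField U X :=
  contMDiffOn_of_locally_contMDiffOn h

theorem SmoothField.sub {U : Set M} {X Y : (x : M) → TangentSpace (𝓡 n) x}
    (hX : SmoothField U X) (hY : SmoothField U Y) : SmoothField U (fun x => X x - Y x) :=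
  ContMDiffOn.sub_section hX hY

theorem SmoothField.smul {U : Set M} {f : M → ℝ} {X : (x : M) → TangentSpace (𝓡 n) x}
    (hf : ContMDiffOn (𝓡 n) 𝓘(ℝ, ℝ) ∞ f U) (hX : SmoothField U X) :
    SmoothField U (fun x => f x • X x) :=
  ContMDiffOn.smul_section hf hX

theorem SmoothField.sum {U : Set M} {ι : Type*} (s : Finset ι)
    {X : ι → (x : M) → TangentSpace (𝓡 n) x} (hX : ∀ i ∈ s, SmoothField U (X i)) :
    SmoothField U (fun x => ∑ i ∈ s, X i x) :=
  ContMDiffOn.sum_section hX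

variable [Bundle.RiemannianBundle (fun x : M => TangentSpace (𝓡 n) x)]

theorem SmoothField.inner
    [IsContMDiffRiemannianBundle (𝓡 n) ∞ (EuclideanSpace ℝ (Fin n))
      (fun x : M => TangentSpace (𝓡 n) x)]
    {U : Set M} {X Y : (x : M) → TangentSpace (𝓡 n) x}
    (hX : SmoothField U X) (hY : SmoothField U Y) :
    ContMDiffOn (𝓡 n) 𝓘(ℝ, ℝ) ∞ (fun x => inner ℝ (X x) (Y x)) U :=
  ContMDiffOn.inner_bundle hX hY

end Fields

/-! ### Coordinates with respect to an orthonormal frame -/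

section Frames

variable {n : ℕ} {T : Type*} [NormedAddCommGroup T] [InnerProductSpace ℝ T]

/-- The linear combination of a frame with given coefficients. -/
def comb (f : OrthonormalBasis (Fin n) ℝ T) : (Fin n → ℝ) →ₗ[ℝ] T where
  toFun c := ∑ i, c i • f i
  map_add' c d := by simp [add_smul, Finset.sum_add_distrib]
  map_smul' a c := by simp [mul_smul, Finset.smul_sum]

/-- The coefficients of a vector with respect to an orthonormal frame. -/
def coords (f : OrthonormalBasis (Fin n) ℝ T) : T →ₗ[ℝ] (Fin n → ℝ) where
  toFun v := fun i => inner ℝ (f i) v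
  map_add' v w := by ext; simp [inner_add_right]
  map_smul' a c := by ext; simp [inner_smul_right]

theorem comb_apply (f : OrthonormalBasis (Fin n) ℝ T) (c : Fin n → ℝ) :
    comb f c = ∑ i, c i • f i := rfl

theorem coords_apply (f : OrthonormalBasis (Fin n) ℝ T) (v : T) (i : Fin n) :
    coords f v i = inner ℝ (f i) v := rfl

theorem comb_coords (f : OrthonormalBasis (Fin n) ℝ T) (v : T) : comb f (coords f v) = v :=
  f.sum_repr' v

theorem coords_comb (f : OrthonormalBasis (Fin n) ℝ T) (c : Fin n → ℝ) :
    coords f (comb f c) = c := by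
  ext i
  rw [coords_apply, comb_apply, inner_sum]
  simp [inner_smul_right, OrthonormalBasis.inner_eq_ite]

theorem comb_single (f : OrthonormalBasis (Fin n) ℝ T) (i : Fin n) : comb f (e i) = f i := by
  simp [comb_apply, Pi.single_apply]

theorem inner_comb (f : OrthonormalBasis (Fin n) ℝ T) (c d : Fin n → ℝ) :
    inner ℝ (comb f c) (comb f d) = c ⬝ᵥ d := by
  rw [comb_apply, sum_inner]
  refine Finset.sum_congr rfl fun i _ => ?_
  rw [real_inner_smul_left, ← coords_apply, coords_comb]

theorem inner_eq_coords (f : OrthonormalBasis (Fin n) ℝ T) (v w : T) :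
    inner ℝ v w = coords f v ⬝ᵥ coords f w := by
  rw [← inner_comb f, comb_coords, comb_coords]

theorem comb_injective (f : OrthonormalBasis (Fin n) ℝ T) : Function.Injective (comb f) :=
  Function.LeftInverse.injective (coords_comb f)

theorem comb_of_mul {f f' : OrthonormalBasis (Fin n) ℝ T} {A : Matrix (Fin n) (Fin n) ℝ}
    (h : ∀ j, f' j = ∑ i, A i j • f i) (c : Fin n → ℝ) : comb f' c = comb f (A *ᵥ c) := by
  simp only [comb_apply, h, Finset.smul_sum, smul_smul, Matrix.mulVec, dotProduct,
    Finset.sum_smul]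
  rw [Finset.sum_comm]
  exact Finset.sum_congr rfl fun i _ => Finset.sum_congr rfl fun j _ => by rw [mul_comm]

theorem coords_of_mul {f f' : OrthonormalBasis (Fin n) ℝ T} {A : Matrix (Fin n) (Fin n) ℝ}
    (h : ∀ j, f' j = ∑ i, A i j • f i) (v : T) : coords f' v = Aᵀ *ᵥ coords f v := by
  ext j
  rw [coords_apply, h, sum_inner]
  simp only [real_inner_smul_left, Matrix.mulVec, dotProduct, Matrix.transpose_apply]
  rfl

/-- The endomorphism with a given matrix with respect to an orthonormal frame. -/
def frameMap (f : OrthonormalBasis (Fin n) ℝ T) (A : Matrix (Fin n) (Fin n) ℝ) : T →ₗ[ℝ] T :=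
  comb f ∘ₗ A.mulVecLin ∘ₗ coords f

theorem frameMap_apply (f : OrthonormalBasis (Fin n) ℝ T) (A : Matrix (Fin n) (Fin n) ℝ) (v : T) :
    frameMap f A v = comb f (A *ᵥ coords f v) := rfl

theorem frameMap_of_mul {f f' : OrthonormalBasis (Fin n) ℝ T} {A : Matrix (Fin n) (Fin n) ℝ}
    (h : ∀ j, f' j = ∑ i, A i j • f i) (C : Matrix (Fin n) (Fin n) ℝ) :
    frameMap f' C = frameMap f (A * C * Aᵀ) := by
  ext v
  rw [frameMap_apply, frameMap_apply, comb_of_mul h, coords_of_mul h, Matrix.mulVec_mulVec,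
    Matrix.mulVec_mulVec]

theorem finrank_range_frameMap (f : OrthonormalBasis (Fin n) ℝ T)
    (A : Matrix (Fin n) (Fin n) ℝ) :
    Module.finrank ℝ (LinearMap.range (frameMap f A)) =
      Module.finrank ℝ (LinearMap.range A.mulVecLin) := by
  have h : LinearMap.range (frameMap f A) = (LinearMap.range A.mulVecLin).map (comb f) := by
    rw [frameMap, LinearMap.range_comp, LinearMap.range_comp_of_range_eq_top]
    exact LinearMap.range_eq_top.mpr (Function.RightInverse.surjective (coords_comb f))
  rw [h, ← (Submodule.equivMapOfInjective _ (comb_injective f) _).finrank_eq]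

end Frames

/-! ### From partially pure spinor fields to almost CR hermitian structures -/

section SpinorToCR

variable {n r : ℕ}

/-- The entries are real quadratic polynomials in φ. -/
theorem contDiff_cxMat (i j : Fin n) :
    ContDiff ℝ ∞ (fun φ : TwistedSpinor r n => cxMat φ i j) := by
  have h1 : ∀ k, ContDiff ℝ ∞ (fun φ : TwistedSpinor r n => E (e i) (E (e j) φ) k) := by
    intro k
    let L : TwistedSpinor r n →ₗ[ℝ] ℂ :=
      (LinearMap.proj k ∘ₗ (E (e i) ∘ₗ E (e j) : Module.End ℂ (TwistedSpinor r n))).restrictScalars ℝ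
    exact (LinearMap.toContinuousLinearMap L).contDiff
  have h2 : ∀ k, ContDiff ℝ ∞ (fun φ : TwistedSpinor r n => (starRingEnd ℂ) (φ k)) := by
    intro k
    let L : TwistedSpinor r n →ₗ[ℝ] ℂ :=
      Complex.conjAe.toLinearMap ∘ₗ (LinearMap.proj k : TwistedSpinor r n →ₗ[ℝ] ℂ)
    exact (LinearMap.toContinuousLinearMap L).contDiff
  have h3 : (fun φ : TwistedSpinor r n => cxMat φ i j) =
      fun φ => -Complex.imCLM (∑ k, E (e i) (E (e j) φ) k * (starRingEnd ℂ) (φ k)) := rfl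
  rw [h3]
  exact (Complex.imCLM.contDiff.comp (ContDiff.sum fun k _ => (h1 k).mul (h2 k))).neg

variable {M : Type*} [TopologicalSpace M] [ChartedSpace (EuclideanSpace ℝ (Fin n)) M]
  [IsManifold (𝓡 n) ∞ M] [Bundle.RiemannianBundle (fun x : M => TangentSpace (𝓡 n) x)]

namespace SpinCRStructure

variable {o : ManifoldOrientation n M} (S : SpinCRStructure o r)

/-- The endomorphism of `TₓM` given by `cxMat`. -/
def cxMap {x : M} (ψ : S.SpinorFiber x) : TangentSpace (𝓡 n) x →ₗ[ℝ] TangentSpace (𝓡 n) x :=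
  Quot.lift (fun a : S.P.Fiber x × {v : TwistedSpinor r n // InSigma v} =>
      frameMap (S.toFrame a.1).1 (cxMat a.2.1))
    (by
      rintro ⟨p, v⟩ ⟨q, w⟩ ⟨g, hp, hw⟩
      change p = S.P.act q g at hp
      change w.1 = _ *ᵥ v.1 at hw
      change frameMap (S.toFrame p).1 (cxMat v.1) = frameMap (S.toFrame q).1 (cxMat w.1)
      obtain ⟨u, rfl⟩ := QuotientGroup.mk_surjective g
      rw [hw, repCR_mk, cxMat_spinAct]
      subst hp
      exact frameMap_of_mul (fun j => S.toFrame_act q _ j) _) ψ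

theorem cxMap_mk {x : M} (p : S.P.Fiber x) (v : {v : TwistedSpinor r n // InSigma v}) :
    S.cxMap (S.mkSpinor p v) = frameMap (S.toFrame p).1 (cxMat v.1) := rfl

theorem cxMap_spec {x : M} {ψ : S.SpinorFiber x} (h : S.IsPartiallyPureAt ψ) :
    (∀ u, S.cxMap ψ (S.cxMap ψ (S.cxMap ψ u)) = -S.cxMap ψ u) ∧
      (∀ u w, inner ℝ (S.cxMap ψ u) w = -inner ℝ u (S.cxMap ψ w)) ∧
      Module.finrank ℝ (LinearMap.range (S.cxMap ψ)) + r = n := by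
  obtain ⟨⟨p, v⟩, rfl⟩ := Quot.exists_rep ψ
  have hv : IsPartiallyPure v.1 := h p v rfl
  obtain ⟨h3, hrank⟩ := hv.cxMat_spec
  change (∀ u, frameMap (S.toFrame p).1 (cxMat v.1) (frameMap (S.toFrame p).1 (cxMat v.1)
      (frameMap (S.toFrame p).1 (cxMat v.1) u)) = -frameMap (S.toFrame p).1 (cxMat v.1) u) ∧
    (∀ u w, inner ℝ (frameMap (S.toFrame p).1 (cxMat v.1) u) w =
      -inner ℝ u (frameMap (S.toFrame p).1 (cxMat v.1) w)) ∧
    Module.finrank ℝ (LinearMap.range (frameMap (S.toFrame p).1 (cxMat v.1))) + r = n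
  refine ⟨fun u => ?_, fun u w => ?_, ?_⟩
  · simp only [frameMap_apply, coords_comb]
    rw [h3, map_neg]
  · rw [inner_eq_coords (S.toFrame p).1, inner_eq_coords (S.toFrame p).1 u, frameMap_apply,
      frameMap_apply, coords_comb, coords_comb, dotProduct_comm,
      dot_mulVec_of_skew (cxMat_transpose hv.unit)]
  · rw [finrank_range_frameMap, hrank]

variable [IsContMDiffRiemannianBundle (𝓡 n) ∞ (EuclideanSpace ℝ (Fin n))
    (fun x : M => TangentSpace (𝓡 n) x)]

theorem smoothField_cxMap {φ : (x : M) → S.SpinorFiber x} (hφ : S.IsSmoothSpinor φ) {U : Set M}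
    {X : (x : M) → TangentSpace (𝓡 n) x} (hX : SmoothField U X) :
    SmoothField U (fun x => S.cxMap (φ x) (X x)) := by
  refine SmoothField.of_locally fun x₀ _ => ?_
  obtain ⟨c, hc, hx₀⟩ := S.P.cover x₀
  refine ⟨c.1, S.P.isOpen c hc, hx₀, ?_⟩
  obtain ⟨v, hv, hφv⟩ := hφ c hc
  have hf := S.toFrame_smooth c hc
  have hM : ∀ i j, ContMDiffOn (𝓡 n) 𝓘(ℝ, ℝ) ∞ (fun x => cxMat (v x).1 i j) (U ∩ c.1) :=
    fun i j => (contDiff_cxMat i j).contMDiff.comp_contMDiffOn (hv.mono Set.inter_subset_right)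
  have h : SmoothField (U ∩ c.1) (fun x => ∑ i, (∑ j, cxMat (v x).1 i j *
      inner ℝ ((S.toFrame (c.2 x)).1 j) (X x)) • (S.toFrame (c.2 x)).1 i) :=
    SmoothField.sum _ fun i _ => SmoothField.smul
      (contMDiffOn_finsetSum fun j _ => (hM i j).mul
        (((hf j).mono Set.inter_subset_right).inner (hX.mono Set.inter_subset_left)))
      ((hf i).mono Set.inter_subset_right)
  refine h.congr fun x hx => ?_
  rw [hφv x hx.2, cxMap_mk]
  rfl

/-- Fixed coefficient vectors whose images form a basis of the range at x₀ have linearly independent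
images nearby, since independence is an open condition. As the rank is constant, these images span.
-/
theorem exists_local_frame_range {φ : (x : M) → S.SpinorFiber x} (hφ : S.IsSmoothSpinor φ)
    (hpp : ∀ x, S.IsPartiallyPureAt (φ x)) (x₀ : M) :
    ∃ U : Set M, IsOpen U ∧ x₀ ∈ U ∧
      ∃ e : Fin (n - r) → (x : M) → TangentSpace (𝓡 n) x, (∀ i, SmoothField U (e i)) ∧
        ∀ x ∈ U, Submodule.span ℝ (Set.range fun i => e i x) = LinearMap.range (S.cxMap (φ x)) := by
  obtain ⟨c, hc, hx₀⟩ := S.P.cover x₀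
  obtain ⟨v, hv, hφv⟩ := hφ c hc
  have hf := S.toFrame_smooth c hc
  have hpv : ∀ x ∈ c.1, IsPartiallyPure (v x).1 := fun x hx => hpp x _ _ (hφv x hx)
  have hrank : Module.finrank ℝ (LinearMap.range (cxMat (v x₀).1).mulVecLin) = n - r := by
    have := (hpv x₀ hx₀).cxMat_spec.2
    omega
  let b := Module.finBasisOfFinrankEq ℝ _ hrank
  choose w hw using fun i => LinearMap.mem_range.mp (b i).2
  have hli : LinearIndependent ℝ (fun i => cxMat (v x₀).1 *ᵥ w i) := by
    have h1 : (fun i => cxMat (v x₀).1 *ᵥ w i) = fun i => ((b i : Fin n → ℝ)) := funext hw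
    rw [h1]
    exact b.linearIndependent.map' (Submodule.subtype _) (Submodule.ker_subtype _)
  have hM : ∀ i j, ContMDiffOn (𝓡 n) 𝓘(ℝ, ℝ) ∞ (fun x => cxMat (v x).1 i j) c.1 :=
    fun i j => (contDiff_cxMat i j).contMDiff.comp_contMDiffOn hv
  have hcont : ContinuousOn (fun x => fun i => cxMat (v x).1 *ᵥ w i) c.1 := by
    refine continuousOn_pi.mpr fun i => continuousOn_pi.mpr fun j => ?_
    change ContinuousOn (fun x => ∑ k, cxMat (v x).1 j k * w i k) c.1
    exact continuousOn_finsetSum _ fun k _ => ((hM j k).continuousOn).mul continuousOn_const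
  let ef : Fin (n - r) → (x : M) → TangentSpace (𝓡 n) x := fun i x =>
    S.cxMap (φ x) (comb (S.toFrame (c.2 x)).1 (w i))
  have hef : ∀ i, ∀ x ∈ c.1, ef i x = comb (S.toFrame (c.2 x)).1 (cxMat (v x).1 *ᵥ w i) := by
    intro i x hx
    change S.cxMap (φ x) _ = _
    rw [hφv x hx, cxMap_mk, frameMap_apply, coords_comb]
  refine ⟨c.1 ∩ (fun x => fun i => cxMat (v x).1 *ᵥ w i) ⁻¹' {f | LinearIndependent ℝ f},
    hcont.isOpen_inter_preimage (S.P.isOpen c hc) isOpen_setOfPred_linearIndependent, ⟨hx₀, hli⟩,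
    ef, ?_, ?_⟩
  · intro i
    refine SmoothField.mono (S.smoothField_cxMap hφ ?_) Set.inter_subset_left
    exact SmoothField.sum Finset.univ fun j _ =>
      SmoothField.smul (contMDiffOn_const (c := w i j)) (hf j)
  · rintro x ⟨hx, hxli⟩
    have : FiniteDimensional ℝ (TangentSpace (𝓡 n) x) :=
      Module.Finite.of_basis (S.toFrame (c.2 x)).1.toBasis
    apply Submodule.eq_of_le_of_finrank_eq
    · rw [Submodule.span_le]
      rintro _ ⟨i, rfl⟩
      exact ⟨_, rfl⟩
    · have h1 : LinearIndependent ℝ (fun i => ef i x) := by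
        have h2 := LinearIndependent.map' hxli (comb (S.toFrame (c.2 x)).1)
          (LinearMap.ker_eq_bot.mpr (comb_injective _))
        have h3 : (fun i => ef i x) = comb (S.toFrame (c.2 x)).1 ∘ fun i => cxMat (v x).1 *ᵥ w i :=
          funext fun i => hef i x hx
        rw [h3]; exact h2
      rw [finrank_span_eq_card h1, Fintype.card_fin]
      have := (S.cxMap_spec (hpp x)).2.2
      omega

/-- The almost CR hermitian structure defined by a partially pure spinor field. -/
def toAlmostCRHermitian {φ : (x : M) → S.SpinorFiber x} (hφ : S.IsSmoothSpinor φ)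
    (hpp : ∀ x, S.IsPartiallyPureAt (φ x)) : AlmostCRHermitian n M r where
  D x := LinearMap.range (S.cxMap (φ x))
  finrank_D x := (S.cxMap_spec (hpp x)).2.2
  smooth_D := S.exists_local_frame_range hφ hpp
  J x := (S.cxMap (φ x)).restrict fun u _ => LinearMap.mem_range_self _ u
  J_J x u := by
    obtain ⟨_, w, rfl⟩ := u
    exact Subtype.ext ((S.cxMap_spec (hpp x)).1 w)
  smooth_J U X _ hX := S.smoothField_cxMap hφ hX
  orthogonal x u v := by
    obtain ⟨_, w, rfl⟩ := v
    obtain ⟨h1, h2, -⟩ := S.cxMap_spec (hpp x)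
    change inner ℝ (S.cxMap (φ x) u.1) (S.cxMap (φ x) (S.cxMap (φ x) w)) =
      inner ℝ u.1 (S.cxMap (φ x) w)
    -- ⟨L u, L L w⟩ = -⟨u, L L L w⟩ = ⟨u, L w⟩, because L is skew and L³ = -L.
    rw [h2, h1, inner_neg_right, neg_neg]

end SpinCRStructure

end SpinorToCR

/-! ### The kernel of the double covering -/

section Kernel

variable {n : ℕ}

/-- The linear form `w ↦ -2 ⟨v, w⟩`. -/
def dualForm (v : Fin n → ℝ) : Module.Dual ℝ (Fin n → ℝ) where
  toFun w := -2 * (v ⬝ᵥ w)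
  map_add' x y := by rw [dotProduct_add]; ring
  map_smul' c x := by rw [dotProduct_smul, RingHom.id_apply, smul_eq_mul, smul_eq_mul]; ring

/-- Both sides are antiderivations in x with the value -2⟨v, w⟩ on a vector w. For even x that
commutes with v the left side is zero, so the contraction vanishes. -/
theorem vec_mul_sub_involute_mul_vec (v : Fin n → ℝ) (x : Cl n) :
    vec v * x - CliffordAlgebra.involute x * vec v =
      CliffordAlgebra.contractLeft (dualForm v) x := by
  induction x using CliffordAlgebra.left_induction with
  | algebraMap c =>
    rw [AlgHom.commutes, CliffordAlgebra.contractLeft_algebraMap, Algebra.commutes, sub_self]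
  | add x y hx hy =>
    rw [map_add, map_add, ← hx, ← hy, mul_add, add_mul]; abel
  | ι_mul x w hx =>
    have h := vec_mul_vec_add_swap v w
    rw [map_mul, CliffordAlgebra.involute_ι, CliffordAlgebra.contractLeft_ι_mul, ← hx]
    have h2 : dualForm v w • x = algebraMap ℝ (Cl n) (-2 * (v ⬝ᵥ w)) * x := by
      rw [Algebra.smul_def]; rfl
    rw [h2, ← h]
    noncomm_ring

/-- The number operator of the exterior algebra of `ℝⁿ`. -/
def numberOp (n : ℕ) : ExteriorAlgebra ℝ (Fin n → ℝ) →ₗ[ℝ] ExteriorAlgebra ℝ (Fin n → ℝ) :=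
  ∑ i, (LinearMap.mulLeft ℝ (ExteriorAlgebra.ι ℝ (Pi.single i 1 : Fin n → ℝ))) ∘ₗ
    CliffordAlgebra.contractLeft (LinearMap.proj i : (Fin n → ℝ) →ₗ[ℝ] ℝ)

theorem numberOp_apply (x : ExteriorAlgebra ℝ (Fin n → ℝ)) :
    numberOp n x = ∑ i, ExteriorAlgebra.ι ℝ (Pi.single i 1 : Fin n → ℝ) *
      CliffordAlgebra.contractLeft (LinearMap.proj i : (Fin n → ℝ) →ₗ[ℝ] ℝ) x := by
  simp [numberOp]

/-- Moving w∧ out of the i-th summand changes the sign twice and leaves the extra term wᵢ eᵢ ∧ x;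
these terms add up to w ∧ x. -/
theorem numberOp_ι_mul (w : Fin n → ℝ) (x : ExteriorAlgebra ℝ (Fin n → ℝ)) :
    numberOp n (ExteriorAlgebra.ι ℝ w * x) =
      ExteriorAlgebra.ι ℝ w * x + ExteriorAlgebra.ι ℝ w * numberOp n x := by
  have hw : ExteriorAlgebra.ι ℝ w * x =
      ∑ i, w i • (ExteriorAlgebra.ι ℝ (Pi.single i 1 : Fin n → ℝ) * x) := by
    have : w = ∑ i, w i • (Pi.single i 1 : Fin n → ℝ) := by
      ext j; simp [Finset.sum_apply, Pi.single_apply]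
    conv_lhs => rw [this]
    rw [map_sum, Finset.sum_mul]
    simp
  rw [numberOp_apply, numberOp_apply, hw, Finset.mul_sum, ← Finset.sum_add_distrib]
  refine Finset.sum_congr rfl fun i _ => ?_
  have h1 : CliffordAlgebra.contractLeft (LinearMap.proj i : (Fin n → ℝ) →ₗ[ℝ] ℝ)
      (ExteriorAlgebra.ι ℝ w * x) = w i • x - ExteriorAlgebra.ι ℝ w *
        CliffordAlgebra.contractLeft (LinearMap.proj i : (Fin n → ℝ) →ₗ[ℝ] ℝ) x :=
    CliffordAlgebra.contractLeft_ι_mul _ _ _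
  have h2 : ExteriorAlgebra.ι ℝ (Pi.single i 1 : Fin n → ℝ) * ExteriorAlgebra.ι ℝ w =
      -(ExteriorAlgebra.ι ℝ w * ExteriorAlgebra.ι ℝ (Pi.single i 1 : Fin n → ℝ)) :=
    eq_neg_of_add_eq_zero_left (ExteriorAlgebra.ι_add_mul_swap _ _)
  rw [← hw, h1, mul_sub, mul_smul_comm, ← mul_assoc, h2, neg_mul, sub_neg_eq_add, mul_assoc]

theorem numberOp_of_mem (k : ℕ) (x : ExteriorAlgebra ℝ (Fin n → ℝ))
    (hx : x ∈ ⋀[ℝ]^k (Fin n → ℝ)) : numberOp n x = (k : ℝ) • x := by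
  induction hx using Submodule.pow_induction_on_left' with
  | algebraMap c =>
    rw [numberOp_apply]
    simp [CliffordAlgebra.contractLeft_algebraMap]
  | add x y i _ _ ihx ihy => rw [map_add, ihx, ihy, smul_add]
  | mem_mul m hm i x _ ih =>
    obtain ⟨w, rfl⟩ := hm
    rw [numberOp_ι_mul, ih, mul_smul_comm]
    push_cast
    rw [add_smul, one_smul, add_comm]

/-- The number operator annihilates x and multiplies its component of degree k by k, so only degree
0 survives. -/
theorem exists_algebraMap_of_contractLeft {x : ExteriorAlgebra ℝ (Fin n → ℝ)}
    (hx : ∀ i, CliffordAlgebra.contractLeft (LinearMap.proj i : (Fin n → ℝ) →ₗ[ℝ] ℝ) x = 0) :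
    ∃ c : ℝ, x = algebraMap ℝ _ c := by
  have hN : numberOp n x = 0 := by
    rw [numberOp_apply]
    exact Finset.sum_eq_zero fun i _ => by rw [hx, mul_zero]
  let 𝒜 : ℕ → Submodule ℝ (ExteriorAlgebra ℝ (Fin n → ℝ)) := fun k => ⋀[ℝ]^k (Fin n → ℝ)
  have key : ∀ (k : ℕ) (y : ExteriorAlgebra ℝ (Fin n → ℝ)),
      (DirectSum.decompose 𝒜 (numberOp n y) k : ExteriorAlgebra ℝ (Fin n → ℝ)) =
        (k : ℝ) • (DirectSum.decompose 𝒜 y k : ExteriorAlgebra ℝ (Fin n → ℝ)) := by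
    intro k y
    induction y using DirectSum.Decomposition.inductionOn 𝒜 with
    | zero => simp
    | @homogeneous i m =>
      rw [numberOp_of_mem i m.1 m.2]
      by_cases h : i = k
      · subst h
        rw [DirectSum.decompose_smul]
        rfl
      · rw [DirectSum.decompose_of_mem_ne 𝒜 (Submodule.smul_mem _ _ m.2) h,
          DirectSum.decompose_of_mem_ne 𝒜 m.2 h, smul_zero]
    | add y z hy hz =>
      rw [map_add, DirectSum.decompose_add, DirectSum.decompose_add, DirectSum.add_apply,
        DirectSum.add_apply, Submodule.coe_add, Submodule.coe_add, hy, hz, smul_add]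
  have h0 : ∀ k, k ≠ 0 → (DirectSum.decompose 𝒜 x k : ExteriorAlgebra ℝ (Fin n → ℝ)) = 0 := by
    intro k hk
    have := key k x
    rw [hN, DirectSum.decompose_zero, DirectSum.zero_apply] at this
    exact (smul_eq_zero.mp this.symm).resolve_left (by exact_mod_cast hk)
  have hsum : x = (DirectSum.decompose 𝒜 x 0 : ExteriorAlgebra ℝ (Fin n → ℝ)) := by
    classical
    conv_lhs => rw [← DirectSum.sum_support_decompose 𝒜 x]
    by_cases hm : 0 ∈ (DirectSum.decompose 𝒜 x).support
    · exact Finset.sum_eq_single_of_mem 0 hm fun k _ hk => h0 k hk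
    · rw [Finset.sum_eq_zero fun k hk => h0 k fun h => hm (h ▸ hk)]
      rw [DFinsupp.notMem_support_iff] at hm
      rw [hm]; rfl
  have hmem := (DirectSum.decompose 𝒜 x 0).2
  rw [← hsum] at hmem
  change x ∈ (LinearMap.range (ExteriorAlgebra.ι ℝ : (Fin n → ℝ) →ₗ[ℝ] _)) ^ 0 at hmem
  rw [pow_zero] at hmem
  obtain ⟨c, hc⟩ := Submodule.mem_one.mp hmem
  exact ⟨c, hc.symm⟩

/-- All contractions of a vanish by `vec_mul_sub_involute_mul_vec`. The linear isomorphism with the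
exterior algebra respects contractions and scalars, so the statement there applies. -/
theorem exists_algebraMap_of_involute {a : Cl n} (ha : CliffordAlgebra.involute a = a)
    (h : ∀ v, vec v * a = a * vec v) : ∃ c : ℝ, a = algebraMap ℝ _ c := by
  have h1 : ∀ v, CliffordAlgebra.contractLeft (dualForm v) a = 0 := fun v => by
    rw [← vec_mul_sub_involute_mul_vec, ha, h, sub_self]
  have h2 : ∀ i, CliffordAlgebra.contractLeft (LinearMap.proj i : (Fin n → ℝ) →ₗ[ℝ] ℝ) a = 0 := by
    intro i
    -- The constant undoes the factor -2 in `dualForm`.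
    have : (LinearMap.proj i : (Fin n → ℝ) →ₗ[ℝ] ℝ) = (-1 / 2 : ℝ) • dualForm (e i) := by
      ext j
      simp [dualForm]
      ring
    rw [this, map_smul, LinearMap.smul_apply, h1, smul_zero]
  have hQ : (CliffordAlgebra.equivExterior (negSq n)) a =
    CliffordAlgebra.changeForm CliffordAlgebra.changeForm.associated_neg_proof a := rfl
  obtain ⟨c, hc⟩ := exists_algebraMap_of_contractLeft
    (x := (CliffordAlgebra.equivExterior (negSq n)) a) (fun i => by
      rw [hQ]
      have := CliffordAlgebra.changeForm_contractLeft
        (h := CliffordAlgebra.changeForm.associated_neg_proof (Q := negSq n))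
        (LinearMap.proj i : (Fin n → ℝ) →ₗ[ℝ] ℝ) a
      rw [h2, map_zero] at this
      exact this.symm)
  refine ⟨c, (CliffordAlgebra.equivExterior (negSq n)).injective ?_⟩
  exact hc.trans (CliffordAlgebra.changeForm_algebraMap
    (CliffordAlgebra.changeForm.associated_neg_proof (Q := negSq n)) c).symm

theorem Spin.involute_eq (a : Spin n) :
    CliffordAlgebra.involute ((a : (Cl n)ˣ) : Cl n) = ((a : (Cl n)ˣ) : Cl n) := by
  obtain ⟨a, ha⟩ := a
  change CliffordAlgebra.involute (a : Cl n) = (a : Cl n)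
  induction ha using Subgroup.closure_induction with
  | mem u hu =>
    rcases hu with ⟨x, y, hx, hy, rfl⟩ | rfl
    · change CliffordAlgebra.involute (vec x * vec y) = vec x * vec y
      rw [map_mul, CliffordAlgebra.involute_ι, CliffordAlgebra.involute_ι, neg_mul_neg]
    · simp
  | one => simp
  | mul a b _ _ iha ihb => rw [Units.val_mul, map_mul, iha, ihb]
  | inv a _ ih =>
    rw [← Units.mul_right_inj a, Units.mul_inv]
    nth_rewrite 1 [← ih]
    rw [← map_mul, Units.mul_inv, map_one]

theorem Spin.reverse_mul (a : Spin n) :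
    CliffordAlgebra.reverse ((a : (Cl n)ˣ) : Cl n) * ((a : (Cl n)ˣ) : Cl n) = 1 := by
  obtain ⟨a, ha⟩ := a
  change CliffordAlgebra.reverse (a : Cl n) * (a : Cl n) = 1
  induction ha using Subgroup.closure_induction with
  | mem u hu =>
    rcases hu with ⟨x, y, hx, hy, rfl⟩ | rfl
    · change CliffordAlgebra.reverse (vec x * vec y) * (vec x * vec y) = 1
      rw [CliffordAlgebra.reverse.map_mul, CliffordAlgebra.reverse_ι, CliffordAlgebra.reverse_ι,
        mul_assoc, ← mul_assoc (vec x), vec_mul_self hx, neg_one_mul, mul_neg, vec_mul_self hy,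
        neg_neg]
    · simp
  | one => simp
  | mul a b _ _ iha ihb =>
    rw [Units.val_mul, CliffordAlgebra.reverse.map_mul, mul_assoc, ← mul_assoc _ (a : Cl n), iha,
      one_mul, ihb]
  | inv a _ ih =>
    have h1 : CliffordAlgebra.reverse (a : Cl n) = ((a⁻¹ : (Cl n)ˣ) : Cl n) :=
      (Units.inv_eq_of_mul_eq_one_left ih).symm
    rw [← h1, CliffordAlgebra.reverse_reverse, h1, Units.mul_inv]

/-- An element over the identity is even and commutes with all vectors, so it is a scalar c;
`Spin.reverse_mul` then says c² = 1. -/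
theorem Spin.eq_one_or_negOne {a : Spin n} (h : spinCover n a = 1) :
    a = 1 ∨ a = Spin.negOne n := by
  obtain ⟨c, hc⟩ := exists_algebraMap_of_involute (Spin.involute_eq a) (fun v => by
    have := (spinCover_spec a).mul_vec v
    rw [h] at this
    simpa using this.symm)
  have hinj : Function.Injective (algebraMap ℝ (Cl n)) := fun x y hxy => by
    have := congrArg (kappa n) hxy
    rw [AlgHom.commutes, AlgHom.commutes] at this
    exact (algebraMap ℝ (Matrix (SpinIdx n) (SpinIdx n) ℂ)).injective this
  have h1 := Spin.reverse_mul a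
  rw [hc, CliffordAlgebra.reverse.commutes, ← map_mul, ← map_one (algebraMap ℝ (Cl n))] at h1
  rcases mul_self_eq_one_iff.mp (hinj h1) with h2 | h2
  · left
    exact Subtype.ext (Units.ext (by rw [hc, h2, map_one]; rfl))
  · right
    exact Subtype.ext (Units.ext (by rw [hc, h2, map_neg, map_one]; rfl))

theorem Spin.eq_or_eq_negOne_mul {a b : Spin n} (h : spinCover n a = spinCover n b) :
    a = b ∨ a = Spin.negOne n * b := by
  have : spinCover n (a * b⁻¹) = 1 := by rw [map_mul, map_inv, h, mul_inv_cancel]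
  rcases Spin.eq_one_or_negOne this with h1 | h1
  · exact Or.inl (mul_inv_eq_one.mp h1)
  · exact Or.inr (mul_inv_eq_iff_eq_mul.mp h1)

end Kernel

/-! ### Smooth local lifts to the spin group -/

section Reflections

variable {k : ℕ}

theorem reflMat_mulVec (x v : Fin k → ℝ) : reflMat x *ᵥ v = v - (2 * (x ⬝ᵥ v)) • x := by
  ext i
  simp [reflMat, Matrix.sub_mulVec, Matrix.smul_mulVec, Matrix.vecMulVec_mulVec]
  ring

theorem reflMat_mulVec_of_orth {x v : Fin k → ℝ} (h : x ⬝ᵥ v = 0) : reflMat x *ᵥ v = v := by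
  rw [reflMat_mulVec, h]; simp

theorem reflMat_mul_self {x : Fin k → ℝ} (hx : x ⬝ᵥ x = 1) : reflMat x * reflMat x = 1 := by
  refine Matrix.ext_of_mulVec_single fun i => ?_
  rw [← Matrix.mulVec_mulVec, reflMat_mulVec, reflMat_mulVec, dotProduct_sub, dotProduct_smul, hx,
    Matrix.one_mulVec]
  simp only [smul_eq_mul, mul_one]
  module

theorem Covers.unitVec_mul {x y : Fin k → ℝ} (hx : x ⬝ᵥ x = 1) (hy : y ⬝ᵥ y = 1) :
    Covers (unitVec x hx * unitVec y hy) (reflMat x * reflMat y) := by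
  intro v
  have h1 := unitVec_conj hy v
  have h2 := unitVec_conj hx (reflMat y *ᵥ v)
  rw [← Matrix.mulVec_mulVec, mul_inv_rev, Units.val_mul, Units.val_mul]
  rw [← neg_eq_iff_eq_neg] at h2
  rw [← h2, ← neg_eq_iff_eq_neg.mpr h1]
  noncomm_ring

/-- The product of two unit vectors as an element of the spin group. -/
def spinPair (x y : Fin k → ℝ) (hx : x ⬝ᵥ x = 1) (hy : y ⬝ᵥ y = 1) : Spin k :=
  ⟨unitVec x hx * unitVec y hy, Subgroup.subset_closure (Or.inl ⟨x, y, hx, hy, rfl⟩)⟩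

theorem spinCover_spinPair (x y : Fin k → ℝ) (hx : x ⬝ᵥ x = 1) (hy : y ⬝ᵥ y = 1) :
    (spinCover k (spinPair x y hx hy)).1 = reflMat x * reflMat y :=
  (spinCover_spec _).unique (Covers.unitVec_mul hx hy)

theorem SO_inv_val (A : SO k) : (A⁻¹).1 = A.1ᵀ := by
  have h : (A⁻¹).1 * A.1 = 1 := congrArg Subtype.val (inv_mul_cancel A)
  calc (A⁻¹).1 = (A⁻¹).1 * (A.1 * A.1ᵀ) := by rw [SO_mul_transpose, mul_one]
    _ = A.1ᵀ := by rw [← mul_assoc, h, one_mul]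

theorem SO_mulVec_dot (A : SO k) (x y : Fin k → ℝ) : (A.1 *ᵥ x) ⬝ᵥ (A.1 *ᵥ y) = x ⬝ᵥ y := by
  rw [Matrix.dotProduct_mulVec, ← Matrix.mulVec_transpose, Matrix.mulVec_mulVec, SO_transpose_mul,
    Matrix.one_mulVec]

theorem spinCover_spinPair_inv (x y : Fin k → ℝ) (hx : x ⬝ᵥ x = 1) (hy : y ⬝ᵥ y = 1) :
    ((spinCover k (spinPair x y hx hy))⁻¹).1 = reflMat y * reflMat x := by
  have h : reflMat y * reflMat x * (reflMat x * reflMat y) = 1 := by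
    rw [mul_assoc, ← mul_assoc (reflMat x), reflMat_mul_self hx, one_mul, reflMat_mul_self hy]
  rw [SO_inv_val, ← spinCover_spinPair x y hx hy] at *
  calc _ = (reflMat y * reflMat x * (spinCover k (spinPair x y hx hy)).1) *
        (spinCover k (spinPair x y hx hy)).1ᵀ := by rw [h, one_mul]
    _ = _ := by rw [mul_assoc, SO_mul_transpose, mul_one]

/-- The unit vector in the direction of `s`; it is `e j` if `s = 0`. -/
def unitDir (j : Fin k) (s : Fin k → ℝ) : Fin k → ℝ :=
  if s = 0 then e j else (√(s ⬝ᵥ s))⁻¹ • s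

theorem dot_self_pos {s : Fin k → ℝ} (h : s ≠ 0) : 0 < s ⬝ᵥ s := by
  have h1 : 0 ≤ s ⬝ᵥ s := Finset.sum_nonneg fun i _ => mul_self_nonneg _
  exact lt_of_le_of_ne h1 fun h2 => h (dotProduct_self_eq_zero.mp h2.symm)

theorem unitDir_dot_self (j : Fin k) (s : Fin k → ℝ) : unitDir j s ⬝ᵥ unitDir j s = 1 := by
  rw [unitDir]
  split_ifs with h
  · exact e_dot_self j
  · have := dot_self_pos h
    rw [dotProduct_smul, smul_dotProduct, smul_smul, smul_eq_mul, ← mul_inv,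
      Real.mul_self_sqrt this.le, inv_mul_cancel₀ this.ne']

theorem reflMat_unitDir_mulVec (j : Fin k) {s : Fin k → ℝ} (h : s ≠ 0) (v : Fin k → ℝ) :
    reflMat (unitDir j s) *ᵥ v = v - (2 * (s ⬝ᵥ v) / (s ⬝ᵥ s)) • s := by
  have := dot_self_pos h
  rw [reflMat_mulVec, unitDir, if_neg h, smul_dotProduct, smul_smul]
  congr 2
  have h2 : (√(s ⬝ᵥ s))⁻¹ * (√(s ⬝ᵥ s))⁻¹ = (s ⬝ᵥ s)⁻¹ := by
    rw [← mul_inv, Real.mul_self_sqrt this.le]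
  rw [smul_eq_mul, div_eq_mul_inv, ← h2]; ring

/-- The direction x + y is preferred to x - y in the smooth lifting, because it stays away from zero
when y is close to x. -/
theorem reflMat_unitDir_add {x y : Fin k → ℝ} (j : Fin k) (hx : x ⬝ᵥ x = 1) (hy : y ⬝ᵥ y = 1)
    (h : x + y ≠ 0) : reflMat (unitDir j (x + y)) *ᵥ y = -x := by
  rw [reflMat_unitDir_mulVec j h]
  have h1 : 2 * ((x + y) ⬝ᵥ y) / ((x + y) ⬝ᵥ (x + y)) = 1 := by
    rw [div_eq_one_iff_eq (dot_self_pos h).ne', add_dotProduct, dotProduct_add, add_dotProduct,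
      add_dotProduct, hx, hy, dotProduct_comm y x]
    ring
  rw [h1, one_smul]; abel

theorem reflMat_unitDir_sub {x y : Fin k → ℝ} (j : Fin k) (hx : x ⬝ᵥ x = y ⬝ᵥ y)
    (h : x - y ≠ 0) : reflMat (unitDir j (x - y)) *ᵥ x = y := by
  rw [reflMat_unitDir_mulVec j h]
  have h1 : 2 * ((x - y) ⬝ᵥ x) / ((x - y) ⬝ᵥ (x - y)) = 1 := by
    rw [div_eq_one_iff_eq (dot_self_pos h).ne', sub_dotProduct, dotProduct_sub, sub_dotProduct,
      sub_dotProduct, hx, dotProduct_comm y x]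
    ring
  rw [h1, one_smul]; abel

theorem unitDir_dot_of_orth {j : Fin k} {s v : Fin k → ℝ} (hs : s ≠ 0) (h : s ⬝ᵥ v = 0) :
    unitDir j s ⬝ᵥ v = 0 := by
  rw [unitDir, if_neg hs, smul_dotProduct, h, smul_zero]

theorem unitDir_of_unit {j : Fin k} {x : Fin k → ℝ} (hx : x ⬝ᵥ x = 1) :
    unitDir j (x + x) = x := by
  have h0 : x + x ≠ 0 := by
    intro h
    have : x = 0 := self_eq_neg.mp (eq_neg_of_add_eq_zero_left h)
    rw [this] at hx; simp at hx
  rw [unitDir, if_neg h0]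
  have h1 : (x + x) ⬝ᵥ (x + x) = 2 ^ 2 := by
    rw [add_dotProduct, dotProduct_add, hx]; norm_num
  rw [h1, Real.sqrt_sq zero_le_two, ← two_smul ℝ x, smul_smul]
  norm_num

end Reflections

/-! ### Smoothness of maps to SO(k) and Spin(k), and local lifting. -/

section Lifts

variable {n : ℕ} {M : Type*} [TopologicalSpace M] [ChartedSpace (EuclideanSpace ℝ (Fin n)) M]
  {k : ℕ}

theorem contMDiffOn_inv_sqrt {U : Set M} {N : M → ℝ}
    (hN : ContMDiffOn (𝓡 n) 𝓘(ℝ, ℝ) ∞ N U) (hpos : ∀ x ∈ U, 0 < N x) :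
    ContMDiffOn (𝓡 n) 𝓘(ℝ, ℝ) ∞ (fun x => (√(N x))⁻¹) U := by
  have h : ContDiffOn ℝ ∞ (fun t : ℝ => (√t)⁻¹) (Set.Ioi 0) := fun t ht =>
    ((Real.contDiffAt_sqrt (ne_of_gt ht)).inv
      (Real.sqrt_ne_zero'.mpr ht)).contDiffWithinAt
  exact h.contMDiffOn.comp hN fun x hx => hpos x hx

theorem smoothSO.mul {U : Set M} {A B : M → SO k} (hA : smoothSO n M k U A)
    (hB : smoothSO n M k U B) : smoothSO n M k U (fun x => A x * B x) := fun i j => by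
  change ContMDiffOn (𝓡 n) 𝓘(ℝ, ℝ) ∞ (fun x => ∑ l, (A x).1 i l * (B x).1 l j) U
  exact contMDiffOn_finsetSum fun l _ => (hA i l).mul (hB l j)

theorem smoothSO.inv {U : Set M} {A : M → SO k} (hA : smoothSO n M k U A) :
    smoothSO n M k U (fun x => (A x)⁻¹) := fun i j => by
  simp only [SO_inv_val]
  exact hA j i

theorem smoothSO.const (U : Set M) (A : SO k) : smoothSO n M k U (fun _ => A) := fun _ _ =>
  contMDiffOn_const

theorem smoothSO.mono {U W : Set M} {A : M → SO k} (hA : smoothSO n M k U A) (h : W ⊆ U) :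
    smoothSO n M k W A := fun i j => (hA i j).mono h

theorem smoothSpin.mono {U W : Set M} {a : M → Spin k} (ha : smoothSpin n M k U a) (h : W ⊆ U) :
    smoothSpin n M k W a := fun ℓ => (ha ℓ).mono h

theorem smoothSpin.mul_spinPair {U : Set M} {a : M → Spin k} (ha : smoothSpin n M k U a)
    {u : M → Fin k → ℝ} (hu1 : ∀ x, u x ⬝ᵥ u x = 1)
    (hu : ∀ i, ContMDiffOn (𝓡 n) 𝓘(ℝ, ℝ) ∞ (fun x => u x i) U) {y : Fin k → ℝ} (hy : y ⬝ᵥ y = 1) :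
    smoothSpin n M k U (fun x => a x * spinPair (u x) y (hu1 x) hy) := by
  intro ℓ
  have h : ∀ x, ℓ (((a x * spinPair (u x) y (hu1 x) hy : Spin k) : (Cl k)ˣ) : Cl k) =
      ∑ i, u x i * (ℓ ∘ₗ LinearMap.mulRight ℝ (basisVec i * vec y)) ((a x : (Cl k)ˣ) : Cl k) := by
    intro x
    have h1 : (((a x * spinPair (u x) y (hu1 x) hy : Spin k) : (Cl k)ˣ) : Cl k) =
      ((a x : (Cl k)ˣ) : Cl k) * (vec (u x) * vec y) := rfl
    have h2 : vec (u x) = ∑ i, u x i • (basisVec i : Cl k) := by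
      have : u x = ∑ i, u x i • e i := by
        ext j; simp [Finset.sum_apply, Pi.single_apply]
      conv_lhs => rw [this]
      simp [basisVec]
    rw [h1, h2, Finset.sum_mul, Finset.mul_sum, map_sum]
    refine Finset.sum_congr rfl fun i _ => ?_
    rw [smul_mul_assoc, mul_smul_comm, map_smul]; rfl
  simp only [h]
  exact contMDiffOn_finsetSum fun i _ => (hu i).mul (ha _)

/-- A smooth map to `SO(k)` lifts locally to a smooth map to `Spin(k)`. -/
theorem exists_smooth_lift {U : Set M} {A : M → SO k} (hA : smoothSO n M k U A) {x₀ : M}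
    (hx₀ : x₀ ∈ U) (a₀ : Spin k) (h0 : spinCover k a₀ = A x₀) :
    ∃ W : Set M, IsOpen W ∧ x₀ ∈ W ∧ ∃ a : M → Spin k, smoothSpin n M k (U ∩ W) a ∧
      ∀ x ∈ U ∩ W, spinCover k (a x) = A x := by
  -- Invariant: A = λ(a) C, where C fixes the first j basis vectors and C(x₀) = 1. For j = k nothing
  -- remains of C.
  have key : ∀ j ≤ k, ∃ W : Set M, IsOpen W ∧ x₀ ∈ W ∧ ∃ (a : M → Spin k) (C : M → SO k),
      smoothSpin n M k (U ∩ W) a ∧ smoothSO n M k (U ∩ W) C ∧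
      (∀ x ∈ U ∩ W, spinCover k (a x) * C x = A x) ∧
      (∀ x ∈ U ∩ W, ∀ i : Fin k, i.val < j → (C x).1 *ᵥ e i = e i) ∧ C x₀ = 1 := by
    intro j
    induction j with
    | zero =>
      intro _
      -- Starting from a remainder that is 1 at x₀ ensures that each C(x) e_J is close to e_J near
      -- x₀, so that e_J + C(x) e_J does not vanish there.
      refine ⟨Set.univ, isOpen_univ, trivial, fun _ => a₀, fun x => (A x₀)⁻¹ * A x,
        fun ℓ => contMDiffOn_const, ?_, ?_, by simp, by simp⟩
      · exact ((smoothSO.const _ _).mul hA).mono Set.inter_subset_left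
      · intro x _
        rw [h0, mul_inv_cancel_left]
    | succ j ih =>
      intro hj
      obtain ⟨W, hW, hxW, a, C, ha, hC, hAC, hfix, hC0⟩ := ih (by omega)
      let J : Fin k := ⟨j, hj⟩
      let y : M → Fin k → ℝ := fun x => (C x).1 *ᵥ e J
      let s : M → Fin k → ℝ := fun x => e J + y x
      have hyi : ∀ x i, y x i = (C x).1 i J := fun x i => by simp [y]
      have hs : ∀ i, ContMDiffOn (𝓡 n) 𝓘(ℝ, ℝ) ∞ (fun x => s x i) (U ∩ W) := fun i => by
        simp only [s, Pi.add_apply, hyi]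
        exact contMDiffOn_const.add (hC i J)
      have hN : ContMDiffOn (𝓡 n) 𝓘(ℝ, ℝ) ∞ (fun x => s x ⬝ᵥ s x) (U ∩ W) :=
        contMDiffOn_finsetSum fun i _ => (hs i).mul (hs i)
      have hy0 : y x₀ = e J := by simp only [y, hC0]; exact Matrix.one_mulVec _
      have hs0 : 0 < s x₀ ⬝ᵥ s x₀ := by
        simp only [s, hy0, add_dotProduct, dotProduct_add, e_dot_self]; norm_num
      obtain ⟨W', hW', hxW', hsub⟩ := mem_nhdsWithin.mp
        ((hN.continuousOn x₀ ⟨hx₀, hxW⟩) (Ioi_mem_nhds hs0))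
      have hpos : ∀ x ∈ U ∩ (W ∩ W'), 0 < s x ⬝ᵥ s x := fun x hx => hsub ⟨hx.2.2, hx.1, hx.2.1⟩
      have hsne : ∀ x ∈ U ∩ (W ∩ W'), s x ≠ 0 := fun x hx h => by
        have := hpos x hx
        rw [h] at this; simp at this
      let u : M → Fin k → ℝ := fun x => unitDir J (s x)
      have hu1 : ∀ x, u x ⬝ᵥ u x = 1 := fun x => unitDir_dot_self J _
      have hmono : U ∩ (W ∩ W') ⊆ U ∩ W := Set.inter_subset_inter_right _ Set.inter_subset_left
      have hu : ∀ i, ContMDiffOn (𝓡 n) 𝓘(ℝ, ℝ) ∞ (fun x => u x i) (U ∩ (W ∩ W')) := fun i => by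
        refine ((contMDiffOn_inv_sqrt (hN.mono hmono) hpos).mul ((hs i).mono hmono)).congr ?_
        intro x hx
        simp only [u, unitDir, if_neg (hsne x hx)]
        rfl
      -- λ(q) sends e_J first to -e_J and then to y = C e_J. It fixes the earlier basis vectors,
      -- which are orthogonal to both directions.
      let q : M → Spin k := fun x => spinPair (u x) (e J) (hu1 x) (e_dot_self J)
      have hq : smoothSO n M k (U ∩ (W ∩ W')) (fun x => spinCover k (q x)) := by
        intro i l
        simp only [q, spinCover_spinPair, Matrix.mul_apply]
        refine contMDiffOn_finsetSum fun p _ => ContMDiffOn.mul ?_ contMDiffOn_const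
        simp only [reflMat, Matrix.sub_apply, Matrix.smul_apply, Matrix.vecMulVec_apply,
          smul_eq_mul]
        exact contMDiffOn_const.sub (contMDiffOn_const.mul ((hu i).mul (hu p)))
      refine ⟨W ∩ W', hW.inter hW', ⟨hxW, hxW'⟩, fun x => a x * q x,
        fun x => (spinCover k (q x))⁻¹ * C x, (ha.mono hmono).mul_spinPair hu1 hu _,
        hq.inv.mul (hC.mono hmono), ?_, ?_, ?_⟩
      · intro x hx
        rw [map_mul, mul_assoc, mul_inv_cancel_left, hAC x (hmono hx)]
      · intro x hx i hi
        change (((spinCover k (q x))⁻¹).1 * (C x).1) *ᵥ e i = e i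
        rw [spinCover_spinPair_inv, ← Matrix.mulVec_mulVec, ← Matrix.mulVec_mulVec]
        rcases Nat.lt_succ_iff_lt_or_eq.mp hi with hi | hi
        · rw [hfix x (hmono hx) i hi]
          have hne : J ≠ i := fun h => by rw [← h] at hi; exact lt_irrefl _ hi
          have h1 : s x ⬝ᵥ e i = 0 := by
            have h2 : y x ⬝ᵥ e i = 0 := by
              conv_lhs => rw [← hfix x (hmono hx) i hi]
              rw [SO_mulVec_dot, e_dot_ne hne]
            rw [add_dotProduct, h2, e_dot_ne hne, add_zero]
          rw [reflMat_mulVec_of_orth (unitDir_dot_of_orth (hsne x hx) h1),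
            reflMat_mulVec_of_orth (e_dot_ne hne)]
        · have : i = J := Fin.ext hi
          rw [this]
          have h1 : y x ⬝ᵥ y x = 1 := by rw [SO_mulVec_dot, e_dot_self]
          rw [show (C x).1 *ᵥ e J = y x from rfl,
            reflMat_unitDir_add J (e_dot_self J) h1 (hsne x hx), Matrix.mulVec_neg, reflMat_mulVec,
            e_dot_self]
          module
      -- At x₀ both reflections coincide, so the new remainder is again 1 there.
      · have hu0 : u x₀ = e J := by
          simp only [u, s, hy0]
          exact unitDir_of_unit (e_dot_self J)
        change (spinCover k (q x₀))⁻¹ * C x₀ = 1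
        rw [hC0, mul_one]
        refine Subtype.ext ?_
        rw [spinCover_spinPair_inv, hu0, reflMat_mul_self (e_dot_self J)]
        rfl
  obtain ⟨W, hW, hxW, a, C, ha, -, hAC, hfix, -⟩ := key k le_rfl
  refine ⟨W, hW, hxW, a, ha, fun x hx => ?_⟩
  have hC1 : C x = 1 := by
    refine Subtype.ext (Matrix.ext_of_mulVec_single fun i => ?_)
    rw [hfix x hx i i.2]
    exact (Matrix.one_mulVec _).symm
  rw [← hAC x hx, hC1, mul_one]

end Lifts

/-! ### Model spinors and their stabilizers -/

section Model

variable {m r : ℕ}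

/-- The inclusion of `ℝʳ` in `ℝ²ᵐ⁺ʳ` as the span of the last `r` basis vectors. -/
def inU (m : ℕ) {r : ℕ} (y : Fin r → ℝ) : Fin (2 * m + r) → ℝ := Fin.append 0 y

/-- The index `2a`. -/
def fst (r : ℕ) (a : Fin m) : Fin (2 * m + r) := ⟨2 * a.val, by omega⟩

/-- The index `2a + 1`. -/
def snd (r : ℕ) (a : Fin m) : Fin (2 * m + r) := ⟨2 * a.val + 1, by omega⟩

theorem fst_ne_snd (r : ℕ) (a : Fin m) : fst r a ≠ snd r a := by
  intro h
  have := congrArg Fin.val h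
  simp [fst, snd] at this

theorem index_cases (i : Fin (2 * m + r)) :
    (∃ a, i = fst r a) ∨ (∃ a, i = snd r a) ∨ ∃ k, i = Fin.natAdd (2 * m) k := by
  by_cases h : i.val < 2 * m
  · by_cases h2 : i.val % 2 = 0
    · exact Or.inl ⟨⟨i.val / 2, by omega⟩, Fin.ext (by simp only [fst]; omega)⟩
    · exact Or.inr (Or.inl ⟨⟨i.val / 2, by omega⟩, Fin.ext (by simp only [snd]; omega)⟩)
  · exact Or.inr (Or.inr ⟨⟨i.val - 2 * m, by omega⟩, Fin.ext (by simp only [Fin.val_natAdd]; omega)⟩)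

theorem inU_natAdd (y : Fin r → ℝ) (k : Fin r) : inU m y (Fin.natAdd (2 * m) k) = y k :=
  Fin.append_right _ _ _

theorem inU_of_lt (y : Fin r → ℝ) {i : Fin (2 * m + r)} (h : i.val < 2 * m) : inU m y i = 0 := by
  have : i = Fin.castAdd r ⟨i.val, h⟩ := rfl
  rw [this, inU, Fin.append_left]; rfl

theorem inU_dot (x y : Fin r → ℝ) : inU m x ⬝ᵥ inU m y = x ⬝ᵥ y := by
  simp only [dotProduct, Fin.sum_univ_add, inU_natAdd]
  rw [Finset.sum_eq_zero, zero_add]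
  intro i _
  rw [inU_of_lt x (by simp), zero_mul]

theorem inU_add (x y : Fin r → ℝ) : inU m (x + y) = inU m x + inU m y := by
  ext i
  refine Fin.addCases (fun j => ?_) (fun j => ?_) i
  · simp [inU_of_lt]
  · simp [inU_natAdd]

theorem inU_smul (c : ℝ) (x : Fin r → ℝ) : inU m (c • x) = c • inU m x := by
  ext i
  refine Fin.addCases (fun j => ?_) (fun j => ?_) i
  · simp [inU_of_lt]
  · simp [inU_natAdd]

theorem inU_e (k : Fin r) : inU m (e k) = e (Fin.natAdd (2 * m) k) := by
  ext i
  refine Fin.addCases (fun j => ?_) (fun j => ?_) i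
  · rw [inU_of_lt _ (by simp)]
    have hne : Fin.castAdd r j ≠ Fin.natAdd (2 * m) k := fun h => by
      have := congrArg Fin.val h
      simp only [Fin.val_castAdd, Fin.val_natAdd] at this
      omega
    simp [hne]
  · simp [inU_natAdd, Pi.single_apply]

theorem inU_injective : Function.Injective (inU m : (Fin r → ℝ) → _) := by
  intro x y h
  ext k
  rw [← inU_natAdd (m := m) x, h, inU_natAdd]

theorem exists_inU {v : Fin (2 * m + r) → ℝ} (h : ∀ i, i.val < 2 * m → v i = 0) :
    ∃ y, v = inU m y := by
  refine ⟨fun k => v (Fin.natAdd (2 * m) k), ?_⟩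
  ext i
  refine Fin.addCases (fun j => ?_) (fun j => ?_) i
  · rw [h _ (by simp), inU_of_lt _ (by simp)]
  · rw [inU_natAdd]

theorem inU_sub (x y : Fin r → ℝ) : inU m (x - y) = inU m x - inU m y := by
  rw [sub_eq_add_neg, sub_eq_add_neg, ← neg_one_smul ℝ y, inU_add, inU_smul, neg_one_smul]

theorem reflMat_inU (x v : Fin r → ℝ) :
    reflMat (inU m x) *ᵥ inU m v = inU m (reflMat x *ᵥ v) := by
  rw [reflMat_mulVec, reflMat_mulVec, inU_dot, inU_sub, inU_smul]

theorem exists_submodule_first (m r : ℕ) : ∃ V : Submodule ℝ (Fin (2 * m + r) → ℝ),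
    Module.finrank ℝ V + r = 2 * m + r ∧ ∀ v, v ∈ V ↔ ∀ k, v (Fin.natAdd (2 * m) k) = 0 := by
  refine ⟨LinearMap.ker
    (LinearMap.funLeft ℝ ℝ (Fin.natAdd (2 * m) : Fin r → Fin (2 * m + r))), ?_, fun v => ?_⟩
  · have h1 := LinearMap.finrank_range_add_finrank_ker
      (LinearMap.funLeft ℝ ℝ (Fin.natAdd (2 * m) : Fin r → Fin (2 * m + r)))
    rw [LinearMap.range_eq_top.mpr (LinearMap.funLeft_surjective_of_injective ℝ ℝ _
      (Fin.natAdd_injective r (2 * m))), finrank_top, Module.finrank_fin_fun,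
      Module.finrank_fin_fun] at h1
    omega
  · rw [LinearMap.mem_ker, funext_iff]; rfl

/-- Partially pure spinors whose complex structure is a standard one on the span of the first `2m`
basis vectors, and for which the two actions of `Spin(r)` are inverse to each other. -/
structure ModelSpinor (ε : Fin m → ℝ) (φ : TwistedSpinor r (2 * m + r)) : Prop where
  sign : ∀ a, ε a * ε a = 1
  pure : IsPartiallyPure φ
  E_fst : ∀ a, E (e (fst r a)) φ = Complex.I • ε a • E (e (snd r a)) φ
  F_F : ∀ x y, F x (F y φ) = E (inU m y) (E (inU m x) φ)

/-- Equivariance of `cxMat`, read for an element that fixes φ. -/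
theorem cxMat_commute_of_spinAct {n : ℕ} {φ : TwistedSpinor r n}
    {u : Spin n × Spin r × Circle} (hu : spinAct u φ = φ) :
    (spinCover _ u.1).1 * cxMat φ = cxMat φ * (spinCover _ u.1).1 := by
  have h1 := cxMat_spinAct u φ
  rw [hu] at h1
  nth_rewrite 2 [h1]
  rw [mul_assoc, SO_transpose_mul, mul_one]

namespace ModelSpinor

variable {ε : Fin m → ℝ} {φ : TwistedSpinor r (2 * m + r)} (h : ModelSpinor ε φ)

include h

theorem E_snd (a : Fin m) : E (e (snd r a)) φ = Complex.I • E (-(ε a • e (fst r a))) φ := by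
  rw [E_neg, E_smul, h.E_fst, smul_neg, smul_comm (ε a) Complex.I, smul_smul (ε a), h.sign,
    one_smul, smul_smul, Complex.I_mul_I, neg_one_smul, neg_neg]

theorem cxMat_fst (a : Fin m) : cxMat φ *ᵥ e (fst r a) = ε a • e (snd r a) :=
  cxMat_mulVec h.pure.unit (by rw [h.E_fst, E_smul])

theorem cxMat_snd (a : Fin m) : cxMat φ *ᵥ e (snd r a) = -(ε a • e (fst r a)) :=
  cxMat_mulVec h.pure.unit (h.E_snd a)

theorem E_cxMat {w : Fin (2 * m + r) → ℝ} (hw : ∀ k, w (Fin.natAdd (2 * m) k) = 0) :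
    E w φ = Complex.I • E (cxMat φ *ᵥ w) φ := by
  have key : ∀ i, w i • E (e i) φ = Complex.I • E (w i • cxMat φ *ᵥ e i) φ := by
    intro i
    rw [E_smul, smul_comm Complex.I]
    rcases index_cases i with ⟨a, rfl⟩ | ⟨a, rfl⟩ | ⟨k, rfl⟩
    · rw [h.cxMat_fst, h.E_fst, E_smul]
    · rw [h.cxMat_snd, h.E_snd]
    · rw [hw, zero_smul, zero_smul]
  have hsum : cxMat φ *ᵥ w = ∑ i, w i • cxMat φ *ᵥ e i := by
    have : w = ∑ i, w i • e i := by
      ext j; simp [Finset.sum_apply, Pi.single_apply]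
    conv_lhs => rw [this]
    rw [Matrix.mulVec_sum]
    simp only [Matrix.mulVec_smul]
  rw [E_eq_sum, hsum, Finset.sum_congr rfl fun i _ => key i, ← Finset.smul_sum]
  congr 1
  simp [E, map_sum, LinearMap.sum_apply]

/-- The general vanishing on V^⊥, for V the span of the first 2m basis vectors; what remains is that
e_{2m+k} has no component in V. -/
theorem cxMat_natAdd (k : Fin r) : cxMat φ *ᵥ e (Fin.natAdd (2 * m) k) = 0 := by
  obtain ⟨V, hrank, hV⟩ := exists_submodule_first m r
  obtain ⟨U, hVU, horth⟩ := exists_orth_isCompl V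
  have hVJ : ∀ X ∈ V, cxMat φ *ᵥ X ∈ V := by
    intro X hX
    have hsum : cxMat φ *ᵥ X = ∑ i, X i • cxMat φ *ᵥ e i := by
      have : X = ∑ i, X i • e i := by
        ext j; simp [Finset.sum_apply, Pi.single_apply]
      conv_lhs => rw [this]
      rw [Matrix.mulVec_sum]
      simp only [Matrix.mulVec_smul]
    rw [hsum]
    refine Submodule.sum_mem _ fun i _ => ?_
    have hV1 : ∀ i : Fin (2 * m + r), i.val < 2 * m → e i ∈ V := fun i hi =>
      (hV _).mpr fun k => Pi.single_eq_of_ne (fun h => by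
        have := congrArg Fin.val h
        simp at this
        omega) _
    rcases index_cases i with ⟨a, rfl⟩ | ⟨a, rfl⟩ | ⟨k, rfl⟩
    · rw [h.cxMat_fst]
      exact V.smul_mem _ (V.smul_mem _ (hV1 _ (by simp only [snd]; omega)))
    · rw [h.cxMat_snd]
      exact V.smul_mem _ (V.neg_mem (V.smul_mem _ (hV1 _ (by simp only [fst]; omega))))
    · rw [(hV X).mp hX, zero_smul]; exact V.zero_mem
  refine h.pure.cxMat_mulVec_eq_zero hrank (fun X hX => ⟨_, hVJ X hX, h.E_cxMat ((hV X).mp hX)⟩)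
    hVU horth ?_
  obtain ⟨v, hv, y, hy, hvy⟩ := Submodule.mem_sup.mp
    (hVU.sup_eq_top ▸ Submodule.mem_top : e (Fin.natAdd (2 * m) k) ∈ V ⊔ U)
  have hv0 : v ⬝ᵥ v = 0 := by
    have h1 : v ⬝ᵥ e (Fin.natAdd (2 * m) k) = 0 := by simp [(hV v).mp hv]
    rw [← hvy, dotProduct_add, horth v hv y hy, add_zero] at h1
    exact h1
  rw [dotProduct_self_eq_zero.mp hv0, zero_add] at hvy
  rwa [← hvy]

theorem cxMat_cxMat (w : Fin (2 * m + r) → ℝ) (hw : ∀ k, w (Fin.natAdd (2 * m) k) = 0) :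
    cxMat φ *ᵥ cxMat φ *ᵥ w = -w := by
  have h1 : E (cxMat φ *ᵥ w) φ = Complex.I • E (-w) φ := by
    rw [E_neg, h.E_cxMat hw, smul_neg, smul_smul, Complex.I_mul_I, neg_one_smul, neg_neg]
  exact cxMat_mulVec h.pure.unit h1

theorem cxMat_apply_natAdd (w : Fin (2 * m + r) → ℝ) (k : Fin r) :
    (cxMat φ *ᵥ w) (Fin.natAdd (2 * m) k) = 0 := by
  have h1 := dot_mulVec_of_skew (cxMat_transpose h.pure.unit) (e (Fin.natAdd (2 * m) k)) w
  rw [h.cxMat_natAdd, dotProduct_zero, neg_zero] at h1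
  simpa using h1

/-- The spin groups act isometrically, so |c| = 1, and the conjugate of c is the compensating
element of U(1). -/
theorem exists_phase {a : Spin (2 * m + r)} {b : Spin r} {c : ℂ}
    (hc : twHom r _ ((b : (Cl r)ˣ) : Cl r) (clHom r _ ((a : (Cl (2 * m + r))ˣ) : Cl _) φ) = c • φ) :
    ∃ z : Circle, spinAct (a, b, z) φ = φ := by
  have h1 : c * (starRingEnd ℂ) c = 1 := by
    have h2 := Spin.herm_twHom b (clHom r _ ((a : (Cl (2 * m + r))ˣ) : Cl _) φ)
      (clHom r _ ((a : (Cl (2 * m + r))ˣ) : Cl _) φ)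
    rw [Spin.herm_clHom, hc, herm_smul_left, herm_smul_right, h.pure.unit, mul_one] at h2
    exact h2
  have hnorm : ‖c‖ = 1 := by
    rw [Complex.mul_conj, Complex.normSq_eq_norm_sq] at h1
    have h3 : ‖c‖ ^ 2 = 1 := by exact_mod_cast h1
    nlinarith [norm_nonneg c]
  refine ⟨⟨(starRingEnd ℂ) c, by simp [Submonoid.unitSphere, hnorm]⟩, ?_⟩
  rw [spinAct_apply, hc, smul_smul]
  change ((starRingEnd ℂ) c * c) • φ = φ
  rw [mul_comm ((starRingEnd ℂ) c) c, h1, one_smul]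

/-- An orthogonal matrix that commutes with the partial complex structure agrees on its range with
an element of the stabilizer. -/
theorem exists_stabilizer_fix {A : Matrix (Fin (2 * m + r)) (Fin (2 * m + r)) ℝ} (hA : Aᵀ * A = 1)
    (hAJ : A * cxMat φ = cxMat φ * A) :
    ∃ (a : Spin (2 * m + r)) (z : Circle), spinAct (a, 1, z) φ = φ ∧
      (∀ x, (spinCover _ a).1 *ᵥ inU m x = inU m x) ∧
      ∀ i, i.val < 2 * m → ((spinCover _ a)⁻¹.1 * A) *ᵥ e i = e i := by
  set J := cxMat φ with hJ
  have hJskew := dot_mulVec_of_skew (cxMat_transpose h.pure.unit)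
  rw [← hJ] at hJskew
  -- Complex lines are treated one at a time: after j of them λ(a)⁻¹ A fixes the first 2j basis
  -- vectors.
  have key : ∀ j ≤ m, ∃ (a : Spin (2 * m + r)) (z : Circle), spinAct (a, 1, z) φ = φ ∧
      (∀ x, (spinCover _ a).1 *ᵥ inU m x = inU m x) ∧
      ∀ i, i.val < 2 * j → ((spinCover _ a)⁻¹.1 * A) *ᵥ e i = e i := by
    intro j
    induction j with
    | zero => exact fun _ => ⟨1, 1, spinAct_one φ, fun x => by simp, fun i hi => by omega⟩
    | succ j ih =>
      intro hj
      obtain ⟨a, z, ha, hU, hfix⟩ := ih (by omega)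
      set C := (spinCover _ a)⁻¹.1 * A with hC
      have hCC : Cᵀ * C = 1 := by
        rw [hC, Matrix.transpose_mul, SO_inv_val, Matrix.transpose_transpose, mul_assoc,
          ← mul_assoc _ _ A, SO_mul_transpose, one_mul, hA]
      have hdot : ∀ x y, (C *ᵥ x) ⬝ᵥ (C *ᵥ y) = x ⬝ᵥ y := fun x y => by
        rw [Matrix.dotProduct_mulVec, ← Matrix.mulVec_transpose, Matrix.mulVec_mulVec, hCC,
          Matrix.one_mulVec]
      have hinvJ : ∀ B : SO (2 * m + r), B.1 * J = J * B.1 → B⁻¹.1 * J = J * B⁻¹.1 := by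
        intro B hB
        have h1 : B⁻¹.1 * B.1 = 1 := congrArg Subtype.val (inv_mul_cancel B)
        have h2 : B.1 * B⁻¹.1 = 1 := congrArg Subtype.val (mul_inv_cancel B)
        calc B⁻¹.1 * J = B⁻¹.1 * (J * B.1) * B⁻¹.1 := by rw [mul_assoc, mul_assoc, h2, mul_one]
          _ = J * B⁻¹.1 := by rw [← hB, ← mul_assoc, h1, one_mul]
      have hCJ : C * J = J * C := by
        rw [hC, mul_assoc, hAJ, ← mul_assoc, hinvJ _ (cxMat_commute_of_spinAct ha), mul_assoc]
      let k : Fin m := ⟨j, by omega⟩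
      set x : Fin (2 * m + r) → ℝ := e (fst r k) with hx
      -- A matrix that commutes with J and fixes e_{2k} also fixes e_{2k+1} = ε_k J e_{2k}, so only
      -- even indices need work.
      have hcomplete : ∀ D : Matrix (Fin (2 * m + r)) (Fin (2 * m + r)) ℝ, D * J = J * D →
          D *ᵥ x = x → D *ᵥ e (snd r k) = e (snd r k) := by
        intro D hD hDx
        have h1 : e (snd r k) = ε k • J *ᵥ x := by
          rw [hJ, hx, h.cxMat_fst, smul_smul, h.sign, one_smul]
        rw [h1, Matrix.mulVec_smul, Matrix.mulVec_mulVec, hD, ← Matrix.mulVec_mulVec, hDx]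
      have hsplit : ∀ i : Fin (2 * m + r), i.val < 2 * (j + 1) →
          i.val < 2 * j ∨ i = fst r k ∨ i = snd r k := by
        intro i hi
        by_cases h1 : i.val < 2 * j
        · exact Or.inl h1
        · by_cases h2 : i.val = 2 * j
          · exact Or.inr (Or.inl (Fin.ext h2))
          · exact Or.inr (Or.inr (Fin.ext (by simp only [snd, k]; omega)))
      by_cases hxy : C *ᵥ x = x
      · refine ⟨a, z, ha, hU, fun i hi => ?_⟩
        rcases hsplit i hi with h1 | rfl | rfl
        · exact hfix i h1
        · exact hxy
        · exact hcomplete C hCJ hxy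
      · set y := C *ᵥ x with hy
        have hw0 : x - y ≠ 0 := fun h0 => hxy (sub_eq_zero.mp h0).symm
        set w₀ := x - y with hw₀
        have hxV : ∀ l, x (Fin.natAdd (2 * m) l) = 0 := fun l => Pi.single_eq_of_ne (fun h => by
          have := congrArg Fin.val h
          simp [fst] at this
          omega) _
        have hyV : ∀ l, y (Fin.natAdd (2 * m) l) = 0 := by
          intro l
          have h1 : y = J *ᵥ (-(J *ᵥ y)) := by
            have hJC : ∀ v, J *ᵥ (C *ᵥ v) = C *ᵥ (J *ᵥ v) := fun v => by
              rw [Matrix.mulVec_mulVec, ← hCJ, ← Matrix.mulVec_mulVec]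
            rw [hy, Matrix.mulVec_neg, hJC, hJC, h.cxMat_cxMat x hxV, Matrix.mulVec_neg, neg_neg]
          rw [h1]
          exact h.cxMat_apply_natAdd _ l
        have hwV : ∀ l, w₀ (Fin.natAdd (2 * m) l) = 0 := fun l => by
          rw [hw₀, Pi.sub_apply, hxV, hyV, sub_zero]
        have hxx : x ⬝ᵥ x = 1 := e_dot_self _
        have hyy : y ⬝ᵥ y = 1 := by rw [hy, hdot, hxx]
        -- As x and y have the same length, |w₀|² = 2⟨x, w₀⟩. This makes the next vector nonzero.
        have hxw : 0 < x ⬝ᵥ w₀ := by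
          have h1 := dot_self_pos hw0
          have h2 : w₀ ⬝ᵥ w₀ = 2 * (x ⬝ᵥ w₀) := by
            rw [hw₀, sub_dotProduct, dotProduct_sub, dotProduct_sub, hxx, hyy, dotProduct_comm y x]
            ring
          linarith
        -- The reflection along w₀ = x - y exchanges x and y; a second one is needed to stay in the
        -- spin group. Its vector lies in the complex line of w₀, so that the pair multiplies φ by a
        -- scalar, and is orthogonal to x, so that x is not moved again.
        set w₁ := (x ⬝ᵥ w₀) • J *ᵥ w₀ - (x ⬝ᵥ J *ᵥ w₀) • w₀ with hw₁
        have hww : (J *ᵥ w₀) ⬝ᵥ w₀ = 0 := by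
          have := hJskew w₀ w₀
          rw [dotProduct_comm]; linarith
        have hJw : (J *ᵥ w₀) ⬝ᵥ (J *ᵥ w₀) = w₀ ⬝ᵥ w₀ := by
          rw [hJskew, h.cxMat_cxMat w₀ hwV, dotProduct_neg, neg_neg]
        have hw1 : w₁ ≠ 0 := by
          intro h0
          have h1 : (J *ᵥ w₀) ⬝ᵥ w₁ = (x ⬝ᵥ w₀) * (w₀ ⬝ᵥ w₀) := by
            rw [hw₁, dotProduct_sub, dotProduct_smul, dotProduct_smul, hww, hJw]
            simp
          rw [h0, dotProduct_zero] at h1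
          exact (mul_pos hxw (dot_self_pos hw0)).ne h1
        have hw1x : w₁ ⬝ᵥ x = 0 := by
          rw [hw₁, sub_dotProduct, smul_dotProduct, smul_dotProduct, dotProduct_comm _ x,
            dotProduct_comm _ x, smul_eq_mul, smul_eq_mul]
          ring
        have hw1V : ∀ l, w₁ (Fin.natAdd (2 * m) l) = 0 := fun l => by
          rw [hw₁, Pi.sub_apply, Pi.smul_apply, Pi.smul_apply, hwV, h.cxMat_apply_natAdd]; simp
        let w := unitDir (fst r k) w₀
        let w' := unitDir (fst r k) w₁
        let q := spinPair w w' (unitDir_dot_self _ _) (unitDir_dot_self _ _)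
        obtain ⟨c, hc⟩ : ∃ c : ℂ, clHom r _ ((q : (Cl (2 * m + r))ˣ) : Cl _) φ = c • φ := by
          -- J w₀ acts on φ as -i w₀, so w₁ φ is a complex multiple of w₀ φ.
          have h1 : E w₁ φ = (-(Complex.I * (x ⬝ᵥ w₀ : ℝ)) - (x ⬝ᵥ J *ᵥ w₀ : ℝ)) • E w₀ φ := by
            rw [hw₁, E_sub, E_smul, E_smul]
            have h2 : E (J *ᵥ w₀) φ = -(Complex.I • E w₀ φ) := by
              rw [h.E_cxMat hwV, smul_smul, Complex.I_mul_I, neg_one_smul, neg_neg]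
            rw [h2, sub_smul, neg_smul, smul_neg, mul_comm Complex.I, ← smul_smul, Complex.coe_smul,
              Complex.coe_smul]
          have h3 : E w φ = (√(w₀ ⬝ᵥ w₀))⁻¹ • E w₀ φ := by
            simp only [w, unitDir, if_neg hw0, E_smul]
          have h4 : E w₀ φ = √(w₀ ⬝ᵥ w₀) • E w φ := by
            rw [h3, smul_smul, mul_inv_cancel₀ (Real.sqrt_ne_zero'.mpr (dot_self_pos hw0)), one_smul]
          have h5 : E w' φ = (((√(w₁ ⬝ᵥ w₁))⁻¹ : ℝ) : ℂ) • E w₁ φ := by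
            simp only [w', unitDir, if_neg hw1, E_smul, Complex.coe_smul]
          have h6 : ∃ c : ℂ, E w' φ = c • E w φ := by
            refine ⟨(((√(w₁ ⬝ᵥ w₁))⁻¹ : ℝ) : ℂ) * ((-(Complex.I * (x ⬝ᵥ w₀ : ℝ)) -
              (x ⬝ᵥ J *ᵥ w₀ : ℝ)) * ((√(w₀ ⬝ᵥ w₀) : ℝ) : ℂ)), ?_⟩
            rw [h5, h1, h4, ← Complex.coe_smul (√(w₀ ⬝ᵥ w₀)) (E w φ), smul_smul, smul_smul, mul_assoc]
          obtain ⟨c, hc⟩ := h6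
          refine ⟨-c, ?_⟩
          change clHom r _ (vec w * vec w') φ = _
          rw [clHom_mul_apply]
          change E w (E w' φ) = _
          rw [hc, map_smul, E_E_unit (unitDir_dot_self _ _), smul_neg, neg_smul]
        obtain ⟨z', hz'⟩ := h.exists_phase (a := q) (b := 1) (c := c) (by
          rw [hc]; simp)
        have hqU : ∀ v, w₀ ⬝ᵥ v = 0 → (J *ᵥ w₀) ⬝ᵥ v = 0 → (spinCover _ q).1 *ᵥ v = v ∧
            (spinCover _ q)⁻¹.1 *ᵥ v = v := by
          intro v h1 h2
          have h3 : w ⬝ᵥ v = 0 := unitDir_dot_of_orth hw0 h1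
          have h4 : w' ⬝ᵥ v = 0 := unitDir_dot_of_orth hw1 (by
            rw [hw₁, sub_dotProduct, smul_dotProduct, smul_dotProduct, h1, h2]; simp)
          rw [spinCover_spinPair_inv, spinCover_spinPair, ← Matrix.mulVec_mulVec,
            ← Matrix.mulVec_mulVec, reflMat_mulVec_of_orth h4, reflMat_mulVec_of_orth h3,
            reflMat_mulVec_of_orth h4]
          exact ⟨rfl, rfl⟩
        have hinU : ∀ v : Fin (2 * m + r) → ℝ, (∀ l, v (Fin.natAdd (2 * m) l) = 0) →
            ∀ x : Fin r → ℝ, v ⬝ᵥ inU m x = 0 := by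
          intro v hv x
          simp only [dotProduct, Fin.sum_univ_add]
          rw [Finset.sum_eq_zero, Finset.sum_eq_zero, add_zero]
          · intro i _; rw [hv, zero_mul]
          · intro i _; rw [inU_of_lt _ (by simp), mul_zero]
        have hact : spinAct (a * q, 1, z * z') φ = φ := by
          have : ((a * q, 1, z * z') : Spin (2 * m + r) × Spin r × Circle) =
            (a, 1, z) * (q, 1, z') := by simp
          rw [this, spinAct_mul, hz', ha]
        have hqC : (spinCover _ (a * q))⁻¹.1 * A = (spinCover _ q)⁻¹.1 * C := by
          rw [map_mul, mul_inv_rev, hC, ← mul_assoc]; rfl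
        have hqx : (spinCover _ q)⁻¹.1 *ᵥ y = x := by
          have h1 : reflMat w *ᵥ x = y := reflMat_unitDir_sub _ (by rw [hxx, hyy]) hw0
          have h2 : reflMat w *ᵥ y = x := by
            rw [← h1, Matrix.mulVec_mulVec, reflMat_mul_self (unitDir_dot_self _ _),
              Matrix.one_mulVec]
          rw [spinCover_spinPair_inv, ← Matrix.mulVec_mulVec, h2,
            reflMat_mulVec_of_orth (unitDir_dot_of_orth hw1 hw1x)]
        refine ⟨a * q, z * z', hact, ?_, ?_⟩
        · intro v
          rw [map_mul]
          change ((spinCover _ a).1 * (spinCover _ q).1) *ᵥ inU m v = inU m v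
          rw [← Matrix.mulVec_mulVec, (hqU _ (hinU _ hwV v)
            (hinU _ (h.cxMat_apply_natAdd w₀) v)).1, hU]
        -- The vectors fixed before are orthogonal to x and to y. Their span is J-invariant, so they
        -- are orthogonal to J w₀ as well and remain fixed.
        · have hlow : ∀ i : Fin (2 * m + r), i.val < 2 * j → w₀ ⬝ᵥ e i = 0 := by
            intro i hi
            have hne : fst r k ≠ i := fun h => by rw [← h] at hi; simp [fst, k] at hi
            have h1 : y ⬝ᵥ e i = 0 := by
              conv_lhs => rw [← hfix i hi]
              rw [hy, hdot, hx, e_dot_ne hne]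
            rw [hw₀, sub_dotProduct, h1, hx, e_dot_ne hne, sub_zero]
          intro i hi
          rw [hqC]
          rcases hsplit i hi with h1 | rfl | rfl
          · rw [← Matrix.mulVec_mulVec, hfix i h1]
            refine (hqU _ (hlow i h1) ?_).2
            rw [dotProduct_comm, hJskew, neg_eq_zero]
            rcases index_cases i with ⟨b, rfl⟩ | ⟨b, rfl⟩ | ⟨l, rfl⟩
            · rw [hJ, h.cxMat_fst, dotProduct_smul, hlow _ (by simp only [fst, snd] at h1 ⊢; omega),
                smul_zero]
            · rw [hJ, h.cxMat_snd, dotProduct_neg, dotProduct_smul,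
                hlow _ (by simp only [fst, snd] at h1 ⊢; omega), smul_zero, neg_zero]
            · rw [hJ, h.cxMat_natAdd, dotProduct_zero]
          · rw [← Matrix.mulVec_mulVec]; exact hqx
          · refine hcomplete _ ?_ ?_
            · rw [mul_assoc, hCJ, ← mul_assoc, hinvJ _ (cxMat_commute_of_spinAct hz'), mul_assoc]
            · rw [← Matrix.mulVec_mulVec]; exact hqx
  exact key m le_rfl

end ModelSpinor

end Model

section ModelLift

variable {m r : ℕ}

theorem eq_one_of_mulVec_e {n : ℕ} {C : Matrix (Fin n) (Fin n) ℝ} (h : ∀ i, C *ᵥ e i = e i) :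
    C = 1 :=
  Matrix.ext_of_mulVec_single fun i => by rw [Matrix.one_mulVec]; exact h i

/-- An orthogonal matrix that fixes the first `2m` basis vectors is a product of reflections in
hyperplanes that contain these vectors. -/
theorem exists_prod_reflMat {C : Matrix (Fin (2 * m + r)) (Fin (2 * m + r)) ℝ} (hC : Cᵀ * C = 1)
    (hfix : ∀ i, i.val < 2 * m → C *ᵥ e i = e i) :
    ∃ L : List {x : Fin r → ℝ // x ⬝ᵥ x = 1}, C = (L.map fun x => reflMat (inU m x.1)).prod := by
  -- Here j counts the basis vectors that need not be fixed yet; each reflection takes care of the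
  -- first of them.
  have key : ∀ j ≤ r, ∀ C : Matrix (Fin (2 * m + r)) (Fin (2 * m + r)) ℝ, Cᵀ * C = 1 →
      (∀ i, i.val < 2 * m + (r - j) → C *ᵥ e i = e i) →
      ∃ L : List {x : Fin r → ℝ // x ⬝ᵥ x = 1},
        C = (L.map fun x => reflMat (inU m x.1)).prod := by
    intro j
    induction j with
    | zero =>
      intro _ C _ h
      exact ⟨[], eq_one_of_mulVec_e fun i => h i (by simp)⟩
    | succ j ih =>
      intro hj C hC h
      have hdot : ∀ x y, (C *ᵥ x) ⬝ᵥ (C *ᵥ y) = x ⬝ᵥ y := fun x y => by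
        rw [Matrix.dotProduct_mulVec, ← Matrix.mulVec_transpose, Matrix.mulVec_mulVec, hC,
          Matrix.one_mulVec]
      let k : Fin r := ⟨r - (j + 1), by omega⟩
      let p : Fin (2 * m + r) := Fin.natAdd (2 * m) k
      have hsplit : ∀ i : Fin (2 * m + r), i.val < 2 * m + (r - j) →
          i.val < 2 * m + (r - (j + 1)) ∨ i = p := by
        intro i hi
        by_cases h1 : i.val < 2 * m + (r - (j + 1))
        · exact Or.inl h1
        · exact Or.inr (Fin.ext (by simp only [p, k, Fin.val_natAdd]; omega))
      by_cases hp : C *ᵥ e p = e p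
      · refine ih (by omega) C hC fun i hi => ?_
        rcases hsplit i hi with h1 | rfl
        · exact h i h1
        · exact hp
      · set s := C *ᵥ e p - e p with hs
        have hs0 : s ≠ 0 := sub_ne_zero.mpr hp
        have hlow : ∀ i : Fin (2 * m + r), i.val < 2 * m + (r - (j + 1)) → s ⬝ᵥ e i = 0 := by
          intro i hi
          have hne : p ≠ i := fun h => by
            rw [← h] at hi; simp only [p, k, Fin.val_natAdd, lt_irrefl] at hi
          rw [hs, sub_dotProduct]
          nth_rewrite 1 [← h i hi]
          rw [hdot, sub_self]
        -- The difference vector is orthogonal to the fixed basis vectors, in particular to the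
        -- first 2m, so it comes from ℝʳ.
        obtain ⟨y, hy⟩ := exists_inU (v := s) fun i hi => by
          simpa using hlow i (by omega)
        have hy0 : y ≠ 0 := by
          rintro rfl
          exact hs0 (by rw [hy]; simpa using inU_smul (m := m) (r := r) 0 0)
        have hunit : inU m (unitDir k y) = unitDir p s := by
          simp only [unitDir, if_neg hy0, if_neg hs0, inU_smul, ← hy]
          rw [hy, inU_dot]
        set x := unitDir k y
        have hx : x ⬝ᵥ x = 1 := unitDir_dot_self _ _
        have hR : reflMat (inU m x) *ᵥ (C *ᵥ e p) = e p := by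
          rw [hunit]
          exact reflMat_unitDir_sub _ (hdot _ _) hs0
        have hRR := reflMat_mul_self (x := inU m x) (by rw [inU_dot, hx])
        have hRT : (reflMat (inU m x))ᵀ = reflMat (inU m x) := by
          ext i j
          simp [reflMat, Matrix.vecMulVec_apply, Matrix.one_apply, eq_comm, mul_comm]
        obtain ⟨L, hL⟩ := ih (by omega) (reflMat (inU m x) * C) (by
            rw [Matrix.transpose_mul, hRT, mul_assoc, ← mul_assoc _ _ C, hRR, one_mul, hC])
          (fun i hi => by
            rw [← Matrix.mulVec_mulVec]
            rcases hsplit i hi with h1 | rfl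
            · rw [h i h1, hunit]
              exact reflMat_mulVec_of_orth (unitDir_dot_of_orth hs0 (hlow i h1))
            · exact hR)
        refine ⟨⟨x, hx⟩ :: L, ?_⟩
        rw [List.map_cons, List.prod_cons, ← hL, ← mul_assoc, hRR, one_mul]
  exact key r le_rfl C hC fun i hi => hfix i (by simpa using hi)

namespace ModelSpinor

variable {ε : Fin m → ℝ} {φ : TwistedSpinor r (2 * m + r)} (h : ModelSpinor ε φ)

include h

/-- Two reflections in U lift to a product of two vectors in Spin(n), and the same two vectors
define an element of Spin(r). By `F_F` their actions on φ are inverse to each other, so no phase is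
needed. -/
theorem exists_lift_prod (k : ℕ) (L : List {x : Fin r → ℝ // x ⬝ᵥ x = 1})
    (hL : L.length = 2 * k) :
    ∃ (a : Spin (2 * m + r)) (b : Spin r), spinAct (a, b, 1) φ = φ ∧
      (spinCover _ a).1 = (L.map fun x => reflMat (inU m x.1)).prod ∧
      ∀ v, (spinCover _ a).1 *ᵥ inU m v = inU m ((spinCover _ b).1 *ᵥ v) := by
  induction k generalizing L with
  | zero =>
    obtain rfl : L = [] := List.length_eq_zero_iff.mp (by simpa using hL)
    exact ⟨1, 1, spinAct_one φ, by simp, fun v => by simp⟩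
  | succ k ih =>
    match L, hL with
    | x :: y :: L, hL =>
      obtain ⟨a, b, h1, h2, h3⟩ := ih L (by simp at hL; omega)
      let a' := spinPair (inU m x.1) (inU m y.1) (by rw [inU_dot, x.2]) (by rw [inU_dot, y.2])
      let b' := spinPair x.1 y.1 x.2 y.2
      refine ⟨a' * a, b' * b, ?_, ?_, ?_⟩
      · have : ((a' * a, b' * b, 1) : Spin (2 * m + r) × Spin r × Circle) =
            (a', b', 1) * (a, b, 1) := by simp
        rw [this, spinAct_mul, h1, spinAct_apply]
        change ((1 : Circle) : ℂ) • twHom r _ (vec x.1 * vec y.1)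
          (clHom r _ (vec (inU m x.1) * vec (inU m y.1)) φ) = φ
        rw [twHom_mul_apply, clHom_mul_apply]
        change ((1 : Circle) : ℂ) • F x.1 (F y.1 (E (inU m x.1) (E (inU m y.1) φ))) = φ
        rw [← E_F, ← E_F, ← E_F, ← E_F, h.F_F, E_E_unit (by rw [inU_dot, y.2]), map_neg,
          E_E_unit (by rw [inU_dot, x.2])]
        simp
      · rw [map_mul, List.map_cons, List.map_cons, List.prod_cons, List.prod_cons, ← h2,
          ← mul_assoc, ← spinCover_spinPair]
        rfl
      · intro v
        have ha : (spinCover _ a').1 = reflMat (inU m x.1) * reflMat (inU m y.1) :=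
          spinCover_spinPair _ _ _ _
        have hb : (spinCover _ b').1 = reflMat x.1 * reflMat y.1 := spinCover_spinPair _ _ _ _
        rw [map_mul, map_mul]
        change ((spinCover _ a').1 * (spinCover _ a).1) *ᵥ inU m v =
          inU m (((spinCover _ b').1 * (spinCover _ b).1) *ᵥ v)
        rw [← Matrix.mulVec_mulVec, h3, ha, hb, ← Matrix.mulVec_mulVec, reflMat_inU, reflMat_inU,
          ← Matrix.mulVec_mulVec, ← Matrix.mulVec_mulVec]

/-- Every special orthogonal matrix that commutes with the partial complex structure lifts to the
stabilizer of the model spinor. -/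
theorem exists_lift (A : SO (2 * m + r)) (hA : A.1 * cxMat φ = cxMat φ * A.1) :
    ∃ u : Spin (2 * m + r) × Spin r × Circle, spinCover _ u.1 = A ∧ spinAct u φ = φ ∧
      ∀ v, A.1 *ᵥ inU m v = inU m ((spinCover _ u.2.1).1 *ᵥ v) := by
  obtain ⟨a, z, h1, h2, h3⟩ := h.exists_stabilizer_fix (SO_transpose_mul A) hA
  obtain ⟨L, hL⟩ := exists_prod_reflMat (C := ((spinCover _ a)⁻¹ * A).1) (SO_transpose_mul _) h3
  -- The remaining factor has determinant 1, and each reflection contributes -1.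
  have hlen : Even L.length := by
    have hdet : ∀ L : List {x : Fin r → ℝ // x ⬝ᵥ x = 1},
        (L.map fun x => reflMat (inU m x.1)).prod.det = (-1) ^ L.length := by
      intro L
      induction L with
      | nil => simp
      | cons x L ih =>
        rw [List.map_cons, List.prod_cons, Matrix.det_mul, ih, reflMat_det (by rw [inU_dot, x.2]),
          List.length_cons, pow_succ']
    have h4 := hdet L
    rw [← hL, (Matrix.mem_specialOrthogonalGroup_iff.mp ((spinCover _ a)⁻¹ * A).2).2] at h4
    by_contra hodd
    rw [(Nat.not_even_iff_odd.mp hodd).neg_one_pow] at h4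
    norm_num at h4
  obtain ⟨k, hk⟩ := hlen
  obtain ⟨a', b', h5, h6, h7⟩ := h.exists_lift_prod k L (by omega)
  have hA' : spinCover _ (a * a') = A := by
    have : spinCover _ a' = (spinCover _ a)⁻¹ * A := Subtype.ext (by rw [h6, hL])
    rw [map_mul, this, mul_inv_cancel_left]
  refine ⟨(a * a', b', z), hA', ?_, ?_⟩
  · have : ((a * a', b', z) : Spin (2 * m + r) × Spin r × Circle) = (a, 1, z) * (a', b', 1) := by
      simp
    rw [this, spinAct_mul, h5, h1]
  · intro v
    rw [← hA', map_mul]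
    change ((spinCover _ a).1 * (spinCover _ a').1) *ᵥ inU m v = _
    rw [← Matrix.mulVec_mulVec, h7, h2]

end ModelSpinor

/-- Unitary matrices preserve the orientation: for r = 0 the element of `exists_stabilizer_fix`
covers the whole matrix, which therefore lies in `SO`. -/
theorem ModelSpinor.det_eq_one {ε : Fin m → ℝ} {φ : TwistedSpinor 0 (2 * m + 0)}
    (h : ModelSpinor ε φ) {A : Matrix (Fin (2 * m + 0)) (Fin (2 * m + 0)) ℝ} (hA : Aᵀ * A = 1)
    (hAJ : A * cxMat φ = cxMat φ * A) : A.det = 1 := by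
  obtain ⟨a, z, -, -, h3⟩ := h.exists_stabilizer_fix hA hAJ
  have h4 := eq_one_of_mulVec_e fun i => h3 i i.isLt
  have h5 : A = (spinCover _ a).1 := by
    have h6 : (spinCover _ a).1 * (spinCover _ a)⁻¹.1 = 1 :=
      congrArg Subtype.val (mul_inv_cancel (spinCover _ a))
    rw [← one_mul A, ← h6, mul_assoc, h4, mul_one]
  rw [h5]
  exact (Matrix.mem_specialOrthogonalGroup_iff.mp (spinCover _ a).2).2

/-- The quotient u⁻¹ v has spin components ±1. Since it fixes φ ≠ 0, its phase is the product of
these two signs, so it lies in `signs`. -/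
theorem mk_eq_mk_of_spinAct {n : ℕ} {φ : TwistedSpinor r n} (hφ : herm φ φ = 1)
    {u v : Spin n × Spin r × Circle} (hu : spinAct u φ = φ) (hv : spinAct v φ = φ)
    (h1 : spinCover n u.1 = spinCover n v.1) (h2 : spinCover r u.2.1 = spinCover r v.2.1) :
    (QuotientGroup.mk u : SpinCR n r) = QuotientGroup.mk v := by
  rw [QuotientGroup.eq]
  set w := u⁻¹ * v with hw
  have hwφ : spinAct w φ = φ := by
    have h3 : spinAct w φ = spinAct u⁻¹ (spinAct u φ) := by rw [hw, spinAct_mul, hv, hu]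
    rw [h3, ← spinAct_mul, inv_mul_cancel, spinAct_one]
  have hne : φ ≠ 0 := by
    rintro rfl
    rw [herm_zero_left] at hφ
    exact zero_ne_one hφ
  have hw1 : spinCover n w.1 = 1 := by
    change spinCover n (u.1⁻¹ * v.1) = 1
    rw [map_mul, map_inv, h1, inv_mul_cancel]
  have hw2 : spinCover r w.2.1 = 1 := by
    change spinCover r (u.2.1⁻¹ * v.2.1) = 1
    rw [map_mul, map_inv, h2, inv_mul_cancel]
  have g1 : ((1, Spin.negOne r, -1) : Spin n × Spin r × Circle) ∈ signs n r :=
    Subgroup.subset_closure (by simp)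
  have g2 : ((Spin.negOne n, Spin.negOne r, 1) : Spin n × Spin r × Circle) ∈ signs n r :=
    Subgroup.subset_closure (by simp)
  obtain ⟨a, b, z⟩ := w
  have hz : ∀ s : ℂ, ((z : ℂ) * s) • φ = φ → (z : ℂ) * s = 1 := fun s hs => by
    have h5 : ((z : ℂ) * s - 1) • φ = 0 := by rw [sub_smul, one_smul, hs, sub_self]
    exact sub_eq_zero.mp ((smul_eq_zero.mp h5).resolve_right hne)
  have hcl : clHom r n (((Spin.negOne n : Spin n) : (Cl n)ˣ) : Cl n) φ = -φ := by
    simp [Spin.negOne]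
  have htw : ∀ ψ, twHom r n (((Spin.negOne r : Spin r) : (Cl r)ˣ) : Cl r) ψ = -ψ := by
    intro ψ; simp [Spin.negOne]
  rw [spinAct_apply] at hwφ
  simp only at hwφ hw1 hw2
  rcases Spin.eq_one_or_negOne hw1 with rfl | rfl <;>
    rcases Spin.eq_one_or_negOne hw2 with rfl | rfl
  · have h6 := hz 1 (by simpa using hwφ)
    obtain rfl : z = 1 := Circle.ext (by simpa using h6)
    exact one_mem _
  · have h6 := hz (-1) (by simpa [htw] using hwφ)
    obtain rfl : z = -1 := Circle.ext (by
      rw [Circle.coe_neg, Circle.coe_one, ← h6]; ring)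
    exact g1
  · have h6 := hz (-1) (by simpa [hcl] using hwφ)
    obtain rfl : z = -1 := Circle.ext (by
      rw [Circle.coe_neg, Circle.coe_one, ← h6]; ring)
    have := mul_mem g1 g2
    have hsq : Spin.negOne r * Spin.negOne r = 1 := Subtype.ext (by simp [Spin.negOne])
    simpa [hsq] using this
  · have h6 := hz 1 (by simpa [hcl, htw] using hwφ)
    obtain rfl : z = 1 := Circle.ext (by simpa using h6)
    exact g2

end ModelLift

/-! ### Criterion for model spinors in terms of expectation values. -/

section Existence

variable {m r : ℕ}

/-- The basis vectors of the last summand in `ℝ²ᵐ⁺ʳ`. -/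
abbrev eU (m : ℕ) {r : ℕ} (k : Fin r) : Fin (2 * m + r) → ℝ := e (Fin.natAdd (2 * m) k)

/-- The product of the basis vectors of the last summand with indices in a given list. -/
def word (m : ℕ) {r : ℕ} (w : List (Fin r)) : Cl (2 * m + r) :=
  ((w.map (Fin.natAdd (2 * m))).map basisVec).prod

theorem vec_mul_word {w : List (Fin r)} (hlen : Even w.length) (p : Fin r) :
    vec (eU m p) * word m w = (-1 : ℝ) ^ w.count p • (word m w * vec (eU m p)) := by
  have := basisVec_mul_prod (Fin.natAdd (2 * m) p) (w.map (Fin.natAdd (2 * m)))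
  rw [List.length_map, List.count_map_of_injective _ _ (Fin.natAdd_injective r (2 * m)), pow_add,
    hlen.neg_one_pow, one_mul] at this
  exact this

theorem clHom_word_two (k l : Fin r) (φ : TwistedSpinor r (2 * m + r)) :
    clHom r _ (word m [k, l]) φ = E (eU m k) (E (eU m l) φ) := by
  simp only [word, List.map_cons, List.map_nil, List.prod_cons, List.prod_nil, mul_one,
    clHom_mul_apply]
  rfl

theorem clHom_word_four (i j k l : Fin r) (φ : TwistedSpinor r (2 * m + r)) :
    clHom r _ (word m [i, j, k, l]) φ =
      E (eU m i) (E (eU m j) (E (eU m k) (E (eU m l) φ))) := by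
  simp only [word, List.map_cons, List.map_nil, List.prod_cons, List.prod_nil, mul_one,
    clHom_mul_apply]
  rfl

theorem natAdd_dot_ne {k l : Fin r} (h : k ≠ l) : eU m k ⬝ᵥ eU m l = 0 :=
  e_dot_ne fun h' => h (Fin.natAdd_injective r (2 * m) h')

/-- If products of two or four distinct basis vectors of U have expectation zero, then η_kl is
simply e_{2m+k} ∧ e_{2m+l}, and the remaining conditions of partial purity follow from `F_F`. -/
theorem ModelSpinor.of_herm_word {ε : Fin m → ℝ} {χ : TwistedSpinor r (2 * m + r)}
    (sign : ∀ a, ε a * ε a = 1) (sigma : InSigma χ) (unit : herm χ χ = 1)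
    (E_fst : ∀ a, E (e (fst r a)) χ = Complex.I • ε a • E (e (snd r a)) χ)
    (F_F : ∀ x y, F x (F y χ) = E (inU m y) (E (inU m x) χ))
    (hw : ∀ w : List (Fin r), w.Nodup → w.length = 2 ∨ w.length = 4 →
      herm (clHom r _ (word m w) χ) χ = 0) : ModelSpinor ε χ := by
  have hFF : ∀ k l, F (e k) (F (e l) χ) = E (eU m l) (E (eU m k) χ) := fun k l => by
    rw [F_F, inU_e, inU_e]
  have h2 : ∀ k l : Fin r, k ≠ l → herm (E (eU m k) (E (eU m l) χ)) χ = 0 := fun k l hkl => by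
    rw [← clHom_word_two]; exact hw _ (by simp [hkl]) (Or.inl rfl)
  have hF2 : ∀ k l : Fin r, k ≠ l → herm (F (e k) (F (e l) χ)) χ = 0 := fun k l hkl => by
    rw [hFF]; exact h2 l k hkl.symm
  obtain ⟨V, hrank, hV⟩ := exists_submodule_first m r
  have hlow : ∀ i : Fin (2 * m + r), i.val < 2 * m → e i ∈ V := fun i hi =>
    (hV _).mpr fun k => Pi.single_eq_of_ne (fun h => by
      have := congrArg Fin.val h
      simp only [Fin.val_natAdd] at this
      omega) _
  have hE : ∀ i : Fin (2 * m + r), ∃ y ∈ V, i.val < 2 * m → E (e i) χ = Complex.I • E y χ := by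
    intro i
    rcases index_cases i with ⟨a, rfl⟩ | ⟨a, rfl⟩ | ⟨k, rfl⟩
    · exact ⟨ε a • e (snd r a), V.smul_mem _ (hlow _ (by simp only [snd]; omega)), fun _ => by
        rw [E_fst, E_smul]⟩
    · refine ⟨-(ε a • e (fst r a)), V.neg_mem (V.smul_mem _ (hlow _ (by simp only [fst]; omega))),
        fun _ => ?_⟩
      rw [E_neg, E_smul, E_fst, smul_neg, smul_comm (ε a) Complex.I, smul_smul (ε a), sign,
        one_smul, smul_smul, Complex.I_mul_I, neg_one_smul, neg_neg]
    · exact ⟨0, V.zero_mem, fun h => by simp at h⟩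
  choose y hyV hy using hE
  have hJ : ∀ X ∈ V, ∃ Y ∈ V, E X χ = Complex.I • E Y χ := by
    intro X hX
    refine ⟨∑ i, X i • y i, Submodule.sum_mem _ fun i _ => V.smul_mem _ (hyV i), ?_⟩
    have : E (∑ i, X i • y i) χ = ∑ i, X i • E (y i) χ := by
      simp [E, map_sum, LinearMap.sum_apply]
    rw [E_eq_sum, this, Finset.smul_sum]
    refine Finset.sum_congr rfl fun i _ => ?_
    by_cases hi : i.val < 2 * m
    · rw [hy i hi, smul_comm]
    · have h0 : X i = 0 := by
        rcases index_cases i with ⟨a, rfl⟩ | ⟨a, rfl⟩ | ⟨k, rfl⟩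
        · exact absurd (by simp only [fst]; omega) hi
        · exact absurd (by simp only [snd]; omega) hi
        · exact (hV X).mp hX k
      rw [h0, zero_smul, zero_smul, smul_zero]
  -- An index below 2m gives zero by `herm_E_E_tw_eq_zero`. For two indices in U the factor f_k f_l
  -- turns into e_l e_k, which leaves ±1 if the pairs coincide and otherwise a word of length two or
  -- four.
  have hcoeff : ∀ k l : Fin r, k ≠ l → ∀ i j, i < j →
      (herm (E (e i) (E (e j) (F (e k) (F (e l) χ)))) χ).re =
        (if i = Fin.natAdd (2 * m) k ∧ j = Fin.natAdd (2 * m) l then 1 else 0) -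
        (if i = Fin.natAdd (2 * m) l ∧ j = Fin.natAdd (2 * m) k then 1 else 0) := by
    intro k l hkl i j hij
    have hne : ∀ i : Fin (2 * m + r), i.val < 2 * m → ∀ k, i ≠ Fin.natAdd (2 * m) k :=
      fun i hi k h => by rw [h] at hi; simp at hi
    have hV0 : ∀ i : Fin (2 * m + r), i.val < 2 * m → ∀ Z,
        herm (E (e i) (E Z (F (e k) (F (e l) χ)))) χ = 0 := fun i hi Z => by
      have h3 := herm_E_E_tw_eq_zero (w := vec (e k) * vec (e l)) (by
        rw [twHom_mul_apply]; exact hF2 k l hkl) (hy i hi) Z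
      rwa [twHom_mul_apply] at h3
    by_cases hi : i.val < 2 * m
    · rw [hV0 i hi]; simp [hne i hi]
    by_cases hj : j.val < 2 * m
    · rw [E_E_orth (e_dot_ne hij.ne), herm_neg_left, hV0 j hj]; simp [hne j hj]
    obtain ⟨a, rfl⟩ : ∃ a, i = Fin.natAdd (2 * m) a := by
      rcases index_cases i with ⟨a, rfl⟩ | ⟨a, rfl⟩ | h
      · exact absurd (by simp only [fst]; omega) hi
      · exact absurd (by simp only [snd]; omega) hi
      · exact h
    obtain ⟨b, rfl⟩ : ∃ a, j = Fin.natAdd (2 * m) a := by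
      rcases index_cases j with ⟨a, rfl⟩ | ⟨a, rfl⟩ | h
      · exact absurd (by simp only [fst]; omega) hj
      · exact absurd (by simp only [snd]; omega) hj
      · exact h
    have hab : a ≠ b := fun h => by rw [h] at hij; exact lt_irrefl _ hij
    have hu : ∀ p : Fin r, ∀ ψ : TwistedSpinor r (2 * m + r), E (eU m p) (E (eU m p) ψ) = -ψ :=
      fun p ψ => E_E_unit (e_dot_self _) ψ
    have hs : ∀ p q : Fin r, p ≠ q → ∀ ψ : TwistedSpinor r (2 * m + r),
        E (eU m p) (E (eU m q) ψ) = -E (eU m q) (E (eU m p) ψ) :=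
      fun p q hpq ψ => E_E_orth (natAdd_dot_ne hpq) ψ
    simp only [(Fin.natAdd_injective r (2 * m)).eq_iff]
    rw [hFF]
    by_cases hbl : b = l
    · subst hbl
      rw [hu, map_neg, herm_neg_left]
      by_cases hak : a = k
      · subst hak
        rw [hu, herm_neg_left, unit]; simp [hkl]
      · rw [h2 a k hak]; simp [hak, hab]
    by_cases hbk : b = k
    · subst hbk
      rw [hs l b hkl.symm, map_neg, hu, neg_neg]
      by_cases hal : a = l
      · subst hal
        rw [hu, herm_neg_left, unit]; simp [hab]
      · rw [h2 a l hal]; simp [hal, hab]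
    by_cases hak : a = k
    · subst hak
      rw [hs a b hab, hs l a hkl.symm, map_neg, map_neg, hu, map_neg, neg_neg, herm_neg_left, h2 b l hbl]
      simp [hbl, hkl]
    by_cases hal : a = l
    · subst hal
      rw [hs a b hab, hu, map_neg, neg_neg, h2 b k hbk]
      simp [hbl, hbk]
    rw [← clHom_word_four, hw _ _ (Or.inr rfl)]
    · simp [hak, hal]
    · simp [hab, hal, hak, hbl, hbk, hkl.symm]
  refine ⟨sign, ⟨sigma, unit, ⟨V, hrank, hJ⟩, fun k l hkl => ?_, fun k l hkl => ?_, ?_⟩, E_fst, F_F⟩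
  · have heta : eta χ k l = basisVec (Fin.natAdd (2 * m) k) * basisVec (Fin.natAdd (2 * m) l) := by
      rw [eta, Finset.sum_eq_single (Fin.natAdd (2 * m) k),
        Finset.sum_eq_single (Fin.natAdd (2 * m) l)]
      · rw [if_pos (by simpa using hkl), etaCoeff, clMul_basis, twMul_basis,
          hcoeff k l hkl.ne _ _ (by simpa using hkl)]
        simp [hkl.ne]
      · intro j _ hj
        split_ifs with hlt
        · rw [etaCoeff, clMul_basis, twMul_basis, hcoeff k l hkl.ne _ _ hlt]
          simp [hj, hkl.ne]
        · rfl
      · simp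
      · intro i _ hi
        refine Finset.sum_eq_zero fun j _ => ?_
        split_ifs with hlt
        · rw [etaCoeff, clMul_basis, twMul_basis, hcoeff k l hkl.ne _ _ hlt]
          have : ¬ (i = Fin.natAdd (2 * m) l ∧ j = Fin.natAdd (2 * m) k) := by
            rintro ⟨rfl, rfl⟩
            exact absurd ((Fin.natAdd_lt_natAdd_iff _).mp hlt) hkl.not_gt
          simp [hi, this]
        · rfl
      · simp
    rw [heta, clMul_basis, twMul_basis, hFF, E_E_orth (natAdd_dot_ne hkl.ne), neg_add_cancel]
  · rw [twMul_basis]; exact hF2 k l hkl.ne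
  · intro hr
    subst hr
    have h4 : ∀ i j k l : Fin 4, F (e i) (F (e j) (F (e k) (F (e l) χ))) =
        clHom 4 _ (word m [l, k, j, i]) χ := fun i j k l => by
      rw [hFF, ← E_F, ← E_F, ← E_F, ← E_F, hFF, clHom_word_four]
    rw [volumeElt_four, h4]
    exact hw _ (by decide) (Or.inr rfl)

end Existence

/-! ### Construction of model spinors. -/

section Existence

variable {m r : ℕ}

/-- The operator whose kernel consists of the spinors on which `e_{2a}` acts as `i ε_a e_{2a+1}`. -/
def pairOp (ε : Fin m → ℝ) (a : Fin m) (φ : TwistedSpinor r (2 * m + r)) :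
    TwistedSpinor r (2 * m + r) :=
  E (e (fst r a)) φ - Complex.I • ε a • E (e (snd r a)) φ

/-- The complex vector e_{2a} - i ε_a e_{2a+1} is isotropic, so its Clifford square is zero. -/
theorem pairOp_self {ε : Fin m → ℝ} {a : Fin m} (hε : ε a * ε a = 1)
    (φ : TwistedSpinor r (2 * m + r)) : pairOp ε a (pairOp ε a φ) = 0 := by
  have hs : ∀ ψ : TwistedSpinor r (2 * m + r), E (e (snd r a)) (E (e (fst r a)) ψ) =
      -E (e (fst r a)) (E (e (snd r a)) ψ) := fun ψ => E_E_orth (e_dot_ne (fst_ne_snd r a).symm) ψ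
  simp only [pairOp, map_sub, map_smul, E_E_unit (e_dot_self _), hs, LinearMap.map_smul_of_tower]
  rw [smul_sub, smul_sub, smul_comm (ε a) Complex.I, smul_smul Complex.I, smul_smul (ε a), hε,
    Complex.I_mul_I]
  simp only [one_smul, neg_smul, smul_neg]
  abel

theorem pairOp_E_comm {ε : Fin m → ℝ} {a : Fin m} {x : Fin (2 * m + r) → ℝ}
    (h1 : e (fst r a) ⬝ᵥ x = 0) (h2 : e (snd r a) ⬝ᵥ x = 0) (φ : TwistedSpinor r (2 * m + r)) :
    pairOp ε a (E x φ) = -E x (pairOp ε a φ) := by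
  simp only [pairOp, map_sub, map_smul, LinearMap.map_smul_of_tower, E_E_orth h1, E_E_orth h2]
  simp only [smul_neg]
  abel

theorem pairOp_smul (ε : Fin m → ℝ) (a : Fin m) (c : ℂ) (φ : TwistedSpinor r (2 * m + r)) :
    pairOp ε a (c • φ) = c • pairOp ε a φ := by
  simp only [pairOp, map_smul, smul_sub]
  rw [smul_comm (ε a) c, smul_comm Complex.I c]

theorem pairOp_add (ε : Fin m → ℝ) (a : Fin m) (φ ψ : TwistedSpinor r (2 * m + r)) :
    pairOp ε a (φ + ψ) = pairOp ε a φ + pairOp ε a ψ := by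
  simp only [pairOp, map_add, smul_add]
  abel

theorem pairOp_twHom (ε : Fin m → ℝ) (a : Fin m) (w : Cl r) (φ : TwistedSpinor r (2 * m + r)) :
    pairOp ε a (twHom r _ w φ) = twHom r _ w (pairOp ε a φ) := by
  have h : ∀ x, E x (twHom r _ w φ) = twHom r _ w (E x φ) := fun x => clHom_twHom _ _ _
  simp only [pairOp, h, map_sub, map_smul, LinearMap.map_smul_of_tower]

/-- The nilpotent operators anticommute. If φ is not yet in the kernel of the next one, its image
is, and the image stays in the earlier kernels. -/
theorem exists_pairOp_eq_zero {ε : Fin m → ℝ} (hε : ∀ a, ε a * ε a = 1) :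
    ∃ φ : TwistedSpinor r (2 * m + r), φ ≠ 0 ∧ ∀ a, pairOp ε a φ = 0 := by
  have key : ∀ j ≤ m, ∃ φ : TwistedSpinor r (2 * m + r), φ ≠ 0 ∧
      ∀ a : Fin m, a.val < j → pairOp ε a φ = 0 := by
    intro j
    induction j with
    | zero => exact fun _ => ⟨fun _ => 1, fun h => one_ne_zero
        (congrFun h (fun _ => 0, fun _ => 0)), fun a ha => by omega⟩
    | succ j ih =>
      intro hj
      obtain ⟨φ, h0, hφ⟩ := ih (by omega)
      let k : Fin m := ⟨j, by omega⟩
      have hsplit : ∀ a : Fin m, a.val < j + 1 → a.val < j ∨ a = k := fun a ha => by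
        by_cases h : a.val < j
        · exact Or.inl h
        · exact Or.inr (Fin.ext (by simp only [k]; omega))
      by_cases hk : pairOp ε k φ = 0
      · refine ⟨φ, h0, fun a ha => ?_⟩
        rcases hsplit a ha with h | rfl
        · exact hφ a h
        · exact hk
      · refine ⟨pairOp ε k φ, hk, fun a ha => ?_⟩
        rcases hsplit a ha with h | rfl
        · have h1 : ∀ x, e (fst r a) ⬝ᵥ x = 0 → e (snd r a) ⬝ᵥ x = 0 →
              pairOp ε a (E x φ) = 0 := fun x hx hx' => by
            rw [pairOp_E_comm hx hx', hφ a h, map_zero, neg_zero]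
          have h2 : pairOp ε a (-(Complex.I • ε k • E (e (snd r k)) φ)) = 0 := by
            rw [← smul_neg, pairOp_smul, ← Complex.coe_smul, ← smul_neg, pairOp_smul,
              ← E_neg, h1, smul_zero, smul_zero] <;>
            · rw [dotProduct_neg, e_dot_ne, neg_zero]
              intro h'
              have := congrArg Fin.val h'
              simp only [fst, snd, k] at this
              omega
          have h3 : pairOp ε k φ =
              E (e (fst r k)) φ + -(Complex.I • ε k • E (e (snd r k)) φ) := sub_eq_add_neg _ _
          rw [h3, pairOp_add, h2, h1, add_zero] <;>
          · rw [e_dot_ne]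
            intro h'
            have := congrArg Fin.val h'
            simp only [fst, snd, k] at this
            omega
        · exact pairOp_self (hε _) φ
  obtain ⟨φ, h0, h⟩ := key m le_rfl
  exact ⟨φ, h0, fun a => h a a.isLt⟩

/-- The involutions f_k e_{2m+k} commute with each other, and the condition on φ says that they all
have the eigenvalue -c. Such a joint eigenvector is obtained by projecting step by step; the common
sign c is not prescribed, because only c² = 1 matters. -/
theorem exists_pairOp_F {ε : Fin m → ℝ} (hε : ∀ a, ε a * ε a = 1) :
    ∃ (c : ℝ) (φ : TwistedSpinor r (2 * m + r)), c * c = 1 ∧ herm φ φ = 1 ∧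
      (∀ a, pairOp ε a φ = 0) ∧ ∀ k, F (e k) φ = c • E (eU m k) φ := by
  have key : ∀ j ≤ r, ∃ (c : ℝ) (φ : TwistedSpinor r (2 * m + r)), c * c = 1 ∧ φ ≠ 0 ∧
      (∀ a, pairOp ε a φ = 0) ∧ ∀ k : Fin r, k.val < j → F (e k) φ = c • E (eU m k) φ := by
    intro j
    induction j with
    | zero =>
      obtain ⟨φ, h0, hφ⟩ := exists_pairOp_eq_zero (r := r) hε
      exact fun _ => ⟨1, φ, one_mul 1, h0, hφ, fun k hk => by omega⟩
    | succ j ih =>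
      intro hj
      obtain ⟨c, φ, hc, h0, hφ, hF⟩ := ih (by omega)
      let k : Fin r := ⟨j, by omega⟩
      have hne : ∀ l : Fin r, l.val < j → l ≠ k := fun l hl h => by
        rw [h] at hl; simp [k] at hl
      have hsplit : ∀ l : Fin r, l.val < j + 1 → l.val < j ∨ l = k := fun l hl => by
        by_cases h : l.val < j
        · exact Or.inl h
        · exact Or.inr (Fin.ext (by simp only [k]; omega))
      have hpF : ∀ a x, pairOp ε a (F x φ) = 0 := fun a x => by
        rw [F, pairOp_twHom, hφ, map_zero]
      have hpE : ∀ a ψ, pairOp ε a ψ = 0 → pairOp ε a (E (eU m k) ψ) = 0 := fun a ψ h => by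
        rw [pairOp_E_comm, h, map_zero, neg_zero] <;>
        · rw [e_dot_ne]
          intro h'
          have := congrArg Fin.val h'
          simp only [fst, snd, Fin.val_natAdd] at this
          omega
      -- If the projection of φ vanishes, φ has the wrong eigenvalue for the new involution. Then
      -- f_k φ is taken: it keeps this eigenvalue and reverses all earlier ones, so c becomes -c
      -- throughout.
      by_cases hk : φ - c • F (e k) (E (eU m k) φ) = 0
      · refine ⟨-c, F (e k) φ, by simpa using hc, fun h => h0 ?_, fun a => hpF a _, fun l hl => ?_⟩
        · have h1 := F_F_unit (e_dot_self k) φ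
          rw [h, map_zero] at h1
          exact neg_eq_zero.mp h1.symm
        · rcases hsplit l hl with h | rfl
          · rw [F_F_orth (e_dot_ne (hne l h)), hF l h, LinearMap.map_smul_of_tower, E_F, neg_smul]
          · rw [F_F_unit (e_dot_self _), E_F, neg_smul, ← sub_eq_zero.mp hk]
      · refine ⟨c, φ - c • F (e k) (E (eU m k) φ), hc, hk, fun a => ?_, fun l hl => ?_⟩
        · rw [sub_eq_add_neg, ← neg_smul, ← Complex.coe_smul, pairOp_add, hφ, pairOp_smul, ← E_F,
            hpE a _ (hpF a _), smul_zero, add_zero]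
        · rcases hsplit l hl with h | rfl
          · rw [map_sub, map_sub, LinearMap.map_smul_of_tower, LinearMap.map_smul_of_tower,
              F_F_orth (e_dot_ne (hne l h)), ← E_F, hF l h, LinearMap.map_smul_of_tower, E_F (eU m l),
              E_E_orth (natAdd_dot_ne (hne l h)), LinearMap.map_smul_of_tower, map_neg]
            module
          · rw [map_sub, map_sub, LinearMap.map_smul_of_tower, LinearMap.map_smul_of_tower,
              F_F_unit (e_dot_self _), E_F, E_E_unit (e_dot_self _), map_neg, smul_sub,
              smul_smul, hc, one_smul]
            module
  obtain ⟨c, φ, hc, h0, hφ, hF⟩ := key r le_rfl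
  obtain ⟨t, ht⟩ : ∃ t : ℝ, herm φ φ = t := ⟨_, herm_self_eq φ⟩
  have ht0 : 0 < t := by
    have h1 : t ≠ 0 := fun h => h0 (herm_self_eq_zero (by rw [ht, h]; simp))
    refine lt_of_le_of_ne ?_ h1.symm
    have h2 := herm_self_eq φ
    rw [ht] at h2
    rw [Complex.ofReal_inj.mp h2]
    exact Finset.sum_nonneg fun i _ => Complex.normSq_nonneg _
  refine ⟨c, (((√t)⁻¹ : ℝ) : ℂ) • φ, hc, ?_, fun a => by rw [pairOp_smul, hφ, smul_zero],
    fun k => by rw [map_smul, map_smul, hF k k.isLt, smul_comm]⟩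
  rw [herm_smul_left, herm_smul_right, ht, Complex.conj_ofReal, ← Complex.ofReal_mul,
    ← Complex.ofReal_mul]
  norm_cast
  have := Real.sqrt_ne_zero'.mpr ht0
  nth_rewrite 3 [← Real.mul_self_sqrt ht0.le]
  field_simp

theorem F_eq_of_basis {c : ℝ} {φ : TwistedSpinor r (2 * m + r)}
    (hF : ∀ k, F (e k) φ = c • E (eU m k) φ) (x : Fin r → ℝ) : F x φ = c • E (inU m x) φ := by
  have h1 : inU m x = ∑ k, x k • eU m k := by
    ext i
    refine Fin.addCases (fun j => ?_) (fun j => ?_) i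
    · rw [inU_of_lt _ (by simp), Finset.sum_apply, Finset.sum_eq_zero]
      intro k _
      have hne : Fin.castAdd r j ≠ Fin.natAdd (2 * m) k := fun h => by
        have := congrArg Fin.val h
        simp only [Fin.val_castAdd, Fin.val_natAdd] at this
        omega
      simp [hne]
    · simp [inU_natAdd, Finset.sum_apply, Pi.single_apply]
  rw [F_eq_sum, h1]
  simp only [hF, E, map_sum, map_smul, LinearMap.sum_apply, LinearMap.smul_apply, Finset.smul_sum]
  exact Finset.sum_congr rfl fun k _ => smul_comm _ _ _

theorem F_F_of_F_eq {c : ℝ} (hc : c * c = 1) {φ : TwistedSpinor r (2 * m + r)}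
    (hF : ∀ k, F (e k) φ = c • E (eU m k) φ) (x y : Fin r → ℝ) :
    F x (F y φ) = E (inU m y) (E (inU m x) φ) := by
  rw [F_eq_of_basis hF, LinearMap.map_smul_of_tower, ← E_F, F_eq_of_basis hF,
    LinearMap.map_smul_of_tower, smul_smul, hc, one_smul]

/-- An operator that anticommutes with `F_p E_p` has vanishing expectation in an eigenvector. -/
theorem herm_eq_zero_of_anticomm {c : ℝ} (hc : c * c = 1) {φ : TwistedSpinor r (2 * m + r)}
    {p : Fin r} (hF : F (e p) φ = c • E (eU m p) φ) (K : Module.End ℂ (TwistedSpinor r (2 * m + r)))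
    (hK : ∀ ψ, K (E (eU m p) (F (e p) ψ)) = -E (eU m p) (F (e p) (K ψ))) : herm (K φ) φ = 0 := by
  have hS : E (eU m p) (F (e p) φ) = -(c • φ) := by
    rw [hF, LinearMap.map_smul_of_tower, E_E_unit (e_dot_self _), smul_neg]
  have hiso : ∀ ψ χ : TwistedSpinor r (2 * m + r),
      herm (E (eU m p) (F (e p) ψ)) (E (eU m p) (F (e p) χ)) = herm ψ χ := fun ψ χ => by
    rw [herm_E, E_E_unit (e_dot_self _), herm_neg_right, neg_neg, herm_F,
      F_F_unit (e_dot_self _), herm_neg_right, neg_neg]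
  have h1 := hiso (K φ) φ
  rw [← neg_eq_iff_eq_neg.mpr (hK φ), hS, map_neg, neg_neg, LinearMap.map_smul_of_tower,
    herm_neg_right, herm_rsmul_left, herm_rsmul_right, ← mul_assoc, ← Complex.ofReal_mul, hc,
    Complex.ofReal_one, one_mul] at h1
  have h2 : (2 : ℂ) * herm (K φ) φ = 0 := by linear_combination -h1
  exact (mul_eq_zero.mp h2).resolve_left two_ne_zero

/-- A product of l distinct basis vectors has the square (-1)^{l(l+1)/2}; for l = 2k the exponent
has the parity of k. -/
theorem volumeElt_mul_self (k : ℕ) (hr : r = 2 * k) :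
    volumeElt r * volumeElt r = (-1 : ℝ) ^ k • 1 := by
  have h : ∀ l : List (Fin r), l.Nodup → (l.map basisVec).prod * (l.map basisVec).prod =
      (-1 : ℝ) ^ (∑ i ∈ Finset.range (l.length + 1), i) • (1 : Cl r) := by
    intro l
    induction l with
    | nil => simp
    | cons i l ih =>
      intro hl
      obtain ⟨h1, h2⟩ := List.nodup_cons.mp hl
      have h3 := basisVec_mul_prod i l
      rw [List.count_eq_zero_of_not_mem h1, add_zero] at h3
      have h4 : (l.map basisVec).prod * basisVec i =
          (-1 : ℝ) ^ l.length • (basisVec i * (l.map basisVec).prod) := by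
        rw [h3, smul_smul, ← mul_pow]; simp
      rw [List.map_cons, List.prod_cons, mul_assoc, ← mul_assoc _ (basisVec i), h4, smul_mul_assoc,
        mul_smul_comm, mul_assoc, ← mul_assoc (basisVec i) (basisVec i),
        show basisVec i * basisVec i = -1 from vec_mul_self (e_dot_self i), ih h2,
        List.length_cons, Finset.sum_range_succ _ (l.length + 1), pow_add, pow_succ]
      simp [smul_smul, mul_comm]
  rw [volumeElt_eq, h _ (List.nodup_finRange r), List.length_finRange, hr]
  congr 1
  have h2 : ∀ k : ℕ, (-1 : ℝ) ^ (∑ i ∈ Finset.range (2 * k + 1), i) = (-1) ^ k := by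
    intro k
    induction k with
    | zero => simp
    | succ k ih =>
      rw [show 2 * (k + 1) + 1 = 2 * k + 1 + 1 + 1 by ring, Finset.sum_range_succ,
        Finset.sum_range_succ, pow_add, pow_add, ih, pow_succ]
      rw [show 2 * k + 1 + 1 = 2 * (k + 1) by ring, pow_succ, pow_mul, pow_mul]
      simp
  exact h2 k

theorem herm_volumeElt (φ ψ : TwistedSpinor r (2 * m + r)) :
    herm (twHom r _ (volumeElt r) φ) (twHom r _ (volumeElt r) ψ) = herm φ ψ := by
  rw [volumeElt_eq]
  induction List.finRange r with
  | nil => simp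
  | cons i l ih =>
    rw [List.map_cons, List.prod_cons, twHom_mul_apply, twHom_mul_apply]
    change herm (F (e i) _) (F (e i) _) = _
    rw [herm_F, F_F_unit (e_dot_self _), herm_neg_right, neg_neg, ih]

/-- Model spinors exist for all dimensions and all sign patterns. -/
theorem exists_modelSpinor (r : ℕ) {ε : Fin m → ℝ} (hε : ∀ a, ε a * ε a = 1) :
    ∃ φ : TwistedSpinor r (2 * m + r), ModelSpinor ε φ := by
  obtain ⟨c, φ, hc, unit, hφ, hF⟩ := exists_pairOp_F (r := r) hε
  have hFF := F_F_of_F_eq hc hF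
  have hEF : ∀ (w : Cl (2 * m + r)) x (ψ : TwistedSpinor r (2 * m + r)),
      clHom r _ w (F x ψ) = F x (clHom r _ w ψ) := fun w x ψ => clHom_twHom _ _ _
  have hcomm : ∀ w : List (Fin r), Even w.length → ∀ p ψ,
      clHom r _ (word m w) (E (eU m p) ψ) =
        (-1 : ℝ) ^ w.count p • E (eU m p) (clHom r _ (word m w) ψ) := fun w hw p ψ => by
    have h1 : word m w * vec (eU m p) = (-1 : ℝ) ^ w.count p • (vec (eU m p) * word m w) := by
      rw [vec_mul_word hw, smul_smul, ← mul_pow]; simp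
    rw [E, ← clHom_mul_apply, h1, map_smul, LinearMap.smul_apply, clHom_mul_apply]
  have hwφ : ∀ w : List (Fin r), w.Nodup → w.length = 2 ∨ w.length = 4 →
      herm (clHom r _ (word m w) φ) φ = 0 := by
    intro w hw hlen
    obtain ⟨p, hp⟩ := List.exists_mem_of_length_pos (l := w) (by omega)
    -- A word of even length that contains p exactly once anticommutes with e_{2m+p} and commutes
    -- with f_p.
    refine herm_eq_zero_of_anticomm hc (hF p) _ fun ψ => ?_
    rw [hcomm w (by rcases hlen with h | h <;> rw [h] <;> decide),
      List.count_eq_one_of_mem hw hp, hEF, pow_one, neg_one_smul]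
  by_cases hr : Odd r ∨ r = 0 ∨ r = 2 ∨ r = 4
  · refine ⟨φ, ModelSpinor.of_herm_word hε ?_ unit (fun a => sub_eq_zero.mp (hφ a)) hFF hwφ⟩
    rcases hr with h | rfl | h | h
    · exact Or.inl h
    · exact Or.inr (Or.inr (Or.inr (by simp [volumeElt, twMul_eq])))
    · exact Or.inr (Or.inl h)
    · exact Or.inr (Or.inr (Or.inl h))
  -- For even r ≥ 6 the spinor has to lie in Δᵣ⁺ ⊗ Δₙ. The normalized projection `χ` of φ has the
  -- same relevant expectation values as φ.
  · push Not at hr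
    obtain ⟨hodd, h0, h2, h4⟩ := hr
    have hev : Even r := Nat.not_odd_iff_even.mp hodd
    obtain ⟨k, hk⟩ := hev.exists_two_nsmul
    rw [smul_eq_mul] at hk
    have h6 : 6 ≤ r := by omega
    set ν := twHom r (2 * m + r) (volumeElt r) with hν
    set s : ℂ := Complex.I ^ (r / 2) with hs
    have hs2 : s * s = ((-1 : ℝ) ^ k : ℝ) := by
      rw [hs, ← mul_pow, Complex.I_mul_I, show r / 2 = k by omega]; simp
    have hss : s * (starRingEnd ℂ) s = 1 := by
      rw [hs, map_pow, ← mul_pow, Complex.mul_conj]; simp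
    have hνν : ∀ ψ, ν (ν ψ) = ((-1 : ℝ) ^ k) • ψ := fun ψ => by
      rw [hν, ← twHom_mul_apply, volumeElt_mul_self k hk, map_smul, map_one]; rfl
    have hνF : ∀ x ψ, ν (F x ψ) = -F x (ν ψ) := fun x ψ => by
      rw [hν, F, ← twHom_mul_apply, ← twHom_mul_apply, vec_mul_volumeElt hev, map_neg]
      simp
    have hνE : ∀ w ψ, clHom r _ w (ν ψ) = ν (clHom r _ w ψ) := fun w ψ => clHom_twHom _ _ _
    -- This is where r ≥ 6 matters: some index p does not occur in w. Then the word commutes with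
    -- e_{2m+p} while the volume element anticommutes with f_p, so the cross terms of the
    -- expectation vanish.
    have hout : ∀ w : List (Fin r), Even w.length → w.length ≤ 4 →
        herm (clHom r _ (word m w) (ν φ)) φ = 0 := by
      intro w hw hlen
      obtain ⟨p, hp⟩ : ∃ p, p ∉ w := by
        by_contra! hall
        have h1 : (Finset.univ : Finset (Fin r)) ⊆ w.toFinset := fun p _ =>
          List.mem_toFinset.mpr (hall p)
        have h3 := (Finset.card_le_card h1).trans (List.toFinset_card_le w)
        rw [Finset.card_univ, Fintype.card_fin] at h3
        omega
      refine herm_eq_zero_of_anticomm hc (hF p) (clHom r _ (word m w) * ν) fun ψ => ?_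
      change clHom r _ (word m w) (ν (E _ (F _ ψ))) = -E _ (F _ (clHom r _ (word m w) (ν ψ)))
      rw [E, ← hνE, hνF, map_neg, map_neg]
      change -(clHom r _ (word m w) (E (eU m p) (F _ (ν ψ)))) = _
      rw [hcomm w hw, List.count_eq_zero_of_not_mem hp, pow_zero, one_smul, hEF]
      rfl
    -- φ and ν φ are orthogonal unit vectors (the empty word in `hout`), hence the factor 1/√2.
    set t : ℂ := (((√2)⁻¹ : ℝ) : ℂ) with ht
    have htt : t * (starRingEnd ℂ) t = 1 / 2 := by
      rw [ht, Complex.conj_ofReal, ← Complex.ofReal_mul, ← mul_inv, Real.mul_self_sqrt (by norm_num)]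
      norm_num
    set χ := t • (φ + (starRingEnd ℂ) s • ν φ) with hχ
    have hherm : ∀ w : List (Fin r), Even w.length → w.length ≤ 4 →
        herm (clHom r _ (word m w) χ) χ = herm (clHom r _ (word m w) φ) φ := by
      intro w hw hlen
      have h1 := hout w hw hlen
      have h3 : herm (clHom r _ (word m w) (ν φ)) (ν φ) = herm (clHom r _ (word m w) φ) φ := by
        rw [hνE, hν, herm_volumeElt]
      have h5 : herm (clHom r _ (word m w) φ) (ν φ) = 0 := by
        rw [← herm_volumeElt, ← hν, hνν, herm_rsmul_right, ← hνE, h1, mul_zero]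
      rw [hχ, map_smul, map_add, map_smul, herm_smul_left, herm_smul_right, herm_add_left,
        herm_add_right, herm_add_right, herm_smul_left, herm_smul_left, herm_smul_right,
        herm_smul_right, h1, h3, h5, Complex.conj_conj]
      linear_combination (2 * herm (clHom r _ (word m w) φ) φ) * htt +
        t * (starRingEnd ℂ) t * herm (clHom r _ (word m w) φ) φ * hss
    -- Linear identities at φ between operators that commute with the volume element pass to its
    -- projection.
    have hsymm : ∀ K L : Module.End ℂ (TwistedSpinor r (2 * m + r)), (∀ ψ, K (ν ψ) = ν (K ψ)) →
        (∀ ψ, L (ν ψ) = ν (L ψ)) → K φ = L φ → K χ = L χ := by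
      intro K L hK hL h
      rw [hχ, map_smul, map_smul, map_add, map_add, map_smul, map_smul, hK, hL, h]
    refine ⟨χ, ModelSpinor.of_herm_word hε ?_ ?_ (fun a => ?_) (fun x y => ?_)
      fun w hw hlen => ?_⟩
    · refine Or.inr (Or.inr (Or.inr ?_))
      rw [twMul_eq, ← hν, ← hs, hχ, map_smul, map_add, map_smul, hνν, smul_comm s t]
      congr 1
      rw [smul_add, smul_smul s, hss, one_smul, add_comm (ν φ), ← Complex.coe_smul, ← hs2, smul_smul]
      congr 2
      linear_combination s * hss
    · have h1 := hherm [] (by simp) (by simp)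
      simpa [word, unit] using h1
    · exact hsymm (E (e (fst r a))) (Complex.I • ε a • E (e (snd r a))) (fun ψ => hνE _ ψ)
        (fun ψ => by
          simp only [LinearMap.smul_apply, map_smul, LinearMap.map_smul_of_tower]
          rw [E, hνE]) (sub_eq_zero.mp (hφ a))
    · exact hsymm (F x * F y) (E (inU m y) * E (inU m x)) (fun ψ => by
          change F x (F y (ν ψ)) = ν (F x (F y ψ))
          rw [hνF, hνF, map_neg, neg_neg])
        (fun ψ => by
          change E _ (E _ (ν ψ)) = ν (E _ (E _ ψ))
          rw [E, E, hνE, hνE]) (hFF x y)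
    · rw [hherm w (by rcases hlen with h | h <;> rw [h] <;> decide) (by omega), hwφ w hw hlen]

end Existence

/-! ### Adapted frames -/

section Dimension

variable {T : Type*} [NormedAddCommGroup T] [InnerProductSpace ℝ T] {D : Submodule ℝ T}

/-- det(J)² = (-1)^{dim D} cannot be negative. -/
theorem even_finrank_of_sq {J : D →ₗ[ℝ] D} (hJ : ∀ u, J (J u) = -u) :
    Even (Module.finrank ℝ D) := by
  have h1 : J ∘ₗ J = (-1 : ℝ) • LinearMap.id := by ext u; simp [hJ]
  have h2 := congrArg LinearMap.det h1
  rw [LinearMap.det_comp, LinearMap.det_smul, LinearMap.det_id, mul_one] at h2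
  by_contra h
  rw [(Nat.not_even_iff_odd.mp h).neg_one_pow] at h2
  nlinarith [mul_self_nonneg (LinearMap.det J)]

theorem exists_notMem_span_of_card_lt {k : ℕ} (w : ℕ → T) {ι : Type*} (d : ι → T)
    (hk : k < Module.finrank ℝ (Submodule.span ℝ (Set.range d))) :
    ∃ l, d l ∉ Submodule.span ℝ (Set.range fun i : Fin k => w i) := by
  by_contra! h
  have h1 : Submodule.span ℝ (Set.range d) ≤ Submodule.span ℝ (Set.range fun i : Fin k => w i) := by
    rw [Submodule.span_le]
    rintro _ ⟨l, rfl⟩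
    exact h l
  have := FiniteDimensional.span_of_finite ℝ (Set.finite_range fun i : Fin k => w i)
  have h2 := Submodule.finrank_mono h1
  have h3 := finrank_range_le_card (R := ℝ) (fun i : Fin k => w i)
  rw [Fintype.card_fin] at h3
  exact absurd (h2.trans h3) (by omega)

end Dimension

/-! ### The extension of J by zero to the orthogonal complement of D. -/

section Extension

variable {T : Type*} [NormedAddCommGroup T] [InnerProductSpace ℝ T] {D : Submodule ℝ T}
  [D.HasOrthogonalProjection] (J : D →ₗ[ℝ] D)

/-- The extension by zero to the orthogonal complement. -/
def extendByZero : T →ₗ[ℝ] T := D.subtype ∘ₗ J ∘ₗ (D.orthogonalProjectionOnto : T →ₗ[ℝ] D)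

theorem extendByZero_of_mem {v : T} (hv : v ∈ D) : extendByZero J v = J ⟨v, hv⟩ := by
  change ((J (D.orthogonalProjectionOnto v) : D) : T) = _
  rw [show D.orthogonalProjectionOnto v = ⟨v, hv⟩ from
    Submodule.orthogonalProjectionOnto_mem_subspace_eq_self (⟨v, hv⟩ : D)]

theorem extendByZero_mem (v : T) : extendByZero J v ∈ D := Subtype.mem _

theorem extendByZero_of_orth {v : T} (hv : ∀ u ∈ D, inner ℝ u v = 0) : extendByZero J v = 0 := by
  change ((J (D.orthogonalProjectionOnto v) : D) : T) = _
  rw [Submodule.orthogonalProjectionOnto_apply_of_mem_orthogonal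
    ((Submodule.mem_orthogonal D v).mpr hv), map_zero]
  rfl

variable {J}

theorem extendByZero_extendByZero (hJ : ∀ u, J (J u) = -u) {v : T} (hv : v ∈ D) :
    extendByZero J (extendByZero J v) = -v := by
  rw [extendByZero_of_mem J hv, extendByZero_of_mem J (Subtype.mem _), Subtype.coe_eta, hJ]
  rfl

theorem inner_extendByZero (hJ : ∀ u v, inner ℝ (J u : T) (J v : T) = inner ℝ (u : T) (v : T))
    {v w : T} (hv : v ∈ D) (hw : w ∈ D) :
    inner ℝ (extendByZero J v) (extendByZero J w) = inner ℝ v w := by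
  rw [extendByZero_of_mem J hv, extendByZero_of_mem J hw, hJ]

theorem inner_extendByZero_self (hJ : ∀ u, J (J u) = -u)
    (hJ' : ∀ u v, inner ℝ (J u : T) (J v : T) = inner ℝ (u : T) (v : T)) {v w : T} (hv : v ∈ D)
    (hw : w ∈ D) : inner ℝ (extendByZero J v) w = -inner ℝ v (extendByZero J w) := by
  rw [← inner_extendByZero hJ' hv (extendByZero_mem J w), extendByZero_extendByZero hJ hw,
    inner_neg_right, neg_neg]

end Extension

/-! ### Appending a vector field to a partial orthonormal frame. -/

section Update

variable {n : ℕ} {M : Type*} [TopologicalSpace M] [ChartedSpace (EuclideanSpace ℝ (Fin n)) M]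

theorem update_apply_of_lt {k i : ℕ} (hi : i < k) (w : ℕ → (x : M) → TangentSpace (𝓡 n) x)
    (u : (x : M) → TangentSpace (𝓡 n) x) (x : M) : Function.update w k u i x = w i x := by
  rw [Function.update_of_ne hi.ne]

/-- Partial frames are indexed by ℕ and only their entries below k count, so that a field is
appended by `Function.update`. -/
theorem orthonormal_update [Bundle.RiemannianBundle (fun x : M => TangentSpace (𝓡 n) x)] {x : M}
    {k : ℕ} {w : ℕ → (x : M) → TangentSpace (𝓡 n) x} {u : (x : M) → TangentSpace (𝓡 n) x}
    (h : ∀ i < k, ∀ j < k, inner ℝ (w i x) (w j x) = if i = j then (1 : ℝ) else 0)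
    (hu : inner ℝ (u x) (u x) = (1 : ℝ)) (hwu : ∀ i < k, inner ℝ (w i x) (u x) = (0 : ℝ)) :
    ∀ i < k + 1, ∀ j < k + 1, inner ℝ (Function.update w k u i x) (Function.update w k u j x) =
      if i = j then (1 : ℝ) else 0 := by
  intro i hi j hj
  rcases Nat.lt_succ_iff_lt_or_eq.mp hi with hi | rfl <;>
    rcases Nat.lt_succ_iff_lt_or_eq.mp hj with hj | rfl
  · rw [Function.update_of_ne hi.ne, Function.update_of_ne hj.ne, h i hi j hj]
  · rw [Function.update_of_ne hi.ne, Function.update_self, hwu i hi, if_neg hi.ne]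
  · rw [Function.update_of_ne hj.ne, Function.update_self, real_inner_comm, hwu j hj,
      if_neg hj.ne']
  · rw [Function.update_self, hu, if_pos rfl]

theorem smooth_update [IsManifold (𝓡 n) ∞ M] {W W' : Set M} (hWW : W' ⊆ W) {k : ℕ}
    {w : ℕ → (x : M) → TangentSpace (𝓡 n) x}
    {u : (x : M) → TangentSpace (𝓡 n) x} (hw : ∀ i < k, SmoothField W (w i))
    (hu : SmoothField W' u) : ∀ i < k + 1, SmoothField W' (Function.update w k u i) := by
  intro i hi
  rcases Nat.lt_succ_iff_lt_or_eq.mp hi with hi | rfl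
  · rw [Function.update_of_ne hi.ne]; exact (hw i hi).mono hWW
  · rw [Function.update_self]; exact hu

end Update

section Extend

variable {n : ℕ} {M : Type*} [TopologicalSpace M] [ChartedSpace (EuclideanSpace ℝ (Fin n)) M]
  [IsManifold (𝓡 n) ∞ M] [Bundle.RiemannianBundle (fun x : M => TangentSpace (𝓡 n) x)]

instance finiteDimensional_tangentSpace (x : M) : FiniteDimensional ℝ (TangentSpace (𝓡 n) x) :=
  inferInstanceAs (FiniteDimensional ℝ (EuclideanSpace ℝ (Fin n)))

namespace AlmostCRHermitian

variable {r : ℕ} (C : AlmostCRHermitian n M r)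

/-- The extension of `J` by zero to the orthogonal complement of `D`. -/
def map (x : M) : TangentSpace (𝓡 n) x →ₗ[ℝ] TangentSpace (𝓡 n) x := extendByZero (C.J x)

/-- `smooth_J` asks for a section of D on all of M, so u is replaced by zero outside W. -/
theorem smoothField_map {W : Set M} (hW : IsOpen W) {u : (x : M) → TangentSpace (𝓡 n) x}
    (hu : SmoothField W u) (hD : ∀ x ∈ W, u x ∈ C.D x) :
    SmoothField W (fun x => C.map x (u x)) := by
  classical
  let X : (x : M) → C.D x := fun x => if h : x ∈ W then ⟨u x, hD x h⟩ else 0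
  have hX : ∀ x ∈ W, (X x : TangentSpace (𝓡 n) x) = u x := fun x hx => by
    simp only [X, dif_pos hx]
  refine (C.smooth_J W X hW (hu.congr hX)).congr fun x hx => ?_
  change extendByZero (C.J x) (u x) = _
  rw [extendByZero_of_mem _ (hD x hx)]
  simp only [X, dif_pos hx]

end AlmostCRHermitian

end Extend

/-! ### Local unitary frames of D and their completion. -/

section Fields

variable {n : ℕ} {M : Type*} [TopologicalSpace M] [ChartedSpace (EuclideanSpace ℝ (Fin n)) M]
  [IsManifold (𝓡 n) ∞ M] [Bundle.RiemannianBundle (fun x : M => TangentSpace (𝓡 n) x)]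
  [IsContMDiffRiemannianBundle (𝓡 n) ∞ (EuclideanSpace ℝ (Fin n))
    (fun x : M => TangentSpace (𝓡 n) x)]

/-- One step of the Gram–Schmidt process for vector fields. -/
theorem exists_unit_field {W : Set M} (hW : IsOpen W) {x₀ : M} (hx₀ : x₀ ∈ W) {k : ℕ}
    {w : ℕ → (x : M) → TangentSpace (𝓡 n) x} (hw : ∀ i < k, SmoothField W (w i))
    (horth : ∀ x ∈ W, ∀ i < k, ∀ j < k, inner ℝ (w i x) (w j x) = if i = j then 1 else 0)
    {d : (x : M) → TangentSpace (𝓡 n) x} (hd : SmoothField W d)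
    (hd0 : d x₀ ∉ Submodule.span ℝ (Set.range fun i : Fin k => w i x₀)) :
    ∃ W' ⊆ W, IsOpen W' ∧ x₀ ∈ W' ∧ ∃ u : (x : M) → TangentSpace (𝓡 n) x, SmoothField W' u ∧
      ∀ x ∈ W', inner ℝ (u x) (u x) = (1 : ℝ) ∧ (∀ i < k, inner ℝ (w i x) (u x) = (0 : ℝ)) ∧
        ∀ D : Submodule ℝ (TangentSpace (𝓡 n) x), d x ∈ D → (∀ i < k, w i x ∈ D) → u x ∈ D := by
  let s : (x : M) → TangentSpace (𝓡 n) x := fun x =>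
    d x - ∑ i ∈ Finset.range k, (inner ℝ (w i x) (d x) : ℝ) • w i x
  have hs : SmoothField W s := hd.sub (SmoothField.sum _ fun i hi =>
    SmoothField.smul ((hw i (Finset.mem_range.mp hi)).inner hd) (hw i (Finset.mem_range.mp hi)))
  have hN : ContMDiffOn (𝓡 n) 𝓘(ℝ, ℝ) ∞ (fun x => (inner ℝ (s x) (s x) : ℝ)) W := hs.inner hs
  have hs0 : s x₀ ≠ 0 := by
    intro h
    refine hd0 ?_
    rw [sub_eq_zero.mp h]
    exact Submodule.sum_mem _ fun i hi => Submodule.smul_mem _ _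
      (Submodule.subset_span ⟨⟨i, Finset.mem_range.mp hi⟩, rfl⟩)
  have hsw : ∀ x ∈ W, ∀ i < k, inner ℝ (w i x) (s x) = (0 : ℝ) := by
    intro x hx i hi
    simp only [s, inner_sub_right, inner_sum, inner_smul_right]
    rw [Finset.sum_eq_single i]
    · rw [horth x hx i hi i hi, if_pos rfl, mul_one, sub_self]
    · intro j hj hji
      rw [horth x hx i hi j (Finset.mem_range.mp hj), if_neg (Ne.symm hji), mul_zero]
    · intro h
      exact absurd (Finset.mem_range.mpr hi) h
  refine ⟨W ∩ (fun x => (inner ℝ (s x) (s x) : ℝ)) ⁻¹' Set.Ioi 0, Set.inter_subset_left,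
    hN.continuousOn.isOpen_inter_preimage hW isOpen_Ioi,
    ⟨hx₀, real_inner_self_pos.mpr hs0⟩, fun x => (√(inner ℝ (s x) (s x)))⁻¹ • s x, ?_, ?_⟩
  · exact SmoothField.smul (contMDiffOn_inv_sqrt (hN.mono Set.inter_subset_left) fun x hx => hx.2)
      (hs.mono Set.inter_subset_left)
  · rintro x ⟨hx, hpos⟩
    refine ⟨?_, fun i hi => ?_, fun D hdD hwD => D.smul_mem _ (D.sub_mem hdD
      (D.sum_mem fun i hi => D.smul_mem _ (hwD i (Finset.mem_range.mp hi))))⟩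
    · have hpos' : (0 : ℝ) < inner ℝ (s x) (s x) := hpos
      rw [real_inner_smul_left, real_inner_smul_right, ← mul_assoc, ← mul_inv,
        Real.mul_self_sqrt hpos'.le, inv_mul_cancel₀ hpos'.ne']
    · rw [real_inner_smul_right, hsw x hx i hi, mul_zero]

namespace AlmostCRHermitian

variable {r : ℕ} (C : AlmostCRHermitian n M r)

/-- Near every point there is a smooth unitary frame of `D`. -/
theorem exists_unitary_frame {m : ℕ} (hm : 2 * m + r = n) (x₀ : M) :
    ∃ W : Set M, IsOpen W ∧ x₀ ∈ W ∧ ∃ w : ℕ → (x : M) → TangentSpace (𝓡 n) x,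
      (∀ i < 2 * m, SmoothField W (w i)) ∧ ∀ x ∈ W,
        (∀ i < 2 * m, ∀ j < 2 * m, inner ℝ (w i x) (w j x) = if i = j then (1 : ℝ) else 0) ∧
        (∀ i < 2 * m, w i x ∈ C.D x) ∧ ∀ a < m, C.map x (w (2 * a) x) = w (2 * a + 1) x := by
  obtain ⟨U, hU, hxU, d, hd, hdD⟩ := C.smooth_D x₀
  have key : ∀ k ≤ m, ∃ W ⊆ U, IsOpen W ∧ x₀ ∈ W ∧ ∃ w : ℕ → (x : M) → TangentSpace (𝓡 n) x,
      (∀ i < 2 * k, SmoothField W (w i)) ∧ ∀ x ∈ W,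
        (∀ i < 2 * k, ∀ j < 2 * k, inner ℝ (w i x) (w j x) = if i = j then (1 : ℝ) else 0) ∧
        (∀ i < 2 * k, w i x ∈ C.D x) ∧ ∀ a < k, C.map x (w (2 * a) x) = w (2 * a + 1) x := by
    intro k
    induction k with
    | zero =>
      exact fun _ => ⟨U, le_rfl, hU, hxU, fun _ _ => 0, fun i hi => by omega, fun x _ =>
        ⟨fun i hi => by omega, fun i hi => by omega, fun a ha => by omega⟩⟩
    | succ k ih =>
      intro hk
      obtain ⟨W, hWU, hW, hxW, w, hw, hwx⟩ := ih (by omega)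
      obtain ⟨l, hl⟩ := exists_notMem_span_of_card_lt (k := 2 * k) (fun i => w i x₀)
        (fun l => d l x₀) (by
          have := C.finrank_D x₀
          rw [hdD x₀ hxU]
          omega)
      obtain ⟨W', hWW, hW', hxW', u, hu, hux⟩ := exists_unit_field hW hxW hw
        (fun x hx => (hwx x hx).1) ((hd l).mono hWU) hl
      have huD : ∀ x ∈ W', u x ∈ C.D x := fun x hx => (hux x hx).2.2 _ (by
        rw [← hdD x (hWU (hWW hx))]
        exact Submodule.subset_span ⟨l, rfl⟩) (hwx x (hWW hx)).2.1
      have hJu := C.smoothField_map hW' hu huD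
      set v : (x : M) → TangentSpace (𝓡 n) x := fun x => C.map x (u x) with hv
      have hvv : ∀ x ∈ W', inner ℝ (v x) (v x) = (1 : ℝ) := fun x hx => by
        rw [← (hux x hx).1]
        exact inner_extendByZero (C.orthogonal x) (huD x hx) (huD x hx)
      have huv : ∀ x ∈ W', inner ℝ (u x) (v x) = (0 : ℝ) := fun x hx => by
        have h1 := inner_extendByZero_self (C.J_J x) (C.orthogonal x) (huD x hx) (huD x hx)
        have h2 := real_inner_comm (u x) (v x)
        change inner ℝ (v x) (u x) = -inner ℝ (u x) (v x) at h1
        linarith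
      -- Up to sign each earlier vector is J of its partner, and J preserves the orthogonality of
      -- that partner to u.
      have hwv : ∀ x ∈ W', ∀ i < 2 * k, inner ℝ (w i x) (v x) = (0 : ℝ) := by
        intro x hx i hi
        obtain ⟨h1, h2, h3⟩ := hwx x (hWW hx)
        have h4 : ∀ j < 2 * k, ∀ y, C.map x (w j x) = y → y ∈ C.D x →
            inner ℝ y (v x) = (0 : ℝ) := fun j hj y hy hyD => by
          rw [← hy, ← (hux x hx).2.1 j hj]
          exact inner_extendByZero (C.orthogonal x) (h2 j hj) (huD x hx)
        rcases Nat.even_or_odd' i with ⟨b, rfl | rfl⟩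
        · have h5 := h4 (2 * b + 1) (by omega) (-w (2 * b) x) (by
            rw [← h3 b (by omega)]
            exact extendByZero_extendByZero (C.J_J x) (h2 _ hi)) (neg_mem (h2 _ hi))
          rw [inner_neg_left] at h5
          linarith
        · exact h4 (2 * b) (by omega) _ (h3 b (by omega)) (h2 _ hi)
      refine ⟨W', hWW.trans hWU, hW', hxW',
        Function.update (Function.update w (2 * k) u) (2 * k + 1) v,
        smooth_update le_rfl (smooth_update hWW hw hu) hJu, fun x hx => ?_⟩
      obtain ⟨h1, h2, h3⟩ := hwx x (hWW hx)
      refine ⟨orthonormal_update (orthonormal_update h1 (hux x hx).1 (hux x hx).2.1) (hvv x hx)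
        fun i hi => ?_, fun i hi => ?_, fun a ha => ?_⟩
      · rcases Nat.lt_succ_iff_lt_or_eq.mp (show i < 2 * k + 1 from hi) with hi | rfl
        · rw [update_apply_of_lt hi]; exact hwv x hx i hi
        · rw [Function.update_self]; exact huv x hx
      · rcases Nat.lt_succ_iff_lt_or_eq.mp (show i < 2 * k + 1 + 1 by omega) with hi | rfl
        · rw [update_apply_of_lt hi]
          rcases Nat.lt_succ_iff_lt_or_eq.mp hi with hi | rfl
          · rw [update_apply_of_lt hi]; exact h2 i hi
          · rw [Function.update_self]; exact huD x hx
        · rw [Function.update_self]; exact extendByZero_mem _ _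
      · rcases Nat.lt_succ_iff_lt_or_eq.mp ha with ha | rfl
        · rw [update_apply_of_lt (by omega), update_apply_of_lt (by omega),
            update_apply_of_lt (by omega), update_apply_of_lt (by omega)]
          exact h3 a ha
        · rw [Function.update_self, update_apply_of_lt (by omega), Function.update_self]
  obtain ⟨W, -, hW, hxW, w, h⟩ := key m le_rfl
  exact ⟨W, hW, hxW, w, h⟩

end AlmostCRHermitian

/-- Every smooth orthonormal system extends locally to a smooth orthonormal frame. -/
theorem exists_extend_frame (o : ManifoldOrientation n M) {k : ℕ} (hk : k ≤ n) {W : Set M}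
    (hW : IsOpen W) {x₀ : M} (hx₀ : x₀ ∈ W) {w : ℕ → (x : M) → TangentSpace (𝓡 n) x}
    (hw : ∀ i < k, SmoothField W (w i))
    (horth : ∀ x ∈ W, ∀ i < k, ∀ j < k, inner ℝ (w i x) (w j x) = if i = j then (1 : ℝ) else 0) :
    ∃ W' ⊆ W, IsOpen W' ∧ x₀ ∈ W' ∧ ∃ w' : ℕ → (x : M) → TangentSpace (𝓡 n) x,
      (∀ i < n, SmoothField W' (w' i)) ∧ (∀ x, ∀ i < k, w' i x = w i x) ∧
      ∀ x ∈ W', ∀ i < n, ∀ j < n, inner ℝ (w' i x) (w' j x) = if i = j then (1 : ℝ) else 0 := by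
  -- Only the smooth local frame provided by the orientation is used here, not its sign.
  obtain ⟨U, hU, hxU, d, hd, hb⟩ := o.locally_constant x₀
  have key : ∀ l, k + l ≤ n → ∃ W' ⊆ W ∩ U, IsOpen W' ∧ x₀ ∈ W' ∧
      ∃ w' : ℕ → (x : M) → TangentSpace (𝓡 n) x, (∀ i < k + l, SmoothField W' (w' i)) ∧
      (∀ x, ∀ i < k, w' i x = w i x) ∧ ∀ x ∈ W', ∀ i < k + l, ∀ j < k + l,
        inner ℝ (w' i x) (w' j x) = if i = j then (1 : ℝ) else 0 := by
    intro l
    induction l with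
    | zero =>
      exact fun _ => ⟨W ∩ U, le_rfl, hW.inter hU, ⟨hx₀, hxU⟩, w,
        fun i hi => (hw i hi).mono Set.inter_subset_left, fun _ _ _ => rfl,
        fun x hx => horth x hx.1⟩
    | succ l ih =>
      intro hl
      obtain ⟨W', hWW, hW', hxW', w', hw', heq, horth'⟩ := ih (by omega)
      obtain ⟨p, hp⟩ := exists_notMem_span_of_card_lt (k := k + l) (fun i => w' i x₀)
        (fun p => d p x₀) (by
          obtain ⟨b, hb, -⟩ := hb x₀ hxU
          have h1 : (fun p => d p x₀) = b := funext fun p => (hb p).symm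
          rw [h1, b.span_eq, finrank_top, Module.finrank_eq_card_basis b, Fintype.card_fin]
          omega)
      obtain ⟨W₂, hWW₂, hW₂, hxW₂, u, hu, hux⟩ := exists_unit_field hW' hxW' hw' horth'
        ((hd p).mono (hWW.trans Set.inter_subset_right)) hp
      refine ⟨W₂, hWW₂.trans hWW, hW₂, hxW₂, Function.update w' (k + l) u,
        smooth_update hWW₂ hw' hu, fun x i hi => ?_, fun x hx =>
        orthonormal_update (horth' x (hWW₂ hx)) (hux x hx).1 (hux x hx).2.1⟩
      rw [update_apply_of_lt (by omega), heq x i hi]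
  obtain ⟨W', hWW, hW', hxW', w', hw', h⟩ := key (n - k) (by omega)
  have : k + (n - k) = n := by omega
  rw [this] at hw' h
  exact ⟨W', hWW.trans Set.inter_subset_left, hW', hxW', w', hw', h⟩

end Fields

/-! ### Oriented orthonormal frames and the action of SO(n) on them. -/

section FrameAlgebra

variable {n : ℕ} {T : Type*} [NormedAddCommGroup T] [InnerProductSpace ℝ T]

theorem exists_orthonormalBasis (hT : Module.finrank ℝ T = n) [FiniteDimensional ℝ T]
    {w : Fin n → T} (hw : ∀ i j, inner ℝ (w i) (w j) = if i = j then (1 : ℝ) else 0) :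
    ∃ f : OrthonormalBasis (Fin n) ℝ T, ∀ i, f i = w i := by
  have hon : Orthonormal ℝ w := orthonormal_iff_ite.mpr hw
  refine ⟨OrthonormalBasis.mk hon ?_, fun i => by rw [OrthonormalBasis.coe_mk]⟩
  rw [hon.linearIndependent.span_eq_top_of_card_eq_finrank' (by rw [Fintype.card_fin, hT])]

theorem toBasis_det_eq (f : OrthonormalBasis (Fin n) ℝ T) (b : Fin n → T) :
    f.toBasis.det b = (Matrix.of fun i j => (inner ℝ (f i) (b j) : ℝ)).det := by
  rw [Module.Basis.det_apply]
  congr 1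
  ext i j
  rw [Module.Basis.toMatrix_apply, OrthonormalBasis.coe_toBasis_repr_apply,
    OrthonormalBasis.repr_apply_apply, Matrix.of_apply]

theorem frameMap_eq {f : OrthonormalBasis (Fin n) ℝ T} {A : Matrix (Fin n) (Fin n) ℝ}
    {L : T →ₗ[ℝ] T}
    (h : ∀ i, comb f (A *ᵥ e i) = L (f i)) : frameMap f A = L := by
  refine f.toBasis.ext fun i => ?_
  rw [OrthonormalBasis.coe_toBasis, frameMap_apply, ← h]
  rw [← comb_single f i, coords_comb]

theorem frameMap_injective (f : OrthonormalBasis (Fin n) ℝ T) {A B : Matrix (Fin n) (Fin n) ℝ}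
    (h : frameMap f A = frameMap f B) : A = B := by
  refine Matrix.ext_of_mulVec_single fun i => comb_injective f ?_
  have h1 := LinearMap.congr_fun h (f i)
  rwa [frameMap_apply, frameMap_apply, ← comb_single f i, coords_comb] at h1

end FrameAlgebra

theorem exists_orthonormalBasis_tangentSpace {n : ℕ} {M : Type*} [TopologicalSpace M]
    [ChartedSpace (EuclideanSpace ℝ (Fin n)) M]
    [Bundle.RiemannianBundle (fun x : M => TangentSpace (𝓡 n) x)] (x : M)
    {w : Fin n → TangentSpace (𝓡 n) x}
    (hw : ∀ i j, inner ℝ (w i) (w j) = if i = j then (1 : ℝ) else 0) :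
    ∃ f : OrthonormalBasis (Fin n) ℝ (TangentSpace (𝓡 n) x), ∀ i, f i = w i := by
  have h : Module.finrank ℝ (TangentSpace (𝓡 n) x) = n :=
    finrank_euclideanSpace_fin (𝕜 := ℝ) (n := n)
  exact exists_orthonormalBasis (T := TangentSpace (𝓡 n) x) h hw

section Frame

variable {n : ℕ} {M : Type*} [TopologicalSpace M] [ChartedSpace (EuclideanSpace ℝ (Fin n)) M]
  [IsManifold (𝓡 n) ∞ M] [Bundle.RiemannianBundle (fun x : M => TangentSpace (𝓡 n) x)]
  {o : ManifoldOrientation n M} {x : M}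

/-- The matrix that relates two oriented orthonormal frames. -/
def Frame.trans (f f' : Frame o x) : SO n :=
  ⟨f.1.toBasis.toMatrix f'.1, Matrix.mem_specialOrthogonalGroup_iff.mpr
    ⟨f.1.toMatrix_orthonormalBasis_mem_orthogonal f'.1,
      f.1.det_to_matrix_orthonormalBasis_of_same_orientation f'.1 (f.2.trans f'.2.symm)⟩⟩

theorem Frame.trans_apply (f f' : Frame o x) (i j : Fin n) :
    (f.trans f').1 i j = inner ℝ (f.1 i) (f'.1 j) := by
  change f.1.toBasis.toMatrix f'.1 i j = _
  rw [Module.Basis.toMatrix_apply, OrthonormalBasis.coe_toBasis_repr_apply,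
    OrthonormalBasis.repr_apply_apply]

theorem Frame.trans_spec (f f' : Frame o x) (j : Fin n) :
    f'.1 j = ∑ i, (f.trans f').1 i j • f.1 i := by
  simp only [Frame.trans_apply]
  exact (comb_coords f.1 (f'.1 j)).symm

theorem Frame.ext_of_apply {f f' : Frame o x} (h : ∀ i, f.1 i = f'.1 i) : f = f' :=
  Subtype.ext (DFunLike.ext _ _ h)

theorem Frame.trans_eq {f f' : Frame o x} {A : SO n} (h : ∀ j, f'.1 j = ∑ i, A.1 i j • f.1 i) :
    f.trans f' = A := by
  refine Subtype.ext (Matrix.ext fun i j => ?_)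
  rw [Frame.trans_apply, h]
  exact congrFun (coords_comb f.1 fun i => A.1 i j) i

theorem Frame.exists_act (f : Frame o x) (A : SO n) :
    ∃ f' : Frame o x, ∀ j, f'.1 j = ∑ i, A.1 i j • f.1 i := by
  obtain ⟨f', hf'⟩ := exists_orthonormalBasis_tangentSpace x
    (w := fun j => comb f.1 (A.1 *ᵥ e j)) (fun i j => by
      rw [inner_comb, SO_mulVec_dot, e_dot])
  have hj : ∀ j, f' j = ∑ i, A.1 i j • f.1 i := fun j => by
    rw [hf', comb_apply]
    exact Finset.sum_congr rfl fun i _ => by rw [Matrix.mulVec_single_one, Matrix.col_apply]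
  refine ⟨⟨f', ?_⟩, hj⟩
  rw [← f.2, eq_comm, Module.Basis.orientation_eq_iff_det_pos, toBasis_det_eq]
  have h1 : (Matrix.of fun i j => (inner ℝ (f.1 i) (f'.toBasis j) : ℝ)) = A.1 := by
    ext i j
    rw [Matrix.of_apply, OrthonormalBasis.coe_toBasis, hj]
    exact congrFun (coords_comb f.1 fun i => A.1 i j) i
  rw [h1, (Matrix.mem_specialOrthogonalGroup_iff.mp A.2).2]
  exact one_pos

/-- The right action of `SO(n)` on frames. -/
def Frame.act (f : Frame o x) (A : SO n) : Frame o x := Classical.choose (f.exists_act A)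

theorem Frame.act_apply (f : Frame o x) (A : SO n) (j : Fin n) :
    (f.act A).1 j = ∑ i, A.1 i j • f.1 i := Classical.choose_spec (f.exists_act A) j

theorem Frame.act_trans (f f' : Frame o x) : f.act (f.trans f') = f' :=
  Frame.ext_of_apply fun j => by rw [Frame.act_apply, ← Frame.trans_spec]

theorem Frame.act_act (f : Frame o x) (A B : SO n) : (f.act A).act B = f.act (A * B) :=
  Frame.ext_of_apply fun j => by
    simp only [Frame.act_apply, Finset.smul_sum, smul_smul]
    rw [Finset.sum_comm]
    refine Finset.sum_congr rfl fun i _ => ?_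
    change _ = (∑ k, A.1 i k * B.1 k j) • f.1 i
    rw [Finset.sum_smul]
    exact Finset.sum_congr rfl fun k _ => by rw [mul_comm]

end Frame

/-! ### The standard model spinors -/

section Standard

variable {m r : ℕ}

/-- The signs of the two standard complex structures: the last one can be negative. -/
def stdSign (m : ℕ) (σ : Bool) (a : Fin m) : ℝ := if σ = false ∧ a.val + 1 = m then -1 else 1

theorem stdSign_mul_self (σ : Bool) (a : Fin m) : stdSign m σ a * stdSign m σ a = 1 := by
  rw [stdSign]; split_ifs <;> norm_num

/-- A model spinor for each of the two standard complex structures. -/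
def stdSpinor (m r : ℕ) (σ : Bool) : TwistedSpinor r (2 * m + r) :=
  Classical.choose (exists_modelSpinor r (stdSign_mul_self (m := m) σ))

theorem stdSpinor_spec (m r : ℕ) (σ : Bool) :
    ModelSpinor (stdSign m σ) (stdSpinor m r σ) :=
  Classical.choose_spec (exists_modelSpinor r (stdSign_mul_self (m := m) σ))

/-- The last index. -/
def lastIdx (hn : 0 < 2 * m + r) : Fin (2 * m + r) := ⟨2 * m + r - 1, by omega⟩

theorem fst_ne_last (hn : 0 < 2 * m + r) (a : Fin m) : fst r a ≠ lastIdx hn := by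
  intro h
  have := congrArg Fin.val h
  simp only [fst, lastIdx] at this
  omega

/-- The two standard complex structures are conjugate by the reflection of the last vector. -/
theorem reflMat_conj_stdSpinor (hm : 0 < 2 * m + 0) :
    reflMat (e (lastIdx hm)) * cxMat (stdSpinor m 0 true) * reflMat (e (lastIdx hm)) =
      cxMat (stdSpinor m 0 false) := by
  set l := lastIdx hm with hl
  have hfix : ∀ i, i ≠ l → reflMat (e l) *ᵥ e i = e i := fun i hi =>
    reflMat_mulVec_of_orth (e_dot_ne hi.symm)
  have hlast : reflMat (e l) *ᵥ e l = -e l := by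
    rw [reflMat_mulVec, e_dot_self]; module
  have hfst : ∀ a : Fin m, reflMat (e l) *ᵥ e (fst 0 a) = e (fst 0 a) := fun a =>
    hfix _ (fst_ne_last hm a)
  have hsnd : ∀ a : Fin m, reflMat (e l) *ᵥ e (snd 0 a) = stdSign m false a • e (snd 0 a) := by
    intro a
    by_cases ha : a.val + 1 = m
    · have : snd 0 a = l := Fin.ext (by simp only [snd, hl, lastIdx]; omega)
      rw [this, hlast, stdSign, if_pos ⟨rfl, ha⟩, neg_one_smul]
    · rw [hfix, stdSign, if_neg (fun h => ha h.2), one_smul]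
      intro h
      have := congrArg Fin.val h
      simp only [snd, hl, lastIdx] at this
      omega
  have htrue : ∀ a : Fin m, stdSign m true a = 1 := fun a => by simp [stdSign]
  refine Matrix.ext_of_mulVec_single fun i => ?_
  rw [mul_assoc, ← Matrix.mulVec_mulVec, ← Matrix.mulVec_mulVec]
  rcases index_cases i with ⟨a, rfl⟩ | ⟨a, rfl⟩ | ⟨k, -⟩
  · rw [hfst, (stdSpinor_spec m 0 true).cxMat_fst, (stdSpinor_spec m 0 false).cxMat_fst, htrue,
      one_smul, hsnd]
  · rw [hsnd, Matrix.mulVec_smul, (stdSpinor_spec m 0 true).cxMat_snd,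
      (stdSpinor_spec m 0 false).cxMat_snd, htrue, one_smul, Matrix.mulVec_smul, Matrix.mulVec_neg,
      hfst, smul_neg]
  · exact k.elim0

/-- Otherwise A composed with the reflection of the last vector would commute with the complex
structure although its determinant is -1, against `ModelSpinor.det_eq_one`. -/
theorem not_conj_stdSpinor (hm : 0 < 2 * m + 0) (A : SO (2 * m + 0)) :
    A.1 * cxMat (stdSpinor m 0 false) * A.1ᵀ ≠ cxMat (stdSpinor m 0 true) := by
  intro h
  set R := reflMat (e (lastIdx hm)) with hR
  set J := cxMat (stdSpinor m 0 true) with hJ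
  rw [← reflMat_conj_stdSpinor hm, ← hR, ← hJ] at h
  have hRR : R * R = 1 := reflMat_mul_self (e_dot_self _)
  have hRT : Rᵀ = R := by
    ext i j
    simp [hR, reflMat, Matrix.vecMulVec_apply, Matrix.one_apply, eq_comm, mul_comm]
  have h1 := (stdSpinor_spec m 0 true).det_eq_one (A := A.1 * R) (by
      rw [Matrix.transpose_mul, mul_assoc, ← mul_assoc _ A.1, SO_transpose_mul, one_mul, hRT, hRR])
    (by
      rw [← hJ]
      nth_rewrite 2 [← h]
      have h2 : ∀ X Y Z W : Matrix (Fin (2 * m + 0)) (Fin (2 * m + 0)) ℝ,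
          X * (R * Y * R) * Z * (W * R) = X * R * (Y * (R * (Z * W) * R)) := fun X Y Z W => by
        simp only [mul_assoc]
      rw [h2, SO_transpose_mul, mul_one, hRR, mul_one])
  rw [Matrix.det_mul, reflMat_det (e_dot_self _), (Matrix.mem_specialOrthogonalGroup_iff.mp A.2).2]
    at h1
  norm_num at h1

variable {M : Type*} [TopologicalSpace M] [ChartedSpace (EuclideanSpace ℝ (Fin (2 * m + r))) M]
  [IsManifold (𝓡 (2 * m + r)) ∞ M]
  [Bundle.RiemannianBundle (fun x : M => TangentSpace (𝓡 (2 * m + r)) x)]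

/-- A frame is adapted to an almost CR hermitian structure if `J` has a standard form in it. -/
def AlmostCRHermitian.IsAdapted (C : AlmostCRHermitian (2 * m + r) M r) (σ : Bool) {x : M}
    (f : OrthonormalBasis (Fin (2 * m + r)) ℝ (TangentSpace (𝓡 (2 * m + r)) x)) : Prop :=
  -- For r > 0 both signs could occur at the same point; admitting only one of them keeps σ unique.
  frameMap f (cxMat (stdSpinor m r σ)) = C.map x ∧ (r ≠ 0 → σ = true)

/-- Two types at one point would make the two standard structures conjugate under `SO`. Thus a
choice of adapted frames made point by point still has a locally constant σ. -/
theorem AlmostCRHermitian.IsAdapted.type_unique {C : AlmostCRHermitian (2 * m + r) M r}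
    (hn : 0 < 2 * m + r) {o : ManifoldOrientation (2 * m + r) M} {σ σ' : Bool} {x : M}
    {f f' : Frame o x} (h : C.IsAdapted σ f.1) (h' : C.IsAdapted σ' f'.1) : σ = σ' := by
  have key : ∀ f f' : Frame o x, C.IsAdapted true f.1 → ¬ C.IsAdapted false f'.1 := by
    rintro f f' ⟨h1, -⟩ ⟨h2, h3⟩
    obtain rfl : r = 0 := by
      by_contra hr
      exact Bool.false_ne_true (h3 hr)
    rw [frameMap_of_mul (f.trans_spec f'), ← h1] at h2
    exact not_conj_stdSpinor hn _ (frameMap_injective _ h2)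
  cases σ <;> cases σ'
  · rfl
  · exact absurd h (key _ _ h')
  · exact absurd h' (key _ _ h)
  · rfl

theorem AlmostCRHermitian.IsAdapted.trans_commute {C : AlmostCRHermitian (2 * m + r) M r}
    {o : ManifoldOrientation (2 * m + r) M} {σ : Bool} {x : M} {f f' : Frame o x}
    (h : C.IsAdapted σ f.1) (h' : C.IsAdapted σ f'.1) :
    (f.trans f').1 * cxMat (stdSpinor m r σ) = cxMat (stdSpinor m r σ) * (f.trans f').1 := by
  have h1 := h'.1
  rw [frameMap_of_mul (f.trans_spec f'), ← h.1] at h1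
  nth_rewrite 2 [← frameMap_injective _ h1]
  rw [mul_assoc, SO_transpose_mul, mul_one]

variable [IsContMDiffRiemannianBundle (𝓡 (2 * m + r)) ∞ (EuclideanSpace ℝ (Fin (2 * m + r)))
    (fun x : M => TangentSpace (𝓡 (2 * m + r)) x)]

/-- Smooth oriented adapted frames exist locally. -/
theorem AlmostCRHermitian.exists_adapted_frame (C : AlmostCRHermitian (2 * m + r) M r)
    (hn : 0 < 2 * m + r) (o : ManifoldOrientation (2 * m + r) M) (x₀ : M) :
    ∃ (σ : Bool) (W : Set M), IsOpen W ∧ x₀ ∈ W ∧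
      ∃ w : Fin (2 * m + r) → (x : M) → TangentSpace (𝓡 (2 * m + r)) x,
        (∀ i, SmoothField W (w i)) ∧
        ∀ x ∈ W, ∃ f : Frame o x, (∀ i, f.1 i = w i x) ∧ C.IsAdapted σ f.1 := by
  obtain ⟨W₁, hW₁, hxW₁, w₁, hw₁, hwx₁⟩ := C.exists_unitary_frame rfl x₀
  obtain ⟨W, hWW, hW, hxW, w, hw, heq, horth⟩ := exists_extend_frame o (by omega) hW₁ hxW₁ hw₁
    (fun x hx => (hwx₁ x hx).1)
  obtain ⟨U, hU, hxU, d, hd, hb⟩ := o.locally_constant x₀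
  set l := lastIdx hn with hl
  -- The last vector is multiplied by s = ±1. The sign is chosen at x₀ so that the determinant `G s`
  -- against the positive frame `d` is positive there, and it remains so nearby.
  let S : ℝ → Fin (2 * m + r) → ℝ := fun s i => if i = l then s else 1
  let v : ℝ → Fin (2 * m + r) → (x : M) → TangentSpace (𝓡 (2 * m + r)) x :=
    fun s i x => S s i • w i x
  have hvsm : ∀ s i, SmoothField W (v s i) := fun s i =>
    SmoothField.smul contMDiffOn_const (hw i i.isLt)
  have hSS : ∀ s, s * s = 1 → ∀ i, S s i * S s i = 1 := fun s hs i => by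
    simp only [S]; split_ifs <;> simp [hs]
  have hbasis : ∀ s, s * s = 1 → ∀ x ∈ W,
      ∃ f : OrthonormalBasis (Fin (2 * m + r)) ℝ (TangentSpace (𝓡 (2 * m + r)) x),
        ∀ i, f i = v s i x := fun s hs x hx =>
    exists_orthonormalBasis_tangentSpace x fun i j => by
      simp only [v, real_inner_smul_left, real_inner_smul_right]
      rw [horth x hx i i.isLt j j.isLt]
      by_cases hij : i = j
      · subst hij; simp [hSS s hs]
      · simp [hij, Fin.val_inj]
  let G : ℝ → M → ℝ := fun s x =>
    (Matrix.of fun i j => (inner ℝ (v s i x) (d j x) : ℝ)).det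
  have hG : ∀ s x, G s x = s * G 1 x := by
    intro s x
    have h1 : (Matrix.of fun i j => (inner ℝ (v s i x) (d j x) : ℝ)) =
        Matrix.diagonal (S s) * Matrix.of fun i j => (inner ℝ (v 1 i x) (d j x) : ℝ) := by
      ext i j
      rw [Matrix.diagonal_mul, Matrix.of_apply, Matrix.of_apply]
      simp only [v, S, real_inner_smul_left]
      split_ifs <;> simp
    simp only [G]
    rw [h1, Matrix.det_mul, Matrix.det_diagonal]
    simp [S]
  have hGc : ∀ s, ContinuousOn (G s) (W ∩ U) := fun s => by
    have h1 : ContinuousOn (fun x => Matrix.of fun i j => (inner ℝ (v s i x) (d j x) : ℝ)) (W ∩ U) :=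
      continuousOn_pi.mpr fun i => continuousOn_pi.mpr fun j =>
        (((hvsm s i).mono Set.inter_subset_left).inner
          ((hd j).mono Set.inter_subset_right)).continuousOn
    exact (Continuous.matrix_det continuous_id).comp_continuousOn h1
  have hG0 : G 1 x₀ ≠ 0 := by
    obtain ⟨f, hf⟩ := hbasis 1 (one_mul 1) x₀ hxW
    obtain ⟨b, hb, -⟩ := hb x₀ hxU
    have h1 := (f.toBasis.isUnit_det b).ne_zero
    rw [toBasis_det_eq] at h1
    simpa only [hf, hb] using h1
  obtain ⟨s, hs, hspos⟩ : ∃ s : ℝ, s * s = 1 ∧ 0 < G s x₀ := by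
    rcases lt_or_gt_of_ne hG0 with h | h
    · exact ⟨-1, by norm_num, by rw [hG]; linarith⟩
    · exact ⟨1, by norm_num, h⟩
  -- The last vector belongs to D only if r = 0, and only then does its reversal change the matrix
  -- of J.
  obtain ⟨σ, hσr, hσ⟩ : ∃ σ : Bool, (r ≠ 0 → σ = true) ∧
      ∀ a : Fin m, stdSign m σ a = S s (snd r a) := by
    have hlast : ∀ a : Fin m, snd r a = l ↔ r = 0 ∧ a.val + 1 = m := fun a => by
      rw [Fin.ext_iff]
      simp only [snd, hl, lastIdx]
      omega
    rcases mul_self_eq_one_iff.mp hs with rfl | rfl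
    · exact ⟨true, fun _ => rfl, fun a => by simp [stdSign, S]⟩
    · by_cases hr : r = 0
      · exact ⟨false, fun h => absurd hr h, fun a => by simp [stdSign, S, hlast, hr]⟩
      · exact ⟨true, fun _ => rfl, fun a => by simp [stdSign, S, hlast, hr]⟩
  refine ⟨σ, (W ∩ U) ∩ G s ⁻¹' Set.Ioi 0, (hGc s).isOpen_inter_preimage (hW.inter hU) isOpen_Ioi,
    ⟨⟨hxW, hxU⟩, hspos⟩, v s, fun i => (hvsm s i).mono fun x hx => hx.1.1, ?_⟩
  rintro x ⟨⟨hxW', hxU'⟩, hpos⟩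
  obtain ⟨f, hf⟩ := hbasis s hs x hxW'
  obtain ⟨b, hb, hbo⟩ := hb x hxU'
  have hfo : f.toBasis.orientation = o.orient x := by
    rw [← hbo, Module.Basis.orientation_eq_iff_det_pos, toBasis_det_eq]
    simp only [hf, hb]
    exact hpos
  refine ⟨⟨f, hfo⟩, hf, frameMap_eq fun i => ?_, hσr⟩
  change comb f _ = C.map x (f i)
  obtain ⟨h1, h2, h3⟩ := hwx₁ x (hWW hxW')
  have hpair : ∀ a : Fin m, C.map x (f (fst r a)) = stdSign m σ a • f (snd r a) := by
    intro a
    have h4 : S s (fst r a) = 1 := if_neg (fst_ne_last hn a)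
    rw [hf, hf]
    simp only [v]
    rw [h4, one_smul, hσ, smul_smul, hSS s hs, one_smul]
    change C.map x (w (2 * a.val) x) = w (2 * a.val + 1) x
    rw [heq x _ (by omega), heq x _ (by omega), h3 a a.isLt]
  have hmemD : ∀ i : Fin (2 * m + r), i.val < 2 * m → f i ∈ C.D x := by
    intro i hi
    rw [hf]
    simp only [v]
    rw [heq x i hi]
    exact Submodule.smul_mem _ _ (h2 i hi)
  rcases index_cases i with ⟨a, rfl⟩ | ⟨a, rfl⟩ | ⟨k, rfl⟩
  · rw [(stdSpinor_spec m r σ).cxMat_fst, map_smul, comb_single, hpair]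
  · have h5 : C.map x (C.map x (f (fst r a))) = -f (fst r a) :=
      extendByZero_extendByZero (C.J_J x) (hmemD _ (by simp only [fst]; omega))
    rw [hpair, map_smul] at h5
    have h6 := congrArg (fun y => stdSign m σ a • y) h5
    simp only [smul_smul, stdSign_mul_self, one_smul, smul_neg] at h6
    rw [(stdSpinor_spec m r σ).cxMat_snd, map_neg, map_smul, comb_single, h6]
  · rw [(stdSpinor_spec m r σ).cxMat_natAdd, map_zero]
    refine (extendByZero_of_orth _ fun u hu => ?_).symm
    have hspan : Submodule.span ℝ (Set.range fun i : Fin (2 * m) => f (Fin.castAdd r i)) =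
        C.D x := by
      refine Submodule.eq_of_le_of_finrank_eq ?_ ?_
      · rw [Submodule.span_le]
        rintro _ ⟨i, rfl⟩
        exact hmemD _ i.isLt
      · have hli : LinearIndependent ℝ fun i : Fin (2 * m) => f (Fin.castAdd r i) :=
          f.orthonormal.linearIndependent.comp _ (Fin.castAdd_injective _ _)
        rw [finrank_span_eq_card hli, Fintype.card_fin]
        have := C.finrank_D x
        omega
    rw [← hspan] at hu
    refine Submodule.span_induction (p := fun u _ => inner ℝ u (f (Fin.natAdd (2 * m) k)) = (0 : ℝ))
      ?_ (inner_zero_left _) (fun y z _ _ hy hz => by rw [inner_add_left, hy, hz, add_zero])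
      (fun c y _ hy => by rw [real_inner_smul_left, hy, mul_zero]) hu
    rintro _ ⟨i, rfl⟩
    change inner ℝ (f _) (f _) = (0 : ℝ)
    rw [OrthonormalBasis.inner_eq_ite, if_neg]
    intro h
    have := congrArg Fin.val h
    simp only [Fin.val_castAdd, Fin.val_natAdd] at this
    omega

end Standard

/-! ### Stabilizers of the standard model spinors in the twisted spin group -/

section Stabilizer

variable {m r : ℕ}

/-- The elements of the twisted spin group that fix the standard model spinor, and for which the
actions on the last summand of `ℝ²ᵐ⁺ʳ` and on the twisting space `ℝʳ` agree. -/
def stabilizer (m r : ℕ) (σ : Bool) : Subgroup (SpinCR (2 * m + r) r) where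
  carrier := {g | repCR _ r g *ᵥ stdSpinor m r σ = stdSpinor m r σ ∧
    ∀ v, (coverCR _ r g).1.1 *ᵥ inU m v = inU m ((coverCR _ r g).2.1.1 *ᵥ v)}
  mul_mem' := by
    rintro g h ⟨h1, h2⟩ ⟨h3, h4⟩
    refine ⟨by rw [map_mul, ← Matrix.mulVec_mulVec, h3, h1], fun v => ?_⟩
    rw [map_mul]
    change ((coverCR _ r g).1.1 * (coverCR _ r h).1.1) *ᵥ inU m v =
      inU m (((coverCR _ r g).2.1.1 * (coverCR _ r h).2.1.1) *ᵥ v)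
    rw [← Matrix.mulVec_mulVec, h4, h2, Matrix.mulVec_mulVec]
  one_mem' := ⟨by rw [map_one, Matrix.one_mulVec], fun v => by
    rw [map_one]
    change (1 : Matrix _ _ ℝ) *ᵥ inU m v = inU m ((1 : Matrix _ _ ℝ) *ᵥ v)
    rw [Matrix.one_mulVec, Matrix.one_mulVec]⟩
  inv_mem' := by
    rintro g ⟨h1, h2⟩
    have hinv : ∀ {k : ℕ} (A : SO k) (x : Fin k → ℝ), A⁻¹.1 *ᵥ (A.1 *ᵥ x) = x := fun A x => by
      rw [Matrix.mulVec_mulVec, SO_inv_val, SO_transpose_mul, Matrix.one_mulVec]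
    have hinv' : ∀ {k : ℕ} (A : SO k) (x : Fin k → ℝ), A.1 *ᵥ (A⁻¹.1 *ᵥ x) = x := fun A x => by
      rw [Matrix.mulVec_mulVec, SO_inv_val, SO_mul_transpose, Matrix.one_mulVec]
    refine ⟨?_, fun v => ?_⟩
    · nth_rewrite 1 [← h1]
      rw [Matrix.mulVec_mulVec, ← map_mul, inv_mul_cancel, map_one, Matrix.one_mulVec]
    · rw [map_inv]
      change (coverCR _ r g).1⁻¹.1 *ᵥ inU m v = inU m ((coverCR _ r g).2.1⁻¹.1 *ᵥ v)
      conv_lhs => rw [← hinv' (coverCR _ r g).2.1 v]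
      rw [← h2, hinv]

/-- The second condition in `stabilizer` recovers the SO(r) component from the action on U; then
`mk_eq_mk_of_spinAct` applies. -/
theorem stabilizer_ext {σ : Bool} {g h : SpinCR (2 * m + r) r} (hg : g ∈ stabilizer m r σ)
    (hh : h ∈ stabilizer m r σ) (hgh : (coverCR _ r g).1 = (coverCR _ r h).1) : g = h := by
  obtain ⟨u, rfl⟩ := QuotientGroup.mk_surjective g
  obtain ⟨v, rfl⟩ := QuotientGroup.mk_surjective h
  obtain ⟨h1, h2⟩ := hg
  obtain ⟨h3, h4⟩ := hh
  rw [repCR_mk] at h1 h3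
  refine mk_eq_mk_of_spinAct (stdSpinor_spec m r σ).pure.unit h1 h3 hgh ?_
  refine Subtype.ext (Matrix.ext_of_mulVec_single fun i => inU_injective (m := m) ?_)
  have h5 := h2 (e i)
  have h6 := h4 (e i)
  rw [hgh] at h5
  exact h5.symm.trans h6

theorem exists_mem_stabilizer {σ : Bool} {A : SO (2 * m + r)}
    (hA : A.1 * cxMat (stdSpinor m r σ) = cxMat (stdSpinor m r σ) * A.1) :
    ∃ g ∈ stabilizer m r σ, (coverCR _ r g).1 = A := by
  obtain ⟨u, h1, h2, h3⟩ := (stdSpinor_spec m r σ).exists_lift A hA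
  refine ⟨QuotientGroup.mk u, ⟨by rw [repCR_mk, h2], fun v => ?_⟩, by rw [coverCR_mk]; exact h1⟩
  rw [coverCR_mk]
  change (spinCover _ u.1).1 *ᵥ _ = _
  rw [h1, h3]

end Stabilizer

/-! ### Smoothness of maps to the twisted spin group. -/

section Smooth

variable {n : ℕ} {M : Type*} [TopologicalSpace M] [ChartedSpace (EuclideanSpace ℝ (Fin n)) M]

theorem contMDiffOn_mul_complex {f g : M → ℂ} {U : Set M}
    (hf : ContMDiffOn (𝓡 n) 𝓘(ℝ, ℂ) ∞ f U) (hg : ContMDiffOn (𝓡 n) 𝓘(ℝ, ℂ) ∞ g U) :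
    ContMDiffOn (𝓡 n) 𝓘(ℝ, ℂ) ∞ (fun x => f x * g x) U :=
  (contDiff_mul (𝕜 := ℝ) (𝔸 := ℂ)).contMDiff.comp_contMDiffOn (hf.prodMk_space hg)

theorem smoothSpin.kappa {k : ℕ} {U : Set M} {a : M → Spin k} (ha : smoothSpin n M k U a)
    (i j : SpinIdx k) :
    ContMDiffOn (𝓡 n) 𝓘(ℝ, ℂ) ∞ (fun x => TwistedSpin.kappa k ((a x : (Cl k)ˣ) : Cl k) i j) U := by
  let L : Cl k →ₗ[ℝ] ℂ :=
    (LinearMap.proj j ∘ₗ LinearMap.proj i : (SpinIdx k → SpinIdx k → ℂ) →ₗ[ℝ] ℂ) ∘ₗ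
      (TwistedSpin.kappa k).toLinearMap
  have h : ∀ x, TwistedSpin.kappa k ((a x : (Cl k)ˣ) : Cl k) i j =
      Complex.ofRealCLM ((Complex.reLm ∘ₗ L) ((a x : (Cl k)ˣ) : Cl k)) +
        Complex.ofRealCLM ((Complex.imLm ∘ₗ L) ((a x : (Cl k)ˣ) : Cl k)) * Complex.I :=
    fun x => (Complex.re_add_im _).symm
  simp only [h]
  exact (Complex.ofRealCLM.contMDiff.comp_contMDiffOn (ha _)).add
    (contMDiffOn_mul_complex (Complex.ofRealCLM.contMDiff.comp_contMDiffOn (ha _))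
      contMDiffOn_const)

theorem smoothSpin.herm {r : ℕ} {U : Set M} {a : M → Spin n} {b : M → Spin r}
    (ha : smoothSpin n M n U a) (hb : smoothSpin n M r U b) (φ : TwistedSpinor r n) :
    ContMDiffOn (𝓡 n) 𝓘(ℝ, ℂ) ∞ (fun x => TwistedSpin.herm (spinAct (a x, b x, 1) φ) φ) U := by
  have h : ∀ x, TwistedSpin.herm (spinAct (a x, b x, 1) φ) φ = ∑ i, (∑ j,
      TwistedSpin.kappa r ((b x : (Cl r)ˣ) : Cl r) i.1 j.1 *
        TwistedSpin.kappa n ((a x : (Cl n)ˣ) : Cl n) i.2 j.2 * φ j) * star (φ i) := by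
    intro x
    rw [← repCR_mk]
    simp only [TwistedSpin.herm, dotProduct, Matrix.mulVec, Pi.star_apply]
    refine Finset.sum_congr rfl fun i _ => ?_
    congr 1
    refine Finset.sum_congr rfl fun j _ => ?_
    change (((1 : Circle) : ℂ) • (TwistedSpin.kappa r _ ⊗ₖ TwistedSpin.kappa n _)) i j * φ j = _
    rw [Circle.coe_one, one_smul, Matrix.kroneckerMap_apply]
  simp only [h]
  exact contMDiffOn_finsetSum fun i _ => contMDiffOn_mul_complex
    (contMDiffOn_finsetSum fun j _ => contMDiffOn_mul_complex
      (contMDiffOn_mul_complex (hb.kappa i.1 j.1) (ha.kappa i.2 j.2)) contMDiffOn_const)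
    contMDiffOn_const

theorem spinAct_sign {r : ℕ} {a a' : Spin n} {b b' : Spin r} {φ : TwistedSpinor r n}
    (ha : spinCover n a = spinCover n a') (hb : spinCover r b = spinCover r b') (z : Circle) :
    spinAct (a, b, z) φ = spinAct (a', b', z) φ ∨ spinAct (a, b, z) φ = -spinAct (a', b', z) φ := by
  have h1 : ∀ (a : Spin n) (ψ : TwistedSpinor r n),
      clHom r n (((Spin.negOne n * a : Spin n) : (Cl n)ˣ) : Cl n) ψ =
        -clHom r n ((a : (Cl n)ˣ) : Cl n) ψ := fun a ψ => by simp [Spin.negOne]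
  have h2 : ∀ (b : Spin r) (ψ : TwistedSpinor r n),
      twHom r n (((Spin.negOne r * b : Spin r) : (Cl r)ˣ) : Cl r) ψ =
        -twHom r n ((b : (Cl r)ˣ) : Cl r) ψ := fun b ψ => by simp [Spin.negOne]
  simp only [spinAct_apply]
  rcases Spin.eq_or_eq_negOne_mul ha with rfl | rfl <;>
    rcases Spin.eq_or_eq_negOne_mul hb with rfl | rfl
  · exact Or.inl rfl
  · exact Or.inr (by rw [h2, smul_neg])
  · exact Or.inr (by rw [h1, map_neg, smul_neg])
  · exact Or.inl (by rw [h2, h1, map_neg, neg_neg])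

theorem smoothCircle_coverCR {r : ℕ} {U : Set M} {g : M → SpinCR n r}
    (hg : smoothSpinCR n M r U g) : smoothCircle n M U (fun x => (coverCR n r (g x)).2.2) := by
  refine contMDiffOn_of_locally_contMDiffOn fun x₀ hx₀ => ?_
  obtain ⟨W, hW, hxW, a, b, z, -, -, hz, h⟩ := hg x₀ hx₀
  refine ⟨W, hW, hxW, (contMDiffOn_mul_complex hz hz).congr fun x hx => ?_⟩
  change (((coverCR n r (g x)).2.2 : Circle) : ℂ) = _
  rw [h x hx, coverCR_mk]
  change (((z x) ^ 2 : Circle) : ℂ) = _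
  rw [pow_two, Circle.coe_mul]

end Smooth

section SmoothStabilizer

variable {m r : ℕ} {M : Type*} [TopologicalSpace M]
  [ChartedSpace (EuclideanSpace ℝ (Fin (2 * m + r))) M] {U : Set M}
  {g : M → SpinCR (2 * m + r) r}

/-- On the stabilizers the SO(r) component is the lower right block of the SO(n) component. -/
theorem smoothSO_coverCR_snd (hg : ∀ x ∈ U, ∃ σ, g x ∈ stabilizer m r σ)
    (hA : smoothSO (2 * m + r) M (2 * m + r) U (fun x => (coverCR _ r (g x)).1)) :
    smoothSO (2 * m + r) M r U (fun x => (coverCR _ r (g x)).2.1) := by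
  intro i j
  refine (hA (Fin.natAdd (2 * m) i) (Fin.natAdd (2 * m) j)).congr fun x hx => ?_
  obtain ⟨σ, -, h⟩ := hg x hx
  have h1 := congrFun (h (e j)) (Fin.natAdd (2 * m) i)
  rw [inU_natAdd, inU_e] at h1
  simpa using h1.symm

/-- A map to the stabilizers is smooth if it covers a smooth map to the orthogonal group. -/
theorem smoothSpinCR_of_stabilizer {σ : M → Bool} (hg : ∀ x ∈ U, g x ∈ stabilizer m r (σ x))
    (hσ : ∀ x ∈ U, ∀ y ∈ U, σ x = σ y)
    (hA : smoothSO (2 * m + r) M (2 * m + r) U (fun x => (coverCR _ r (g x)).1)) :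
    smoothSpinCR (2 * m + r) M r U g := by
  intro x₀ hx₀
  have hB := smoothSO_coverCR_snd (fun x hx => ⟨σ x, hg x hx⟩) hA
  obtain ⟨u₀, hu₀⟩ := QuotientGroup.mk_surjective (g x₀)
  obtain ⟨W₁, hW₁, hxW₁, a, ha, hcov_a⟩ := exists_smooth_lift hA hx₀ u₀.1 (by
    rw [← hu₀, coverCR_mk])
  obtain ⟨W₂, hW₂, hxW₂, b, hb, hcov_b⟩ := exists_smooth_lift hB hx₀ u₀.2.1 (by
    rw [← hu₀, coverCR_mk])
  set φ := stdSpinor m r (σ x₀) with hφ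
  have hunit : herm φ φ = 1 := (stdSpinor_spec m r (σ x₀)).pure.unit
  -- The smooth lifts differ from the components of a representative of `g x` by signs, so its phase
  -- works up to sign.
  have hz : ∀ x, ∃ z : Circle, x ∈ U ∩ (W₁ ∩ W₂) → spinAct (a x, b x, z) φ = φ := by
    intro x
    by_cases hx : x ∈ U ∩ (W₁ ∩ W₂)
    · obtain ⟨u, hu⟩ := QuotientGroup.mk_surjective (g x)
      have h1 : spinAct u φ = φ := by
        have := (hg x hx.1).1
        rwa [hσ x hx.1 x₀ hx₀, ← hu, repCR_mk] at this
      have h2 : spinCover _ (a x) = spinCover _ u.1 := by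
        rw [hcov_a x ⟨hx.1, hx.2.1⟩, ← hu, coverCR_mk]
      have h3 : spinCover _ (b x) = spinCover _ u.2.1 := by
        rw [hcov_b x ⟨hx.1, hx.2.2⟩, ← hu, coverCR_mk]
      rcases spinAct_sign (φ := φ) h2 h3 u.2.2 with h4 | h4
      · exact ⟨u.2.2, fun _ => h4.trans h1⟩
      · refine ⟨-u.2.2, fun _ => ?_⟩
        have h5 : spinAct (a x, b x, -u.2.2) φ = -spinAct (a x, b x, u.2.2) φ := by
          rw [spinAct_apply, spinAct_apply, Circle.coe_neg, neg_smul]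
        rw [h5, h4, neg_neg]
        exact h1
    · exact ⟨1, fun h => absurd h hx⟩
  choose z hz using hz
  have hmono₁ : U ∩ (W₁ ∩ W₂) ⊆ U ∩ W₁ := fun x hx => ⟨hx.1, hx.2.1⟩
  have hmono₂ : U ∩ (W₁ ∩ W₂) ⊆ U ∩ W₂ := fun x hx => ⟨hx.1, hx.2.2⟩
  refine ⟨W₁ ∩ W₂, hW₁.inter hW₂, ⟨hxW₁, hxW₂⟩, a, b, z, ha.mono hmono₁, hb.mono hmono₂, ?_, ?_⟩
  · refine (Complex.conjCLE.toContinuousLinearMap.contMDiff.comp_contMDiffOn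
      ((ha.mono hmono₁).herm (hb.mono hmono₂) φ)).congr fun x hx => ?_
    -- The phase is the inverse of this expectation value, hence its complex conjugate, and so
    -- depends smoothly on x.
    have h1 : (z x : ℂ) * herm (spinAct (a x, b x, 1) φ) φ = 1 := by
      rw [← herm_smul_left]
      have : (z x : ℂ) • spinAct (a x, b x, 1) φ = φ := by
        have h2 := hz x hx
        rw [spinAct_apply] at h2 ⊢
        simpa using h2
      rw [this, hunit]
    change (z x : ℂ) = (starRingEnd ℂ) (herm (spinAct (a x, b x, 1) φ) φ)
    rw [eq_inv_of_mul_eq_one_right h1, ← Circle.coe_inv, ← Circle.coe_inv_eq_conj, inv_inv]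
  · intro x hx
    refine stabilizer_ext (hg x hx.1) ?_ ?_
    · rw [hσ x hx.1 x₀ hx₀]
      refine ⟨by rw [repCR_mk]; exact hz x hx, fun v => ?_⟩
      rw [coverCR_mk]
      change (spinCover _ (a x)).1 *ᵥ _ = inU m ((spinCover _ (b x)).1 *ᵥ v)
      rw [hcov_a x (hmono₁ hx), hcov_b x (hmono₂ hx)]
      exact (hg x hx.1).2 v
    · rw [coverCR_mk]
      exact (hcov_a x (hmono₁ hx)).symm

end SmoothStabilizer

/-! ### The twisted spin structure of an almost CR hermitian structure -/

/-- The trivial family of torsors, with the atlas given by a set of functions to the structure group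
that differ by smooth ones. -/
def PrincipalBundle.ofSections {M : Type*} [TopologicalSpace M] {G : Type} [Group G]
    {Sm : SmoothMaps M G} (𝒜 : Set (Set M × (M → G))) (isOpen : ∀ c ∈ 𝒜, IsOpen c.1)
    (cover : ∀ x, ∃ c ∈ 𝒜, x ∈ c.1)
    (smooth : ∀ c ∈ 𝒜, ∀ d ∈ 𝒜, Sm (c.1 ∩ d.1) (fun x => (c.2 x)⁻¹ * d.2 x)) :
    PrincipalBundle M G Sm where
  Fiber := fun _ => G
  act := fun p g => p * g
  act_one := mul_one
  act_mul := fun p g h => (mul_assoc p g h).symm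
  simply_transitive := fun p q =>
    ⟨p⁻¹ * q, mul_inv_cancel_left p q, fun _ hg => eq_inv_mul_of_mul_eq hg⟩
  atlas := 𝒜
  isOpen := isOpen
  cover := cover
  transition := fun c hc d hd =>
    ⟨_, smooth c hc d hd, fun x _ => (mul_inv_cancel_left (c.2 x) (d.2 x)).symm⟩

namespace SpinCRStructure

variable {n r : ℕ} {M : Type*} [TopologicalSpace M] [ChartedSpace (EuclideanSpace ℝ (Fin n)) M]
  [IsManifold (𝓡 n) ∞ M] [Bundle.RiemannianBundle (fun x : M => TangentSpace (𝓡 n) x)]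
  {o : ManifoldOrientation n M} (S : SpinCRStructure o r)

/-- An element of the twisted spinor bundle is partially pure if one representative is. -/
theorem isPartiallyPureAt_mk {x : M} (p : S.P.Fiber x) {v : {v : TwistedSpinor r n // InSigma v}}
    (hv : IsPartiallyPure v.1) : S.IsPartiallyPureAt (S.mkSpinor p v) := by
  let pure : S.SpinorFiber x → Prop := Quot.lift (fun a => IsPartiallyPure a.2.1) (by
    rintro ⟨p, v⟩ ⟨q, w⟩ ⟨g, -, hw⟩
    change w.1 = _ *ᵥ v.1 at hw
    refine propext ⟨fun h => ?_, fun h => ?_⟩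
    · change IsPartiallyPure w.1
      obtain ⟨u, rfl⟩ := QuotientGroup.mk_surjective g
      rw [hw, repCR_mk]
      exact h.spinAct u
    · change IsPartiallyPure v.1
      have hv : v.1 = repCR n r g⁻¹ *ᵥ w.1 := by
        rw [hw, Matrix.mulVec_mulVec, ← map_mul, inv_mul_cancel, map_one, Matrix.one_mulVec]
      obtain ⟨u, hu⟩ := QuotientGroup.mk_surjective g⁻¹
      rw [hv, ← hu, repCR_mk]
      exact h.spinAct u)
  intro q w h
  have h1 : pure (S.mkSpinor p v) := hv
  rw [h] at h1
  exact h1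

end SpinCRStructure

namespace AlmostCRHermitian

variable {m r : ℕ} {M : Type*} [TopologicalSpace M]
  [ChartedSpace (EuclideanSpace ℝ (Fin (2 * m + r))) M]
  [IsManifold (𝓡 (2 * m + r)) ∞ M]
  [Bundle.RiemannianBundle (fun x : M => TangentSpace (𝓡 (2 * m + r)) x)]
  {o : ManifoldOrientation (2 * m + r) M}

/-- The functions to the stabilizers of the standard model spinors that map a family of adapted
frames, which need not be continuous, to smooth adapted frames. -/
def adaptedSections (σ : M → Bool) (f : (x : M) → Frame o x) :
    Set (Set M × (M → SpinCR (2 * m + r) r)) :=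
  {c | IsOpen c.1 ∧ (∀ x ∈ c.1, c.2 x ∈ stabilizer m r (σ x)) ∧
    (∀ x ∈ c.1, ∀ y ∈ c.1, σ x = σ y) ∧
    ∀ i, SmoothField c.1 fun x => ((f x).act (coverCR _ r (c.2 x)).1).1 i}

theorem adaptedSections_mem_stabilizer {σ : M → Bool} {f : (x : M) → Frame o x}
    {c d : Set M × (M → SpinCR (2 * m + r) r)} (hc : c ∈ adaptedSections σ f)
    (hd : d ∈ adaptedSections σ f) :
    ∀ x ∈ c.1 ∩ d.1, (c.2 x)⁻¹ * d.2 x ∈ stabilizer m r (σ x) := fun x hx =>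
  mul_mem (inv_mem (hc.2.1 x hx.1)) (hd.2.1 x hx.2)

variable [IsContMDiffRiemannianBundle (𝓡 (2 * m + r)) ∞ (EuclideanSpace ℝ (Fin (2 * m + r)))
    (fun x : M => TangentSpace (𝓡 (2 * m + r)) x)]

/-- A local smooth adapted frame has the same type as the chosen frames, so at every point the
change of frame commutes with the standard structure and lifts to the stabilizer. -/
theorem exists_mem_adaptedSections {C : AlmostCRHermitian (2 * m + r) M r} (hn : 0 < 2 * m + r)
    {σ : M → Bool} {f : (x : M) → Frame o x} (hf : ∀ x, C.IsAdapted (σ x) (f x).1) (x₀ : M) :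
    ∃ c ∈ adaptedSections σ f, x₀ ∈ c.1 := by
  obtain ⟨τ, W, hW, hxW, w, hw, h⟩ := C.exists_adapted_frame hn o x₀
  have hτ : ∀ x ∈ W, σ x = τ := fun x hx => by
    obtain ⟨f', -, hf'⟩ := h x hx
    exact (hf x).type_unique hn hf'
  have hg : ∀ x, ∃ g : SpinCR (2 * m + r) r, x ∈ W → g ∈ stabilizer m r (σ x) ∧
      ∀ i, ((f x).act (coverCR _ r g).1).1 i = w i x := by
    intro x
    by_cases hx : x ∈ W
    · obtain ⟨f', hf'w, hf'⟩ := h x hx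
      rw [← hτ x hx] at hf'
      obtain ⟨g, hg, hgf⟩ := exists_mem_stabilizer ((hf x).trans_commute hf')
      exact ⟨g, fun _ => ⟨hg, fun i => by rw [hgf, Frame.act_trans, hf'w]⟩⟩
    · exact ⟨1, fun h => absurd h hx⟩
  choose g hg using hg
  exact ⟨(W, g), ⟨hW, fun x hx => (hg x hx).1, fun x hx y hy => (hτ x hx).trans (hτ y hy).symm,
    fun i => (hw i).congr fun x hx => (hg x hx).2 i⟩, hxW⟩

section Transition

variable {σ : M → Bool} {f : (x : M) → Frame o x} {c d : Set M × (M → SpinCR (2 * m + r) r)}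

/-- This is the transition matrix between two smooth orthonormal frames; its entries are their inner
products, and the arbitrary frames f cancel. -/
theorem smoothSO_adaptedSections (hc : c ∈ adaptedSections σ f) (hd : d ∈ adaptedSections σ f) :
    smoothSO (2 * m + r) M (2 * m + r) (c.1 ∩ d.1)
      (fun x => (coverCR _ r ((c.2 x)⁻¹ * d.2 x)).1) := by
  intro i j
  have h : ∀ x, ((f x).act (coverCR _ r (c.2 x)).1).trans ((f x).act (coverCR _ r (d.2 x)).1) =
      (coverCR _ r ((c.2 x)⁻¹ * d.2 x)).1 := fun x => by
    refine Frame.trans_eq fun k => ?_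
    have h1 : (coverCR _ r (d.2 x)).1 =
        (coverCR _ r (c.2 x)).1 * (coverCR _ r ((c.2 x)⁻¹ * d.2 x)).1 := by
      rw [← Prod.fst_mul, ← map_mul, mul_inv_cancel_left]
    rw [h1, ← Frame.act_act, Frame.act_apply]
  refine (((hc.2.2.2 i).mono Set.inter_subset_left).inner
    ((hd.2.2.2 j).mono Set.inter_subset_right)).congr fun x _ => ?_
  change (coverCR _ r ((c.2 x)⁻¹ * d.2 x)).1.1 i j = _
  rw [← h x]
  exact Frame.trans_apply _ _ i j

theorem smoothSpinCR_adaptedSections (hc : c ∈ adaptedSections σ f)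
    (hd : d ∈ adaptedSections σ f) :
    smoothSpinCR (2 * m + r) M r (c.1 ∩ d.1) (fun x => (c.2 x)⁻¹ * d.2 x) :=
  smoothSpinCR_of_stabilizer (adaptedSections_mem_stabilizer hc hd)
    (fun x hx y hy => hc.2.2.1 x hx.1 y hy.1) (smoothSO_adaptedSections hc hd)

theorem smoothSO_snd_adaptedSections (hc : c ∈ adaptedSections σ f)
    (hd : d ∈ adaptedSections σ f) :
    smoothSO (2 * m + r) M r (c.1 ∩ d.1)
      (fun x => (coverCR _ r (c.2 x)).2.1⁻¹ * (coverCR _ r (d.2 x)).2.1) := by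
  have h := smoothSO_coverCR_snd
    (fun x hx => ⟨σ x, adaptedSections_mem_stabilizer hc hd x hx⟩) (smoothSO_adaptedSections hc hd)
  simpa only [map_mul, map_inv, Prod.snd_mul, Prod.snd_inv, Prod.fst_mul, Prod.fst_inv] using h

theorem smoothCircle_adaptedSections (hc : c ∈ adaptedSections σ f)
    (hd : d ∈ adaptedSections σ f) :
    smoothCircle (2 * m + r) M (c.1 ∩ d.1)
      (fun x => (coverCR _ r (c.2 x)).2.2⁻¹ * (coverCR _ r (d.2 x)).2.2) := by
  have h := smoothCircle_coverCR (smoothSpinCR_adaptedSections hc hd)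
  simpa only [map_mul, map_inv, Prod.snd_mul, Prod.snd_inv] using h

end Transition

variable (C : AlmostCRHermitian (2 * m + r) M r) (hn : 0 < 2 * m + r) {σ : M → Bool}
  {f : (x : M) → Frame o x} (hf : ∀ x, C.IsAdapted (σ x) (f x).1)

/-- The reduction of the frame bundle to adapted frames lifts to the twisted spin group. -/
def spinCRStructure : SpinCRStructure o r where
  -- All three bundles are trivial as families of torsors. Their geometry lies in the atlases, the
  -- images of the adapted sections under the components of `coverCR`.
  PSO := PrincipalBundle.ofSections
    ((fun c => (c.1, fun x => (coverCR _ r (c.2 x)).2.1)) '' adaptedSections σ f)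
    (by rintro _ ⟨c, hc, rfl⟩; exact hc.1)
    (fun x => by
      obtain ⟨c, hc, hx⟩ := exists_mem_adaptedSections hn hf x
      exact ⟨_, ⟨c, hc, rfl⟩, hx⟩)
    (by rintro _ ⟨c, hc, rfl⟩ _ ⟨d, hd, rfl⟩; exact smoothSO_snd_adaptedSections hc hd)
  PU := PrincipalBundle.ofSections
    ((fun c => (c.1, fun x => (coverCR _ r (c.2 x)).2.2)) '' adaptedSections σ f)
    (by rintro _ ⟨c, hc, rfl⟩; exact hc.1)
    (fun x => by
      obtain ⟨c, hc, hx⟩ := exists_mem_adaptedSections hn hf x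
      exact ⟨_, ⟨c, hc, rfl⟩, hx⟩)
    (by rintro _ ⟨c, hc, rfl⟩ _ ⟨d, hd, rfl⟩; exact smoothCircle_adaptedSections hc hd)
  P := PrincipalBundle.ofSections (adaptedSections σ f) (fun _ hc => hc.1)
    (exists_mem_adaptedSections hn hf) (fun _ hc _ hd => smoothSpinCR_adaptedSections hc hd)
  toFrame := fun {x} g => (f x).act (coverCR _ r g).1
  toPSO := fun g => (coverCR _ r g).2.1
  toPU := fun g => (coverCR _ r g).2.2
  toFrame_act := fun {x} (p : SpinCR (2 * m + r) r) g j => by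
    change ((f x).act (coverCR _ r (p * g)).1).1 j = _
    rw [map_mul, Prod.fst_mul, ← Frame.act_act, Frame.act_apply]
  toPSO_act := fun (p : SpinCR (2 * m + r) r) g =>
    congrArg (fun a => a.2.1) (map_mul (coverCR _ r) p g)
  toPU_act := fun (p : SpinCR (2 * m + r) r) g =>
    congrArg (fun a => a.2.2) (map_mul (coverCR _ r) p g)
  toFrame_smooth := fun c hc => hc.2.2.2
  toPSO_smooth := by
    rintro c hc _ ⟨d, hd, rfl⟩
    exact ⟨_, smoothSO_snd_adaptedSections hd hc, fun x _ =>
      (mul_inv_cancel_left (coverCR _ r (d.2 x)).2.1 (coverCR _ r (c.2 x)).2.1).symm⟩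
  toPU_smooth := by
    rintro c hc _ ⟨d, hd, rfl⟩
    exact ⟨_, smoothCircle_adaptedSections hd hc, fun x _ =>
      (mul_inv_cancel_left (coverCR _ r (d.2 x)).2.2 (coverCR _ r (c.2 x)).2.2).symm⟩

/-- The field is the class [1, φ_σ]. The sections s of the atlas take values in the stabilizer of
φ_σ, so it is also [s, φ_σ], and σ is constant on the domain of s. -/
theorem carriesPartiallyPure_spinCRStructure :
    (C.spinCRStructure hn hf).CarriesPartiallyPure := by
  let v : Bool → {v : TwistedSpinor r (2 * m + r) // InSigma v} := fun τ =>
    ⟨stdSpinor m r τ, (stdSpinor_spec m r τ).pure.inSigma⟩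
  refine ⟨fun x => (C.spinCRStructure hn hf).mkSpinor (1 : SpinCR (2 * m + r) r) (v (σ x)),
    fun c hc => ⟨fun x => v (σ x), ?_, fun x hx => ?_⟩, fun x =>
    SpinCRStructure.isPartiallyPureAt_mk _ _ (stdSpinor_spec m r (σ x)).pure⟩
  · rcases c.1.eq_empty_or_nonempty with h | ⟨y, hy⟩
    · rw [h]
      exact fun x hx => hx.elim
    · exact contMDiffOn_const.congr fun x hx => congrArg (fun τ => (v τ).1) (hc.2.2.1 x hx y hy)
  · exact (Quot.sound ⟨c.2 x, (one_mul (M := SpinCR (2 * m + r) r) (c.2 x)).symm,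
      (hc.2.1 x hx).1.symm⟩).symm

theorem exists_carriesPartiallyPure (C : AlmostCRHermitian (2 * m + r) M r) (hn : 0 < 2 * m + r)
    (o : ManifoldOrientation (2 * m + r) M) :
    ∃ S : SpinCRStructure o r, S.CarriesPartiallyPure := by
  have h : ∀ x : M, ∃ (τ : Bool) (f : Frame o x), C.IsAdapted τ f.1 := fun x => by
    obtain ⟨τ, W, -, hx, w, -, h⟩ := C.exists_adapted_frame hn o x
    obtain ⟨f, -, hf⟩ := h x hx
    exact ⟨τ, f, hf⟩
  choose σ f hf using h
  exact ⟨_, C.carriesPartiallyPure_spinCRStructure hn hf⟩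

end AlmostCRHermitian

/-- The twisted spin structure on the empty manifold. -/
theorem SpinCRStructure.exists_of_isEmpty {n r : ℕ} {M : Type*} [TopologicalSpace M]
    [ChartedSpace (EuclideanSpace ℝ (Fin n)) M] [IsManifold (𝓡 n) ∞ M]
    [Bundle.RiemannianBundle (fun x : M => TangentSpace (𝓡 n) x)] [IsEmpty M]
    (o : ManifoldOrientation n M) : ∃ S : SpinCRStructure o r, S.CarriesPartiallyPure :=
  ⟨{ PSO := .ofSections ∅ (fun _ h => h.elim) isEmptyElim (fun _ h => h.elim)
     PU := .ofSections ∅ (fun _ h => h.elim) isEmptyElim (fun _ h => h.elim)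
     P := .ofSections ∅ (fun _ h => h.elim) isEmptyElim (fun _ h => h.elim)
     toFrame := fun {x} => isEmptyElim x
     toPSO := fun {x} => isEmptyElim x
     toPU := fun {x} => isEmptyElim x
     toFrame_act := fun {x} => isEmptyElim x
     toPSO_act := fun {x} => isEmptyElim x
     toPU_act := fun {x} => isEmptyElim x
     toFrame_smooth := fun _ h => h.elim
     toPSO_smooth := fun _ h => h.elim
     toPU_smooth := fun _ h => h.elim },
   isEmptyElim, fun _ h => h.elim, isEmptyElim⟩

theorem AlmostCRHermitian.exists_spinCRStructure {n r : ℕ} (hr : r < n) {M : Type*}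
    [TopologicalSpace M] [ChartedSpace (EuclideanSpace ℝ (Fin n)) M] [IsManifold (𝓡 n) ∞ M]
    [Bundle.RiemannianBundle (fun x : M => TangentSpace (𝓡 n) x)]
    [IsContMDiffRiemannianBundle (𝓡 n) ∞ (EuclideanSpace ℝ (Fin n))
      (fun x : M => TangentSpace (𝓡 n) x)]
    (C : AlmostCRHermitian n M r) (o : ManifoldOrientation n M) :
    ∃ S : SpinCRStructure o r, S.CarriesPartiallyPure := by
  -- On the empty manifold the structure says nothing about the parity of n - r, so n = 2m + r may
  -- fail.
  rcases isEmpty_or_nonempty M with _ | ⟨⟨x⟩⟩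
  · exact SpinCRStructure.exists_of_isEmpty o
  · obtain ⟨m, hm⟩ := even_finrank_of_sq (C.J_J x)
    have h := C.finrank_D x
    obtain rfl : n = 2 * m + r := by omega
    exact C.exists_carriesPartiallyPure (by omega) o

end TwistedSpin
end

theorem mainTheorem1 (n r : ℕ) (hr : r < n) (M : Type*) [TopologicalSpace M] [T2Space M]
    [SecondCountableTopology M] [ChartedSpace (EuclideanSpace ℝ (Fin n)) M]
    [IsManifold (𝓡 n) ∞ M]
    [Bundle.RiemannianBundle (fun x : M => TangentSpace (𝓡 n) x)]
    [IsContMDiffRiemannianBundle (𝓡 n) ∞ (EuclideanSpace ℝ (Fin n))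
      (fun x : M => TangentSpace (𝓡 n) x)]
    (o : TwistedSpin.ManifoldOrientation n M) :
    (∃ S : TwistedSpin.SpinCRStructure o r, S.CarriesPartiallyPure) ↔
      Nonempty (TwistedSpin.AlmostCRHermitian n M r) := by
  constructor
  · rintro ⟨S, φ, hφ, hpp⟩
    exact ⟨S.toAlmostCRHermitian hφ hpp⟩
  · rintro ⟨C⟩
    exact C.exists_spinCRStructure hr o
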